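/- **Model.** Fix $\lambda>0$, an integer $d\ge 1$, a finite label set $Z$, prior probabilities $\pi_i>0$ ($i\in Z$) with $\sum_{i\in Z}\pi_i=1$, and distributions $P_{ij}=P_{ji}$ on $\mathbb R$ ($i,j\in Z$) that are either all discrete, with probability mass functions $p_{ij}$, or all absolutely continuous, with probability density functions $p_{ij}$. For $n\in\mathbb N$, a graph $G\sim\mathrm{GHCM}(\lambda,n,\pi,P,d)$ is sampled as follows. The vertex set $V$ is a homogeneous Poisson point process of intensity $\lambda$ in the cube $[-n^{1/d}/2,n^{1/d}/2]^d$ (that is, a $\mathrm{Poisson}(\lambda n)$ number of independent uniform points). The vertices $u\in V$ receive independent labels $x^\star(u)\in Z$ with law $\pi$. Conditionally on locations and labels, the observations $Y_{uv}=Y_{vu}$, one for each unordered pair of distinct vertices, are independent; $Y_{uv}\sim P_{x^\star(u),x^\star(v)}$ if the toroidal distance of $u$ and $v$, $$\Big(\sum_{c=1}^d \min\{|u_c-v_c|,\,n^{1/d}-|u_c-v_c|\}^2\Big)^{1/2},$$ is at most $(\log n)^{1/d}$, and $Y_{uv}=0$ otherwise. **Exact recovery.** A permutation $\omega$ of $Z$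 is a *permissible relabeling* if $\pi_i=\pi_{\omega(i)}$ and $P_{ij}=P_{\omega(i),\omega(j)}$ for all $i,j\in Z$; let $\Omega_{\pi,P}$ be the set of these. An estimator $\widetilde x$ is, for each $n$, a (possibly randomized) measurable function of the locations and the observations with values in the labelings $V\to Z$. Its agreement with the truth is $A(\widetilde x,x^\star)=\frac1{|V|}\max_{\omega\in\Omega_{\pi,P}}\sum_{u\in V}\mathbf 1\{\widetilde x(u)=\omega(x^\star(u))\}$, and it *achieves exact recovery* if $\lim_{n\to\infty}\mathbb P(A(\widetilde x,x^\star)=1)=1$. **Theorem (Impossibility).** Let $\nu_d$ be the volume of the unit Euclidean ball in $\mathbb R^d$ and, for $\theta_i=(p_{ir})_{r\in Z}$, let $$D_+(\theta_i,\theta_j)=1-\inf_{t\in[0,1]}\sum_{r\in Z}\pi_r\int p_{ir}(y)^t\,p_{jr}(y)^{1-t}\,dy$$ be the Chernoff–Hellinger divergence (with a sum in place of the integral in the discrete case). No estimator achieves exact recovery if (a) $|Z|\ge 2$ and $\lambda\nu_d\min_{i\ne j}D_+(\theta_i,\theta_j)<1$; or (b) $d=1$, $\lambda<1$ and $|\Omega_{\pi,P}|\ge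 2$. -/

import Mathlib

open MeasureTheory ProbabilityTheory Filter Topology

/-- Parameters `(λ, π, P, d)` of the geometric hidden community model with label set `Z`.
The pairwise distributions `P i j` on `ℝ` are given by densities `p i j` with respect to a common
reference measure, which is either Lebesgue measure (the `p i j` are probability density functions)
or counting measure on a countable set (the `p i j` are probability mass functions). -/
structure GHCMParams (Z : Type*) [Fintype Z] where
  /-- intensity of the Poisson point process -/
  lam : ℝ
  lam_pos : 0 < lam
  /-- dimension -/
  d : ℕ
  d_pos : 1 ≤ d
  /-- prior probabilities of the communities -/
  prior : Z → ℝ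
  prior_pos : ∀ i, 0 < prior i
  prior_sum : ∑ i, prior i = 1
  /-- reference measure of the densities -/
  ref : Measure ℝ
  ref_eq : ref = volume ∨ ∃ S : Set ℝ, S.Countable ∧ ref = Measure.count.restrict S
  /-- PDF / PMF of the pairwise distributions -/
  p : Z → Z → ℝ → ℝ
  p_measurable : ∀ i j, Measurable (p i j)
  p_nonneg : ∀ i j y, 0 ≤ p i j y
  p_lintegral : ∀ i j, ∫⁻ y, ENNReal.ofReal (p i j y) ∂ref = 1
  /-- `P i j` and `P j i` are the same distribution -/
  p_symm : ∀ i j, ref.withDensity (fun y => ENNReal.ofReal (p i j y)) =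
    ref.withDensity (fun y => ENNReal.ofReal (p j i y))

/-- Volume `ν_d` of the unit Euclidean ball in dimension `d`. -/
noncomputable def unitBallVolume (d : ℕ) : ℝ :=
  (volume (Metric.ball (0 : EuclideanSpace ℝ (Fin d)) 1)).toReal

/-- Toroidal distance on a cube of side length `L` with opposite faces identified. -/
noncomputable def torusDist {d : ℕ} (L : ℝ) (u v : Fin d → ℝ) : ℝ :=
  √(∑ c, (min |u c - v c| (L - |u c - v c|)) ^ 2)

/-- Unordered pairs of distinct vertices among `N` vertices (each represented once). -/
abbrev VertexPair (N : ℕ) : Type := {e : Fin N × Fin N // e.1 < e.2}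

/-- Locations of `N` vertices in `ℝ^d`. -/
abbrev Locations (d N : ℕ) : Type := Fin N → Fin d → ℝ

/-- A labeling of `N` vertices. -/
abbrev Labeling (Z : Type*) (N : ℕ) : Type _ := Fin N → Z

/-- Pairwise observations, one for each undirected edge. -/
abbrev Observations (N : ℕ) : Type := VertexPair N → ℝ

/-- A labeled graph with `N` vertices: locations, ground truth labels, pairwise observations. -/
abbrev LabeledGraph (Z : Type*) (d N : ℕ) : Type _ :=
  (Locations d N × Labeling Z N) × Observations N

namespace GHCMParams

variable {Z : Type*} [Fintype Z]

/-- The pairwise distribution `P i j`. -/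
noncomputable def P (M : GHCMParams Z) (i j : Z) : Measure ℝ :=
  M.ref.withDensity (fun y => ENNReal.ofReal (M.p i j y))

instance (M : GHCMParams Z) (i j : Z) : IsProbabilityMeasure (M.P i j) :=
  ⟨by rw [P, withDensity_apply _ MeasurableSet.univ, Measure.restrict_univ, M.p_lintegral]⟩

/-- Chernoff–Hellinger divergence `D_+(θ_i, θ_j)` of the vectors `θ_i = (p i r)_r` and
`θ_j = (p j r)_r` with prior `π`. -/
noncomputable def chDiv (M : GHCMParams Z) (i j : Z) : ℝ :=
  1 - ⨅ t : Set.Icc (0 : ℝ) 1,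
    ∑ r, M.prior r * ∫ y, M.p i r y ^ (t : ℝ) * M.p j r y ^ (1 - (t : ℝ)) ∂M.ref

/-- The set of permissible relabelings. -/
def permissible (M : GHCMParams Z) : Set (Equiv.Perm Z) :=
  {ω | (∀ i, M.prior i = M.prior (ω i)) ∧ ∀ i j, M.P i j = M.P (ω i) (ω j)}

/-- Side length `n^{1/d}` of the cube. -/
noncomputable def side (M : GHCMParams Z) (n : ℕ) : ℝ := (n : ℝ) ^ (1 / (M.d : ℝ))

/-- The cube `[-n^{1/d}/2, n^{1/d}/2]^d`. -/
def cube (M : GHCMParams Z) (n : ℕ) : Set (Fin M.d → ℝ) :=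
  Set.Icc (fun _ => -(M.side n) / 2) (fun _ => M.side n / 2)

/-- Two locations are mutually visible if their toroidal distance is at most `(log n)^{1/d}`. -/
def Visible (M : GHCMParams Z) (n : ℕ) (u v : Fin M.d → ℝ) : Prop :=
  torusDist (M.side n) u v ≤ Real.log n ^ (1 / (M.d : ℝ))

open Classical in
/-- Law of the observation between vertices at `u`, `v` with labels `a`, `b`. -/
noncomputable def obsLaw (M : GHCMParams Z) (n : ℕ) (u v : Fin M.d → ℝ) (a b : Z) : Measure ℝ :=
  if M.Visible n u v then M.P a b else Measure.dirac 0

instance (M : GHCMParams Z) (n : ℕ) (u v : Fin M.d → ℝ) (a b : Z) :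
    IsProbabilityMeasure (M.obsLaw n u v a b) := by
  unfold obsLaw; split_ifs <;> infer_instance

lemma measurableSet_visible (M : GHCMParams Z) (n : ℕ) {N : ℕ} (i j : Fin N) :
    MeasurableSet {v : Locations M.d N | M.Visible n (v i) (v j)} := by
  unfold Visible torusDist
  refine measurableSet_le (Continuous.measurable ?_) measurable_const
  fun_prop

variable [MeasurableSpace Z]

/-- Law of one label. -/
noncomputable def labelLaw (M : GHCMParams Z) : Measure Z :=
  ∑ i, ENNReal.ofReal (M.prior i) • Measure.dirac i

instance (M : GHCMParams Z) : IsProbabilityMeasure M.labelLaw := by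
  constructor
  simp only [labelLaw, Measure.finsetSum_apply, Measure.smul_apply, measure_univ, smul_eq_mul,
    mul_one]
  rw [← ENNReal.ofReal_sum_of_nonneg (fun i _ => (M.prior_pos i).le), M.prior_sum,
    ENNReal.ofReal_one]

variable [DiscreteMeasurableSpace Z]

/-- Conditionally on locations and labels, the pairwise observations are independent. -/
noncomputable def obsKernel (M : GHCMParams Z) (n N : ℕ) :
    Kernel (Locations M.d N × Labeling Z N) (Observations N) where
  toFun w := Measure.pi fun e : VertexPair N =>
    M.obsLaw n (w.1 e.1.1) (w.1 e.1.2) (w.2 e.1.1) (w.2 e.1.2)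
  measurable' := by
    classical
    let g : (VertexPair N → Bool) × Labeling Z N → Measure (Observations N) := fun q =>
      Measure.pi fun e : VertexPair N =>
        if q.1 e = true then M.P (q.2 e.1.1) (q.2 e.1.2) else Measure.dirac 0
    have hg : Measurable g := Measurable.of_discrete
    have hf : Measurable fun w : Locations M.d N × Labeling Z N =>
        ((fun e : VertexPair N => decide (M.Visible n (w.1 e.1.1) (w.1 e.1.2))), w.2) := by
      refine Measurable.prodMk (measurable_pi_lambda _ fun e => ?_) measurable_snd
      refine measurable_to_bool ?_
      have h := (M.measurableSet_visible n e.1.1 e.1.2).preimage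
        (measurable_fst : Measurable (Prod.fst : Locations M.d N × Labeling Z N → _))
      convert h using 1
      ext w
      simp
    convert hg.comp hf using 1
    funext w
    simp only [g, Function.comp, obsLaw, decide_eq_true_eq]

instance (M : GHCMParams Z) (n N : ℕ) : IsMarkovKernel (M.obsKernel n N) :=
  ⟨fun w => inferInstanceAs (IsProbabilityMeasure (Measure.pi fun e : VertexPair N =>
    M.obsLaw n (w.1 e.1.1) (w.1 e.1.2) (w.2 e.1.1) (w.2 e.1.2)))⟩

/-- Law of the labeled graph given that there are `N` vertices: the locations are independent and
uniform in the cube, the labels are independent with law `π`, and the observations are drawn from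
`obsKernel`. -/
noncomputable def lawGiven (M : GHCMParams Z) (n N : ℕ) : Measure (LabeledGraph Z M.d N) :=
  ((Measure.pi fun _ : Fin N => ProbabilityTheory.cond volume (M.cube n)).prod
    (Measure.pi fun _ : Fin N => M.labelLaw)) ⊗ₘ M.obsKernel n N

/-- The law of `G ∼ GHCM(λ, n, π, P, d)` together with the ground truth labels. The vertex set is a
homogeneous Poisson point process with intensity `λ` in the cube of volume `n`: a
`Poisson(λ n)` number of independent uniform points. -/
noncomputable def law (M : GHCMParams Z) (n : ℕ) : Measure (Σ N, LabeledGraph Z M.d N) :=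
  Measure.sum fun N =>
    poissonMeasure (Real.toNNReal (M.lam * n)) {N} • (M.lawGiven n N).map (Sigma.mk N)

open Classical in
/-- Agreement `A(x', x)` of an estimate `x'` with a labeling `x`. -/
noncomputable def agreement (M : GHCMParams Z) {N : ℕ} (x' x : Labeling Z N) : ℝ :=
  (1 / (N : ℝ)) * ⨆ ω : M.permissible, ∑ u, if x' u = (ω : Equiv.Perm Z) (x u) then (1 : ℝ) else 0

/-- A (possibly randomized) estimator, for each scale `n`: a measurable function of the locations,
the pairwise observations and an auxiliary random seed. -/
structure Estimator (M : GHCMParams Z) where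
  toFun : (n N : ℕ) → (Locations M.d N × Observations N) × unitInterval → Labeling Z N
  measurable : ∀ n N, Measurable (toFun n N)

/-- The probability of `A(x', x) = 1` at scale `n`; the seed is uniform on `[0, 1]` and
independent of the labeled graph. -/
noncomputable def successProb (M : GHCMParams Z) (est : M.Estimator) (n : ℕ) : ENNReal :=
  ((M.law n).prod (volume : Measure unitInterval))
    {s | M.agreement (est.toFun n s.1.1 ((s.1.2.1.1, s.1.2.2), s.2)) s.1.2.1.2 = 1}

/-- The estimator achieves exact recovery. -/
def ExactRecovery (M : GHCMParams Z) (est : M.Estimator) : Prop :=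
  Tendsto (fun n => M.successProb est n) atTop (𝓝 1)

end GHCMParams

/-!
Up to constants, `n / log n` disjoint balls of radius slightly above the visibility radius
`(log n)^{1/d}` fit in the cube. Consider those balls whose small concentric core contains a single
vertex: every vertex which this one sees lies in the ball. Given the locations, deciding between
two labels `i ≠ j` of this vertex fails with probability about `σ ^ k`, where `k` is its number of
visible neighbors and `σ = 1 - D₊(θᵢ, θⱼ)`: this is Chernoff's lower bound, obtained by tilting the
observations to the minimizing exponent. Averaged over the Poisson vertices, the expected number of
confusions is about `n ^ (1 - λ ν_d D₊) → ∞`, and since the balls are disjoint, the second moment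
method yields a confusion with high probability. Each confusion exhibits another labeling of
comparable posterior mass, so the estimate is wrong with probability bounded away from `0`.

In dimension one with `λ < 1` the same scheme with `σ = 0` and intervals produces arbitrarily many
empty gaps longer than the visibility radius. Cutting the line at two of them disconnects the
visibility graph into two large parts, and a nontrivial permissible relabeling of one part alone
does not change the posterior mass.
-/

/-! ### Product measures and the second moment method -/

section Pi

lemma pi_withDensity_ofReal {ι : Type*} [Fintype ι] {X : ι → Type*}
    [∀ i, MeasurableSpace (X i)] (μ : ∀ i, Measure (X i)) [∀ i, SigmaFinite (μ i)]
    (f : ∀ i, X i → ℝ) (hf : ∀ i, Integrable (f i) (μ i)) (hf0 : ∀ i x, 0 ≤ f i x) :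
    (Measure.pi μ).withDensity (fun z => ENNReal.ofReal (∏ i, f i (z i))) =
      Measure.pi fun i => (μ i).withDensity fun x => ENNReal.ofReal (f i x) := by
  have (i : ι) : IsFiniteMeasure ((μ i).withDensity fun x => ENNReal.ofReal (f i x)) :=
    isFiniteMeasure_withDensity_ofReal (hf i).2
  refine (Measure.pi_eq (μ := fun i => (μ i).withDensity fun x => ENNReal.ofReal (f i x))
    fun s hs => ?_).symm
  rw [withDensity_apply _ (MeasurableSet.univ_pi hs), Measure.restrict_pi_pi,
    ← ofReal_integral_eq_lintegral_ofReal
      (Integrable.fintype_prod_dep fun i => (hf i).restrict)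
      (ae_of_all _ fun z => Finset.prod_nonneg fun i _ => hf0 i _),
    integral_fintype_prod_eq_prod (μ := fun i => (μ i).restrict (s i)),
    ENNReal.ofReal_prod_of_nonneg fun i _ => integral_nonneg (hf0 i)]
  refine Finset.prod_congr rfl fun i _ => ?_
  rw [withDensity_apply _ (hs i), ofReal_integral_eq_lintegral_ofReal (hf i).restrict
    (ae_of_all _ (hf0 i))]

variable {E J K X : Type*} [Fintype E] [MeasurableSpace X] (Q : E → Measure X)
  [∀ e, IsProbabilityMeasure (Q e)]

lemma iIndepFun_pi_eval : iIndepFun (fun e (y : E → X) => y e) (Measure.pi Q) :=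
  iIndepFun_pi (X := fun _ x => x) fun _ => aemeasurable_id

lemma map_comp_pi_of_injective [Fintype J] {φ : J → E} (hφ : Function.Injective φ) :
    (Measure.pi Q).map (fun y j => y (φ j)) = Measure.pi fun j => Q (φ j) := by
  rw [(iIndepFun_iff_map_fun_eq_pi_map fun j => (measurable_pi_apply (φ j)).aemeasurable).1
    ((iIndepFun_pi_eval Q).precomp hφ)]
  simp only [(measurePreserving_eval Q _).map_eq]

lemma indepFun_comp_pi_of_forall_ne {φ : J → E} {ψ : K → E} (h : ∀ j k, φ j ≠ ψ k) :
    IndepFun (fun (y : E → X) j => y (φ j)) (fun y k => y (ψ k)) (Measure.pi Q) := by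
  classical
  let S : Finset E := {e | e ∈ Set.range φ}
  let T : Finset E := {e | e ∈ Set.range ψ}
  have hST : Disjoint S T := by
    simp only [Finset.disjoint_left, S, T, Finset.mem_filter_univ]
    rintro _ ⟨j, rfl⟩ ⟨k, hk⟩
    exact h j k hk.symm
  exact ((iIndepFun_pi_eval Q).indepFun_finset S T hST measurable_pi_apply).comp
    (φ := fun (z : S → X) j => z ⟨φ j, by simp [S]⟩)
    (ψ := fun (z : T → X) k => z ⟨ψ k, by simp [T]⟩) (by fun_prop) (by fun_prop)

end Pi

section SecondMoment

variable {Ω : Type*} [MeasurableSpace Ω] {μ : Measure Ω} [IsProbabilityMeasure μ] {κ : ℝ}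

lemma measureReal_lt_half_integral_le {X : Ω → ℝ} (hX : MemLp X 2 μ) (hpos : 0 < ∫ x, X x ∂μ)
    (h2 : ∫ x, X x ^ 2 ∂μ ≤ ∫ x, X x ∂μ + κ * (∫ x, X x ∂μ) ^ 2) :
    μ.real {x | X x < (∫ x, X x ∂μ) / 2} ≤ 4 / (∫ x, X x ∂μ) + 4 * (κ - 1) := by
  set m := ∫ x, X x ∂μ
  have hsub : {x | X x < m / 2} ⊆ {x | m / 2 ≤ |X x - m|} := fun x (hx : X x < m / 2) =>
    (by linarith : m / 2 ≤ -(X x - m)).trans (neg_le_abs _)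
  have hvar : variance X μ ≤ m + (κ - 1) * m ^ 2 := by
    rw [variance_eq_sub hX]
    simp only [Pi.pow_apply]
    linarith
  calc μ.real {x | X x < m / 2}
      ≤ variance X μ / (m / 2) ^ 2 :=
        ENNReal.toReal_le_of_le_ofReal (div_nonneg (variance_nonneg _ _) (sq_nonneg _))
          ((measure_mono hsub).trans (meas_ge_le_variance_div_sq hX (half_pos hpos)))
    _ ≤ (m + (κ - 1) * m ^ 2) / (m / 2) ^ 2 := by gcongr
    _ = 4 / m + 4 * (κ - 1) := by field_simp; ring

lemma integral_sq_sum_le {ι : Type*} [Fintype ι] {W : ι → Ω → ℝ} (hWm : ∀ c, Measurable (W c))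
    (hW : ∀ c x, W c x ∈ Set.Icc (0 : ℝ) 1) (hκ : 0 ≤ κ)
    (h : Pairwise fun c c' => ∫ x, W c x * W c' x ∂μ ≤ κ * ((∫ x, W c x ∂μ) * ∫ x, W c' x ∂μ)) :
    ∫ x, (∑ c, W c x) ^ 2 ∂μ ≤ ∫ x, ∑ c, W c x ∂μ + κ * (∫ x, ∑ c, W c x ∂μ) ^ 2 := by
  classical
  have hi : ∀ c, Integrable (W c) μ := fun c =>
    .of_mem_Icc 0 1 (hWm c).aemeasurable (ae_of_all _ (hW c))
  have hi₂ : ∀ c c', Integrable (fun x => W c x * W c' x) μ := fun c c' =>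
    .of_mem_Icc 0 1 ((hWm c).mul (hWm c')).aemeasurable
      (ae_of_all _ fun x => unitInterval.mul_mem (hW c x) (hW c' x))
  have h₀ : ∀ c, 0 ≤ ∫ x, W c x ∂μ := fun c => integral_nonneg fun x => (hW c x).1
  have hle : ∀ c c', ∫ x, W c x * W c' x ∂μ ≤
      (if c = c' then ∫ x, W c x ∂μ else 0) + κ * ((∫ x, W c x ∂μ) * ∫ x, W c' x ∂μ) := by
    intro c c'
    split_ifs with hc
    · subst hc
      exact le_add_of_le_of_nonneg (integral_mono (hi₂ c c) (hi c) fun x =>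
        mul_le_of_le_one_left (hW c x).1 (hW c x).2)
        (mul_nonneg hκ (mul_nonneg (h₀ c) (h₀ c)))
    · rw [zero_add]
      exact h hc
  simp_rw [sq, Finset.sum_mul_sum]
  rw [integral_finsetSum _ fun c _ => integrable_finsetSum _ fun c' _ => hi₂ c c',
    integral_finsetSum _ fun c _ => hi c]
  simp_rw [integral_finsetSum _ fun c' _ => hi₂ _ c']
  refine (Finset.sum_le_sum fun c _ => Finset.sum_le_sum fun c' _ => hle c c').trans_eq ?_
  simp_rw [Finset.sum_add_distrib, Finset.sum_ite_eq, Finset.mem_univ, if_true, ← Finset.mul_sum,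
    ← Finset.sum_mul]

lemma measureReal_sum_lt_half_integral_le {ι : Type*} [Fintype ι] {W : ι → Ω → ℝ}
    (hWm : ∀ c, Measurable (W c)) (hW : ∀ c x, W c x ∈ Set.Icc (0 : ℝ) 1) (hκ : 0 ≤ κ)
    (h : Pairwise fun c c' => ∫ x, W c x * W c' x ∂μ ≤ κ * ((∫ x, W c x ∂μ) * ∫ x, W c' x ∂μ))
    (hpos : 0 < ∫ x, ∑ c, W c x ∂μ) :
    μ.real {x | ∑ c, W c x < (∫ x, ∑ c, W c x ∂μ) / 2} ≤
      4 / (∫ x, ∑ c, W c x ∂μ) + 4 * (κ - 1) := by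
  refine measureReal_lt_half_integral_le (memLp_finsetSum _ fun c _ => ?_) hpos
    (integral_sq_sum_le hWm hW hκ h)
  exact .of_bound (hWm c).aestronglyMeasurable 1
    (ae_of_all _ fun x => by simpa [abs_of_nonneg (hW c x).1] using (hW c x).2)

end SecondMoment

/-! ### Chernoff's lower bound for testing two product measures -/

section Chernoff

variable {X T : Type*} [MeasurableSpace X] [Fintype T]

/-- The total mass of the minimum of the product measures `μ^T` and `(L • μ)^T`, that is, twice
the error probability of the optimal test between them at equal priors. -/
noncomputable def testingAffinity (μ : Measure X) (L : X → ℝ) (T : Type*) [Fintype T] : ℝ :=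
  ∫ z, min 1 (∏ l, L (z l)) ∂Measure.pi fun _ : T => μ

lemma min_one_prod_mem_Icc {X T : Type*} [Fintype T] {L : X → ℝ} (hL0 : ∀ x, 0 ≤ L x) (z : T → X) :
    min 1 (∏ l, L (z l)) ∈ Set.Icc (0 : ℝ) 1 :=
  ⟨le_min zero_le_one (Finset.prod_nonneg fun _ _ => hL0 _), min_le_left _ _⟩

lemma measurable_min_one_prod {L : X → ℝ} (hL : Measurable L) :
    Measurable fun z : T → X => min 1 (∏ l, L (z l)) := by fun_prop

lemma integrable_min_one_prod {μ : Measure X} [IsFiniteMeasure μ] {L : X → ℝ} (hL : Measurable L)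
    (hL0 : ∀ x, 0 ≤ L x) :
    Integrable (fun z : T → X => min 1 (∏ l, L (z l))) (Measure.pi fun _ => μ) :=
  .of_mem_Icc 0 1 (measurable_min_one_prod hL).aemeasurable
    (ae_of_all _ (min_one_prod_mem_Icc hL0))

lemma testingAffinity_restrict_le {μ : Measure X} [IsFiniteMeasure μ] {L L' : X → ℝ}
    (hL : Measurable L) (hL0 : ∀ x, 0 ≤ L x) {A : Set X} (hA : MeasurableSet A)
    (h : ∀ x ∈ A, L' x = L x) :
    testingAffinity (μ.restrict A) L' T ≤ testingAffinity μ L T := by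
  rw [testingAffinity, ← Measure.restrict_pi_pi, setIntegral_congr_fun
    (MeasurableSet.univ_pi fun _ => hA) (g := fun z : T → X => min 1 (∏ l, L (z l)))
    fun z hz => by simp only [h _ (hz _ (Set.mem_univ _))]]
  exact setIntegral_le_integral (integrable_min_one_prod hL hL0)
    (ae_of_all _ fun z => (min_one_prod_mem_Icc hL0 z).1)

lemma mul_nonpos_and_nonneg_of_isMinOn_Icc {f : ℝ → ℝ} {s f' : ℝ} (hs : s ∈ Set.Icc (0 : ℝ) 1)
    (h : IsMinOn f (Set.Icc 0 1) s) (hf : HasDerivAt f f' s) :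
    s * f' ≤ 0 ∧ 0 ≤ (1 - s) * f' := by
  have key : ∀ t ∈ Set.Icc (0 : ℝ) 1, 0 ≤ (t - s) * f' := fun t ht => by
    simpa using h.localize.hasFDerivWithinAt_nonneg hf.hasFDerivAt.hasFDerivWithinAt
      (sub_mem_posTangentConeAt_of_segment_subset ((convex_Icc 0 1).segment_subset hs ht))
  exact ⟨by linarith [key 0 ⟨le_rfl, zero_le_one⟩], key 1 ⟨zero_le_one, le_rfl⟩⟩

lemma integral_pi_eq_integral_pi_tilted {η : Measure X} [IsFiniteMeasure η] [NeZero η] {Y : X → ℝ}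
    {s : ℝ} (hi : Integrable (fun x => Real.exp (s * Y x)) η) (F : (T → X) → ℝ) :
    ∫ z, F z ∂(Measure.pi fun _ : T => η) =
      ∫ z, mgf Y η s ^ Fintype.card T * (Real.exp (-(s * ∑ l, Y (z l))) * F z)
        ∂(Measure.pi fun _ : T => η.tilted fun x => s * Y x) := by
  have hpos : 0 < mgf Y η s := mgf_pos' (NeZero.ne η) hi
  have hdens : (Measure.pi fun _ : T => η.tilted fun x => s * Y x) =
      (Measure.pi fun _ : T => η).withDensity
        fun z => ENNReal.ofReal (∏ l, (Real.exp (s * Y (z l)) / mgf Y η s)) :=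
    (pi_withDensity_ofReal (fun _ : T => η) (fun _ x => Real.exp (s * Y x) / mgf Y η s)
      (fun _ => hi.div_const _) fun _ x => by positivity).symm
  have hm : AEMeasurable (fun z : T → X => ∏ l, (Real.exp (s * Y (z l)) / mgf Y η s))
      (Measure.pi fun _ : T => η) :=
    (Integrable.fintype_prod fun _ => hi.div_const (mgf Y η s)).aestronglyMeasurable.aemeasurable
  rw [hdens, integral_withDensity_eq_integral_toReal_smul₀ hm.ennreal_ofReal
    (ae_of_all _ fun _ => ENNReal.ofReal_lt_top)]
  refine integral_congr_ae (ae_of_all _ fun z => ?_)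
  have hnonneg : 0 ≤ ∏ l, (Real.exp (s * Y (z l)) / mgf Y η s) :=
    Finset.prod_nonneg fun _ _ => by positivity
  simp only [ENNReal.toReal_ofReal hnonneg, smul_eq_mul]
  rw [Finset.prod_div_distrib, ← Real.exp_sum, ← Finset.mul_sum, Finset.prod_const,
    Finset.card_univ, Real.exp_neg]
  field_simp

lemma half_le_measureReal_abs_sum_sub_lt {τ : Measure X} [IsProbabilityMeasure τ] {Y : X → ℝ}
    (hY : MemLp Y 2 τ) {δ : ℝ} (hδ : 0 < δ) [Nonempty T]
    (hT : 2 * variance Y τ ≤ δ ^ 2 * Fintype.card T) :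
    1 / 2 ≤ (Measure.pi fun _ : T => τ).real
      {z | |∑ l, Y (z l) - Fintype.card T * ∫ x, Y x ∂τ| < δ * Fintype.card T} := by
  set τT := Measure.pi fun _ : T => τ
  set k : ℝ := (Fintype.card T : ℝ)
  have hk : 0 < k := Nat.cast_pos.2 Fintype.card_pos
  let S : (T → X) → ℝ := ∑ l, fun z => Y (z l)
  have hSL : MemLp S 2 τT := memLp_finsetSum' _ fun l _ =>
    hY.comp_measurePreserving (measurePreserving_eval _ l)
  have hmean : ∫ z, S z ∂τT = k * ∫ x, Y x ∂τ := by
    simp only [S, Finset.sum_apply]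
    rw [integral_finsetSum _ fun l _ => integrable_comp_eval (μ := fun _ => τ)
      (hY.integrable one_le_two)]
    simp [k, integral_comp_eval (μ := fun _ : T => τ) hY.aestronglyMeasurable]
  have hvar : variance S τT = k * variance Y τ := by
    rw [variance_sum_pi (μ := fun _ : T => τ) (X := fun _ => Y) fun _ => hY]
    simp [k]
  have hcompl : τT.real {z | δ * k ≤ |S z - k * ∫ x, Y x ∂τ|} ≤ 1 / 2 := by
    have hcheb := meas_ge_le_variance_div_sq hSL (mul_pos hδ hk)
    rw [hmean, hvar] at hcheb
    refine ENNReal.toReal_le_of_le_ofReal (by norm_num)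
      (hcheb.trans (ENNReal.ofReal_le_ofReal ?_))
    rw [div_le_iff₀ (by positivity)]
    nlinarith
  have hae : NullMeasurableSet {z | δ * k ≤ |S z - k * ∫ x, Y x ∂τ|} τT :=
    nullMeasurableSet_le aemeasurable_const
      (hSL.aestronglyMeasurable.aemeasurable.sub_const _).abs
  have hset : {z : T → X | |∑ l, Y (z l) - k * ∫ x, Y x ∂τ| < δ * k} =
      {z | δ * k ≤ |S z - k * ∫ x, Y x ∂τ|}ᶜ := by
    ext z; simp [S]
  rw [hset, probReal_compl_eq_one_sub₀ hae]
  linarith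

section Exponent

variable {s x : ℝ}

lemma exp_neg_mul_mul_min_eq :
    Real.exp (-(s * x)) * min 1 (Real.exp x) =
      min (Real.exp (-(s * x))) (Real.exp ((1 - s) * x)) := by
  rw [mul_min_of_nonneg _ _ (Real.exp_pos _).le, mul_one, ← Real.exp_add]
  ring_nf

lemma exp_neg_le_exp_neg_mul_mul_min {a : ℝ} (h₁ : s * x ≤ a) (h₂ : -a ≤ (1 - s) * x) :
    Real.exp (-a) ≤ Real.exp (-(s * x)) * min 1 (Real.exp x) := by
  rw [exp_neg_mul_mul_min_eq]
  exact le_min (Real.exp_le_exp.2 (neg_le_neg h₁)) (Real.exp_le_exp.2 h₂)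

lemma exp_neg_mul_mul_min_mem_Icc (hs : s ∈ Set.Icc (0 : ℝ) 1) (x : ℝ) :
    Real.exp (-(s * x)) * min 1 (Real.exp x) ∈ Set.Icc (0 : ℝ) 1 := by
  refine ⟨by positivity, ?_⟩
  rw [exp_neg_mul_mul_min_eq, min_le_iff, Real.exp_le_one_iff, Real.exp_le_one_iff]
  rcases le_total 0 x with hx | hx
  · exact .inl (neg_nonpos.2 (mul_nonneg hs.1 hx))
  · exact .inr (mul_nonpos_of_nonneg_of_nonpos (sub_nonneg.2 hs.2) hx)

end Exponent

variable {η : Measure X} [IsFiniteMeasure η] {Y : X → ℝ}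

lemma testingAffinity_exp (η : Measure X) (Y : X → ℝ) :
    testingAffinity η (fun x => Real.exp (Y x)) T =
      ∫ z, min 1 (Real.exp (∑ l, Y (z l))) ∂Measure.pi fun _ : T => η := by
  simp only [testingAffinity, Real.exp_sum]

-- Under the tilted law the sum `S` concentrates at `k * m`, where the first-order conditions on
-- `m` keep both `-s * S` and `(1 - s) * S` above `-δ * k`.
lemma mgf_pow_mul_le_testingAffinity_exp [NeZero η] (hY : Measurable Y) {s : ℝ}
    (hs : s ∈ Set.Icc (0 : ℝ) 1) (hi : Integrable (fun x => Real.exp (s * Y x)) η) {m δ : ℝ}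
    (hm₀ : s * m ≤ 0) (hm₁ : 0 ≤ (1 - s) * m) :
    mgf Y η s ^ Fintype.card T * Real.exp (-(δ * Fintype.card T)) *
        (Measure.pi fun _ : T => η.tilted fun x => s * Y x).real
          {z | |∑ l, Y (z l) - Fintype.card T * m| < δ * Fintype.card T} ≤
      testingAffinity η (fun x => Real.exp (Y x)) T := by
  rw [testingAffinity_exp, integral_pi_eq_integral_pi_tilted hi, integral_const_mul, mul_assoc]
  have : IsProbabilityMeasure (η.tilted fun x => s * Y x) := isProbabilityMeasure_tilted hi
  set τT := Measure.pi fun _ : T => η.tilted fun x => s * Y x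
  set k : ℝ := (Fintype.card T : ℝ)
  set F : (T → X) → ℝ := fun z =>
    Real.exp (-(s * ∑ l, Y (z l))) * min 1 (Real.exp (∑ l, Y (z l)))
  have hF : ∀ z, F z ∈ Set.Icc (0 : ℝ) 1 := fun z => exp_neg_mul_mul_min_mem_Icc hs _
  have hFi : Integrable F τT :=
    .of_mem_Icc 0 1 (Measurable.aemeasurable (by fun_prop)) (ae_of_all _ hF)
  set A := {z : T → X | |∑ l, Y (z l) - k * m| < δ * k}
  have hA : MeasurableSet A := measurableSet_lt (by fun_prop) (by fun_prop)
  have hFA : ∀ z ∈ A, Real.exp (-(δ * k)) ≤ F z := fun z hz => by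
    obtain ⟨h₁, h₂⟩ := abs_lt.1 (show |∑ l, Y (z l) - k * m| < δ * k from hz)
    have hk : 0 ≤ k := Nat.cast_nonneg _
    have hδk : 0 ≤ δ * k := by linarith
    refine exp_neg_le_exp_neg_mul_mul_min ?_ ?_
    · nlinarith [mul_nonneg hs.1 (sub_nonneg.2 h₂.le), mul_nonneg (sub_nonneg.2 hs.2) hδk,
        mul_nonpos_of_nonneg_of_nonpos hk hm₀]
    · nlinarith [mul_nonneg (sub_nonneg.2 hs.2) (sub_nonneg.2 h₁.le), mul_nonneg hs.1 hδk,
        mul_nonneg hk hm₁]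
  refine mul_le_mul_of_nonneg_left ?_ (pow_nonneg mgf_nonneg _)
  calc Real.exp (-(δ * k)) * τT.real A = ∫ _ in A, Real.exp (-(δ * k)) ∂τT := by
        simp [mul_comm]
    _ ≤ ∫ z in A, F z ∂τT :=
        setIntegral_mono_on (integrable_const _).integrableOn hFi.integrableOn hA hFA
    _ ≤ ∫ z, F z ∂τT := setIntegral_le_integral hFi (ae_of_all _ fun z => (hF z).1)

lemma exp_neg_mul_pow_le_testingAffinity_exp (hY : Measurable Y) {B : ℝ} (hB : ∀ x, |Y x| ≤ B)
    (hB0 : 0 ≤ B) :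
    Real.exp (-(B * Fintype.card T)) * η.real Set.univ ^ Fintype.card T ≤
      testingAffinity η (fun x => Real.exp (Y x)) T := by
  have hlow : ∀ z : T → X, Real.exp (-(B * Fintype.card T)) ≤ min 1 (∏ l, Real.exp (Y (z l))) :=
    fun z => by
      have hS : -(B * Fintype.card T) ≤ ∑ l, Y (z l) := by
        simpa [mul_comm] using Finset.sum_le_sum fun l (_ : l ∈ Finset.univ) =>
          (abs_le.1 (hB (z l))).1
      rw [← Real.exp_sum]
      exact le_min (Real.exp_le_one_iff.2 (by simp only [Left.neg_nonpos_iff]; positivity))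
        (Real.exp_le_exp.2 hS)
  calc Real.exp (-(B * Fintype.card T)) * η.real Set.univ ^ Fintype.card T
      = ∫ _ : T → X, Real.exp (-(B * Fintype.card T)) ∂Measure.pi fun _ => η := by
        simp [Measure.real, Measure.pi_univ, mul_comm]
    _ ≤ testingAffinity η (fun x => Real.exp (Y x)) T :=
        integral_mono (integrable_const _)
          (integrable_min_one_prod hY.exp fun _ => (Real.exp_pos _).le) hlow

lemma tilted_mean_of_isMinOn_mgf [NeZero η] (hY : Measurable Y) {B : ℝ} (hB : ∀ x, |Y x| ≤ B)
    {s : ℝ} (hs : s ∈ Set.Icc (0 : ℝ) 1) (hmin : IsMinOn (mgf Y η) (Set.Icc 0 1) s) :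
    s * ∫ x, Y x ∂(η.tilted fun x => s * Y x) ≤ 0 ∧
      0 ≤ (1 - s) * ∫ x, Y x ∂(η.tilted fun x => s * Y x) := by
  have hi : ∀ t, Integrable (fun x => Real.exp (t * Y x)) η := fun t =>
    integrable_exp_mul_of_mem_Icc hY.aemeasurable (ae_of_all _ fun x => abs_le.1 (hB x))
  have hint : s ∈ interior (integrableExpSet Y η) := by
    rw [show integrableExpSet Y η = Set.univ from Set.eq_univ_of_forall hi]
    simp
  have hpos : 0 < mgf Y η s := mgf_pos' (NeZero.ne η) (hi s)
  set m := ∫ x, Y x ∂(η.tilted fun x => s * Y x) with hm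
  have hderiv : HasDerivAt (mgf Y η) (mgf Y η s * m) s := by
    convert hasDerivAt_mgf hint using 1
    rw [hm, integral_tilted_mul_eq_mgf, ← integral_const_mul]
    refine integral_congr_ae (ae_of_all _ fun x => ?_)
    simp only [smul_eq_mul]
    field_simp
  obtain ⟨h₀, h₁⟩ := mul_nonpos_and_nonneg_of_isMinOn_Icc hs hmin hderiv
  rw [mul_left_comm] at h₀ h₁
  exact ⟨nonpos_of_mul_nonpos_right h₀ hpos, nonneg_of_mul_nonneg_right h₁ hpos⟩

lemma exists_pow_le_mgf_pow {σ ρ : ℝ} (hσ : 0 ≤ σ) (h : σ < ρ) :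
    ∃ δ > 0, ∀ k : ℕ, σ ^ k ≤ ρ ^ k * Real.exp (-(δ * k)) := by
  have hlim : Tendsto (fun δ : ℝ => ρ * Real.exp (-δ)) (𝓝[>] 0) (𝓝 ρ) := by
    simpa using (Continuous.tendsto (f := fun δ : ℝ => ρ * Real.exp (-δ)) (by fun_prop) 0).mono_left
      nhdsWithin_le_nhds
  obtain ⟨δ, hδσ, hδ⟩ := ((hlim.eventually (lt_mem_nhds h)).and self_mem_nhdsWithin).exists
  refine ⟨δ, hδ, fun k => ?_⟩
  calc σ ^ k ≤ (ρ * Real.exp (-δ)) ^ k := pow_le_pow_left₀ hσ hδσ.le k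
    _ = ρ ^ k * Real.exp (-(δ * k)) := by
      rw [mul_pow, ← Real.exp_nat_mul, mul_neg, mul_comm (k : ℝ)]

lemma exists_mul_pow_le_testingAffinity_exp (hY : Measurable Y) {B : ℝ} (hB : ∀ x, |Y x| ≤ B)
    {σ : ℝ} (hσ : 0 ≤ σ) (h : ∀ t ∈ Set.Icc (0 : ℝ) 1, σ < mgf Y η t) :
    ∃ c > 0, ∀ (T : Type) [Fintype T],
      c * σ ^ Fintype.card T ≤ testingAffinity η (fun x => Real.exp (Y x)) T := by
  have hσ0 : σ < η.real Set.univ := by simpa using h 0 ⟨le_rfl, zero_le_one⟩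
  have hη : NeZero η := ⟨by rintro rfl; exact absurd hσ0 (by simpa using hσ)⟩
  obtain ⟨x₀⟩ : Nonempty X := η.nonempty_of_neZero
  have hB0 : 0 ≤ B := (abs_nonneg _).trans (hB x₀)
  have hi : ∀ t, Integrable (fun x => Real.exp (t * Y x)) η := fun t =>
    integrable_exp_mul_of_mem_Icc hY.aemeasurable (ae_of_all _ fun x => abs_le.1 (hB x))
  obtain ⟨s, hs, hmin⟩ := isCompact_Icc.exists_isMinOn (Set.nonempty_Icc.2 zero_le_one)
    (continuous_mgf hi).continuousOn (s := Set.Icc (0 : ℝ) 1)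
  have : IsProbabilityMeasure (η.tilted fun x => s * Y x) := isProbabilityMeasure_tilted (hi s)
  have hYL : MemLp Y 2 (η.tilted fun x => s * Y x) :=
    MemLp.of_bound hY.aestronglyMeasurable B (ae_of_all _ hB)
  obtain ⟨hm₀, hm₁⟩ := tilted_mean_of_isMinOn_mgf hY hB hs hmin
  obtain ⟨δ, hδ, hσδ⟩ := exists_pow_le_mgf_pow hσ (h s hs)
  obtain ⟨k₀, hk₀⟩ := exists_nat_gt (2 * variance Y (η.tilted fun x => s * Y x) / δ ^ 2)
  refine ⟨min (1 / 2) (Real.exp (-(B * k₀))), by positivity, fun T _ => ?_⟩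
  rcases lt_or_ge (Fintype.card T) k₀ with hT | hT
  · refine le_trans ?_ (exp_neg_mul_pow_le_testingAffinity_exp hY hB hB0)
    gcongr
    exact (min_le_right _ _).trans (by gcongr)
  · have hk : 2 * variance Y (η.tilted fun x => s * Y x) / δ ^ 2 < Fintype.card T :=
      hk₀.trans_le (mod_cast hT)
    have : Nonempty T := Fintype.card_pos_iff.1 <| Nat.cast_pos.1 <|
      (div_nonneg (mul_nonneg zero_le_two (variance_nonneg _ _)) (sq_nonneg δ)).trans_lt hk
    rw [div_lt_iff₀' (by positivity)] at hk
    refine le_trans ?_ (mgf_pow_mul_le_testingAffinity_exp (δ := δ) hY hs (hi s) hm₀ hm₁)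
    rw [mul_comm]
    refine mul_le_mul (hσδ _) ?_ (by positivity) (mul_nonneg (pow_nonneg mgf_nonneg _)
      (Real.exp_pos _).le)
    exact (min_le_left _ _).trans (half_le_measureReal_abs_sum_sub_lt hYL hδ hk.le)

variable {μ : Measure X} [IsFiniteMeasure μ] {L : X → ℝ}

lemma rpow_le_one_add {x t : ℝ} (hx : 0 ≤ x) (ht : t ∈ Set.Icc (0 : ℝ) 1) : x ^ t ≤ 1 + x := by
  rcases le_total x 1 with h | h
  · linarith [Real.rpow_le_one hx h ht.1]
  · linarith [Real.rpow_le_self_of_one_le h ht.2]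

lemma integrable_rpow_of_mem_Icc (hLi : Integrable L μ) (hL0 : ∀ x, 0 ≤ L x) {t : ℝ}
    (ht : t ∈ Set.Icc (0 : ℝ) 1) : Integrable (fun x => L x ^ t) μ :=
  ((integrable_const 1).add hLi).mono' (hLi.1.aemeasurable.pow_const t).aestronglyMeasurable
    (ae_of_all _ fun x => by
      rw [Real.norm_of_nonneg (Real.rpow_nonneg (hL0 x) t)]
      exact rpow_le_one_add (hL0 x) ht)

-- Restricting to `0 < L` matters only at `t = 0`, where `0 ^ 0 = 1` spoils continuity.
lemma le_setIntegral_rpow_of_mem_Icc (hL : Measurable L) (hL0 : ∀ x, 0 ≤ L x)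
    (hLi : Integrable L μ) {ρ : ℝ} (h : ∀ t ∈ Set.Ioo (0 : ℝ) 1, ρ ≤ ∫ x, L x ^ t ∂μ) {t : ℝ}
    (ht : t ∈ Set.Icc (0 : ℝ) 1) : ρ ≤ ∫ x in {x | 0 < L x}, L x ^ t ∂μ := by
  let Φ : ℝ → ℝ := fun t => ∫ x in {x | 0 < L x}, L x ^ t ∂μ
  have hΦ : ContinuousWithinAt Φ (Set.Icc 0 1) t := by
    refine continuousWithinAt_of_dominated (bound := fun x => 1 + L x)
      (.of_forall fun t => (hL.pow_const t).aestronglyMeasurable) ?_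
      ((integrable_const 1).add hLi).integrableOn ?_
    · filter_upwards [self_mem_nhdsWithin] with t ht
      refine ae_of_all _ fun x => ?_
      rw [Real.norm_of_nonneg (Real.rpow_nonneg (hL0 x) t)]
      exact rpow_le_one_add (hL0 x) ht
    · exact (ae_restrict_iff' (measurableSet_lt measurable_const hL)).2 <| ae_of_all _ fun x hx =>
        (Real.continuous_const_rpow (ne_of_gt hx)).continuousWithinAt
  have hcl : t ∈ closure (Set.Ioo (0 : ℝ) 1) := by rwa [closure_Ioo zero_ne_one]
  refine ContinuousWithinAt.closure_le hcl continuousWithinAt_const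
    (hΦ.mono Set.Ioo_subset_Icc_self) fun s hs => (h s hs).trans_eq ?_
  refine (setIntegral_eq_integral_of_forall_compl_eq_zero fun x hx => ?_).symm
  rw [le_antisymm (not_lt.1 hx) (hL0 x), Real.zero_rpow hs.1.ne']

lemma exists_forall_lt_of_monotone {α : Type*} [TopologicalSpace α] {K : Set α} (hK : IsCompact K)
    {f : ℕ → α → ℝ} (hf : ∀ n, Continuous (f n)) (hmono : Monotone f) {σ : ℝ}
    (h : ∀ t ∈ K, ∃ n, σ < f n t) : ∃ n, ∀ t ∈ K, σ < f n t :=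
  hK.elim_directed_cover (fun n => {t | σ < f n t})
    (fun n => isOpen_lt continuous_const (hf n)) (fun t ht => Set.mem_iUnion.2 (h t ht))
    (directed_of_isDirected_le fun _ _ hmn t ht => lt_of_lt_of_le ht (hmono hmn t))

section Truncation

variable {X : Type*} (L : X → ℝ)

/-- The set where the logarithm of the likelihood ratio `L` is at most `n` in absolute value. -/
def logBounded (n : ℕ) : Set X := {x | 0 < L x ∧ |Real.log (L x)| ≤ n}

/-- The logarithm of the likelihood ratio `L`, set to `0` outside `logBounded L n`. -/
noncomputable def truncatedLog (n : ℕ) : X → ℝ :=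
  (logBounded L n).indicator fun x => Real.log (L x)

variable {L}

lemma logBounded_mono : Monotone (logBounded L) := fun _ _ hmn _ hx =>
  ⟨hx.1, hx.2.trans (mod_cast hmn)⟩

lemma iUnion_logBounded : ⋃ n, logBounded L n = {x | 0 < L x} := by
  ext x
  simp only [Set.mem_iUnion, logBounded, Set.mem_ofPred_eq, exists_and_left, and_iff_left_iff_imp]
  exact fun _ => exists_nat_ge _

lemma abs_truncatedLog_le (n : ℕ) (x : X) : |truncatedLog L n x| ≤ n := by
  by_cases hx : x ∈ logBounded L n
  · rw [truncatedLog, Set.indicator_of_mem hx]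
    exact hx.2
  · simp [truncatedLog, hx]

lemma exp_truncatedLog_mul {n : ℕ} {x : X} (hx : x ∈ logBounded L n) (t : ℝ) :
    Real.exp (t * truncatedLog L n x) = L x ^ t := by
  rw [truncatedLog, Set.indicator_of_mem hx, Real.rpow_def_of_pos hx.1, mul_comm]

variable [MeasurableSpace X] {μ : Measure X}

lemma measurableSet_logBounded (hL : Measurable L) (n : ℕ) : MeasurableSet (logBounded L n) :=
  (measurableSet_lt measurable_const hL).inter (measurableSet_le hL.log.abs measurable_const)

lemma measurable_truncatedLog (hL : Measurable L) (n : ℕ) : Measurable (truncatedLog L n) :=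
  hL.log.indicator (measurableSet_logBounded hL n)

lemma mgf_truncatedLog (hL : Measurable L) (n : ℕ) (t : ℝ) :
    mgf (truncatedLog L n) (μ.restrict (logBounded L n)) t = ∫ x in logBounded L n, L x ^ t ∂μ :=
  setIntegral_congr_fun (measurableSet_logBounded hL n) fun _ hx => exp_truncatedLog_mul hx t

variable [IsFiniteMeasure μ]

lemma integrable_exp_truncatedLog_mul (hL : Measurable L) (ν : Measure X) [IsFiniteMeasure ν]
    (n : ℕ) (t : ℝ) : Integrable (fun x => Real.exp (t * truncatedLog L n x)) ν :=
  integrable_exp_mul_of_mem_Icc (measurable_truncatedLog hL n).aemeasurable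
    (ae_of_all _ fun x => abs_le.1 (abs_truncatedLog_le n x))

lemma monotone_mgf_truncatedLog (hL : Measurable L) (hL0 : ∀ x, 0 ≤ L x) :
    Monotone fun n => mgf (truncatedLog L n) (μ.restrict (logBounded L n)) := by
  intro m n hmn t
  simp only [mgf_truncatedLog hL]
  have hint : IntegrableOn (fun x => L x ^ t) (logBounded L n) μ :=
    (integrable_exp_truncatedLog_mul hL _ n t).congr <|
      (ae_restrict_iff' (measurableSet_logBounded hL n)).2 <| ae_of_all _ fun _ hx =>
        exp_truncatedLog_mul hx t
  exact setIntegral_mono_set hint (ae_of_all _ fun x => Real.rpow_nonneg (hL0 x) t)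
    (logBounded_mono hmn).eventuallyLE

lemma exists_forall_lt_mgf_truncatedLog (hL : Measurable L) (hL0 : ∀ x, 0 ≤ L x)
    (hLi : Integrable L μ) {σ ρ : ℝ} (hσρ : σ < ρ)
    (h : ∀ t ∈ Set.Ioo (0 : ℝ) 1, ρ ≤ ∫ x, L x ^ t ∂μ) :
    ∃ n, ∀ t ∈ Set.Icc (0 : ℝ) 1,
      σ < mgf (truncatedLog L n) (μ.restrict (logBounded L n)) t := by
  refine exists_forall_lt_of_monotone isCompact_Icc
    (fun n => continuous_mgf (integrable_exp_truncatedLog_mul hL _ n))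
    (monotone_mgf_truncatedLog hL hL0) fun t ht => ?_
  simp only [mgf_truncatedLog hL]
  have hlim := tendsto_setIntegral_of_monotone (measurableSet_logBounded hL) logBounded_mono
    (integrable_rpow_of_mem_Icc hLi hL0 ht).integrableOn
  rw [iUnion_logBounded] at hlim
  exact (hlim.eventually
    (lt_mem_nhds (hσρ.trans_le (le_setIntegral_rpow_of_mem_Icc hL hL0 hLi h ht)))).exists

end Truncation

lemma exists_mul_pow_le_testingAffinity (hL : Measurable L) (hL0 : ∀ x, 0 ≤ L x)
    (hLi : Integrable L μ) {σ ρ : ℝ} (hσ : 0 ≤ σ) (hσρ : σ < ρ)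
    (h : ∀ t ∈ Set.Ioo (0 : ℝ) 1, ρ ≤ ∫ x, L x ^ t ∂μ) :
    ∃ c > 0, ∀ (T : Type) [Fintype T], c * σ ^ Fintype.card T ≤ testingAffinity μ L T := by
  obtain ⟨n, hn⟩ := exists_forall_lt_mgf_truncatedLog hL hL0 hLi hσρ h
  obtain ⟨c, hc, hcT⟩ := exists_mul_pow_le_testingAffinity_exp (measurable_truncatedLog hL n)
    (abs_truncatedLog_le n) hσ hn
  refine ⟨c, hc, fun T _ => (hcT T).trans ?_⟩
  refine testingAffinity_restrict_le hL hL0 (measurableSet_logBounded hL n) fun x hx => ?_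
  simpa using exp_truncatedLog_mul hx 1

lemma zero_pow_card_le_testingAffinity (μ : Measure X) [IsProbabilityMeasure μ]
    (hL0 : ∀ x, 0 ≤ L x) : 0 ^ Fintype.card T ≤ testingAffinity μ L T := by
  rcases isEmpty_or_nonempty T with hT | hT
  · simp [testingAffinity]
  · rw [zero_pow Fintype.card_ne_zero]
    exact integral_nonneg fun z => (min_one_prod_mem_Icc hL0 z).1

end Chernoff

/-! ### Isolated points of an independent sample -/

/-- A small region `core` inside a larger one `outer`. A sample point alone in `core` is *isolated*:
in the application, the points it sees all lie in `outer`. -/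
structure Cell (X : Type*) [MeasurableSpace X] where
  core : Set X
  outer : Set X
  measurableSet_core : MeasurableSet core
  measurableSet_outer : MeasurableSet outer
  core_subset_outer : core ⊆ outer

namespace Cell

variable {X : Type*} [MeasurableSpace X] {N : ℕ} (C : Cell X) (σ : ℝ)

open Classical in
/-- The factor by which a point at `x` multiplies the weight of an isolated point in `C`: it kills
it in the core, and discounts it by `σ` in the rest of the outer region. -/
noncomputable def discount (x : X) : ℝ :=
  if x ∈ C.core then 0 else if x ∈ C.outer then σ else 1

/-- The factor of the point `l` in `isolationTerm`. -/
noncomputable def isolationFactor (u l : Fin N) (x : X) : ℝ :=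
  if l = u then C.core.indicator 1 x else C.discount σ x

/-- If `u` is the only point of the sample in the core, this is `σ ^ k` with `k` the number of
further points in the outer region; otherwise it is zero. -/
noncomputable def isolationTerm (u : Fin N) (v : Fin N → X) : ℝ :=
  ∏ l, C.isolationFactor σ u l (v l)

/-- If the core contains exactly one point of the sample, this is `σ ^ k` with `k` the number of
further points in the outer region; otherwise it is zero. -/
noncomputable def isolationWeight (v : Fin N → X) : ℝ :=
  ∑ u, C.isolationTerm σ u v

variable {C σ} {C' : Cell X} {u u' : Fin N} {v : Fin N → X}

lemma discount_mem_Icc (hσ : σ ∈ Set.Icc (0 : ℝ) 1) (x : X) :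
    C.discount σ x ∈ Set.Icc (0 : ℝ) 1 := by
  unfold discount
  split_ifs
  exacts [⟨le_rfl, zero_le_one⟩, hσ, ⟨zero_le_one, le_rfl⟩]

lemma isolationFactor_mem_Icc (hσ : σ ∈ Set.Icc (0 : ℝ) 1) (u l : Fin N) (x : X) :
    C.isolationFactor σ u l x ∈ Set.Icc (0 : ℝ) 1 := by
  unfold isolationFactor
  split_ifs
  · by_cases hx : x ∈ C.core <;> simp [hx]
  · exact discount_mem_Icc hσ x

lemma isolationTerm_mem_Icc (hσ : σ ∈ Set.Icc (0 : ℝ) 1) (u : Fin N) (v : Fin N → X) :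
    C.isolationTerm σ u v ∈ Set.Icc (0 : ℝ) 1 :=
  unitInterval.prod_mem fun l _ => isolationFactor_mem_Icc hσ u l _

lemma mem_core_of_isolationTerm_ne_zero (h : C.isolationTerm σ u v ≠ 0) : v u ∈ C.core := by
  have hu := Finset.prod_ne_zero_iff.1 h u (Finset.mem_univ u)
  simp only [isolationFactor, if_true] at hu
  exact Set.mem_of_indicator_ne_zero hu

lemma discount_ne_zero_of_isolationTerm_ne_zero (h : C.isolationTerm σ u v ≠ 0) {l : Fin N}
    (hl : l ≠ u) : C.discount σ (v l) ≠ 0 := by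
  have := Finset.prod_ne_zero_iff.1 h l (Finset.mem_univ l)
  rwa [isolationFactor, if_neg hl] at this

lemma notMem_core_of_discount_ne_zero {x : X} (h : C.discount σ x ≠ 0) : x ∉ C.core :=
  fun hx => h (if_pos hx)

lemma notMem_outer_of_discount_ne_zero {x : X} (h : C.discount 0 x ≠ 0) : x ∉ C.outer :=
  fun hx => h (by simp [discount, hx])

lemma isolationTerm_eq_zero_of_ne (hu : u ≠ u') (h : C.isolationTerm σ u v ≠ 0) :
    C.isolationTerm σ u' v = 0 := by
  by_contra h'
  exact notMem_core_of_discount_ne_zero (discount_ne_zero_of_isolationTerm_ne_zero h hu.symm)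
    (mem_core_of_isolationTerm_ne_zero h')

lemma exists_isolationWeight_eq_isolationTerm (h : C.isolationWeight σ v ≠ 0) :
    ∃ u, C.isolationWeight σ v = C.isolationTerm σ u v ∧ C.isolationTerm σ u v ≠ 0 := by
  obtain ⟨u, -, hu⟩ := Finset.exists_ne_zero_of_sum_ne_zero h
  exact ⟨u, Finset.sum_eq_single_of_mem u (Finset.mem_univ u) fun _ _ hu' =>
    isolationTerm_eq_zero_of_ne hu'.symm hu, hu⟩

lemma isolationWeight_mem_Icc (hσ : σ ∈ Set.Icc (0 : ℝ) 1) (v : Fin N → X) :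
    C.isolationWeight σ v ∈ Set.Icc (0 : ℝ) 1 := by
  by_cases h : C.isolationWeight σ v = 0
  · rw [h]
    exact unitInterval.zero_mem
  · obtain ⟨u, hu, -⟩ := exists_isolationWeight_eq_isolationTerm h
    exact hu ▸ isolationTerm_mem_Icc hσ u v

lemma isolationTerm_le_pow (hσ : σ ∈ Set.Icc (0 : ℝ) 1)
    (h : C.isolationTerm σ u v ≠ 0) {p : Fin N → Prop} [Fintype {l // p l}]
    (hp : ∀ l, p l → l ≠ u ∧ v l ∈ C.outer) :
    C.isolationTerm σ u v ≤ σ ^ Fintype.card {l // p l} := by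
  classical
  have hfactor (l : Fin N) := isolationFactor_mem_Icc (C := C) hσ u l (v l)
  calc C.isolationTerm σ u v
      = (∏ l with p l, C.isolationFactor σ u l (v l)) *
          ∏ l with ¬p l, C.isolationFactor σ u l (v l) :=
        (Finset.prod_filter_mul_prod_filter_not _ _ _).symm
    _ ≤ ∏ l with p l, C.isolationFactor σ u l (v l) :=
        mul_le_of_le_one_right (Finset.prod_nonneg fun l _ => (hfactor l).1)
          (Finset.prod_le_one (fun l _ => (hfactor l).1) fun l _ => (hfactor l).2)
    _ = ∏ l with p l, σ := by
        refine Finset.prod_congr rfl fun l hl => ?_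
        obtain ⟨hlu, hl⟩ := hp l (Finset.mem_filter.1 hl).2
        rw [isolationFactor, if_neg hlu, discount, if_neg (notMem_core_of_discount_ne_zero
          (discount_ne_zero_of_isolationTerm_ne_zero h hlu)), if_pos hl]
    _ = σ ^ Fintype.card {l // p l} := by rw [Finset.prod_const, Fintype.card_subtype]

lemma discount_mul_discount (h : Disjoint C.outer C'.outer) (x : X) :
    C.discount σ x * C'.discount σ x = C.discount σ x + C'.discount σ x - 1 := by
  by_cases hx : x ∈ C.outer
  · have hx' : x ∉ C'.outer := Set.disjoint_left.1 h hx
    simp [discount, hx', mt (@C'.core_subset_outer x) hx']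
  · simp [discount, hx, mt (@C.core_subset_outer x) hx]

@[fun_prop]
lemma measurable_discount : Measurable (C.discount σ) :=
  .ite C.measurableSet_core measurable_const <|
    .ite C.measurableSet_outer measurable_const measurable_const

@[fun_prop]
lemma measurable_isolationFactor (u l : Fin N) : Measurable (C.isolationFactor σ u l) := by
  unfold isolationFactor
  split_ifs
  · exact measurable_one.indicator C.measurableSet_core
  · exact measurable_discount

@[fun_prop]
lemma measurable_isolationTerm (u : Fin N) : Measurable (C.isolationTerm σ u) := by
  unfold isolationTerm
  fun_prop

@[fun_prop]
lemma measurable_isolationWeight : Measurable (C.isolationWeight σ : (Fin N → X) → ℝ) := by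
  unfold isolationWeight
  fun_prop

variable {τ : Measure X} [IsProbabilityMeasure τ]

lemma integrable_discount (hσ : σ ∈ Set.Icc (0 : ℝ) 1) : Integrable (C.discount σ) τ :=
  .of_mem_Icc 0 1 measurable_discount.aemeasurable (ae_of_all _ (discount_mem_Icc hσ))

lemma integrable_isolationFactor (hσ : σ ∈ Set.Icc (0 : ℝ) 1) (u l : Fin N) :
    Integrable (C.isolationFactor σ u l) τ :=
  .of_mem_Icc 0 1 (measurable_isolationFactor u l).aemeasurable
    (ae_of_all _ (isolationFactor_mem_Icc hσ u l))

lemma integrable_isolationTerm (hσ : σ ∈ Set.Icc (0 : ℝ) 1) (u : Fin N) :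
    Integrable (C.isolationTerm σ u) (Measure.pi fun _ => τ) :=
  .of_mem_Icc 0 1 (measurable_isolationTerm u).aemeasurable
    (ae_of_all _ (isolationTerm_mem_Icc hσ u))

lemma integrable_isolationWeight (hσ : σ ∈ Set.Icc (0 : ℝ) 1) :
    Integrable (C.isolationWeight σ : (Fin N → X) → ℝ) (Measure.pi fun _ => τ) :=
  .of_mem_Icc 0 1 measurable_isolationWeight.aemeasurable
    (ae_of_all _ (isolationWeight_mem_Icc hσ))

lemma integral_discount :
    ∫ x, C.discount σ x ∂τ = 1 - (σ * τ.real C.core + (1 - σ) * τ.real C.outer) := by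
  have hcore : Integrable (fun x => σ * C.core.indicator (1 : X → ℝ) x) τ :=
    ((integrable_const (1 : ℝ)).indicator C.measurableSet_core).const_mul _
  have houter : Integrable (fun x => (1 - σ) * C.outer.indicator (1 : X → ℝ) x) τ :=
    ((integrable_const (1 : ℝ)).indicator C.measurableSet_outer).const_mul _
  have hsum : Integrable (fun x => σ * C.core.indicator (1 : X → ℝ) x +
      (1 - σ) * C.outer.indicator (1 : X → ℝ) x) τ := hcore.add houter
  have heq (x : X) : C.discount σ x =
      1 - (σ * C.core.indicator (1 : X → ℝ) x + (1 - σ) * C.outer.indicator (1 : X → ℝ) x) := by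
    have := @C.core_subset_outer x
    by_cases hc : x ∈ C.core <;> by_cases ho : x ∈ C.outer <;> simp_all [discount]
  simp_rw [heq]
  rw [integral_sub (integrable_const 1) hsum, integral_add hcore houter,
    integral_const_mul, integral_const_mul, integral_indicator_one C.measurableSet_core,
    integral_indicator_one C.measurableSet_outer]
  simp

lemma integral_isolationTerm (u : Fin N) :
    ∫ v, C.isolationTerm σ u v ∂(Measure.pi fun _ => τ) =
      τ.real C.core * (∫ x, C.discount σ x ∂τ) ^ (N - 1) := by
  have h : ∀ l ∈ Finset.univ.erase u,
      ∫ x, C.isolationFactor σ u l x ∂τ = ∫ x, C.discount σ x ∂τ := fun l hl => by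
    simp only [isolationFactor, if_neg (Finset.ne_of_mem_erase hl)]
  unfold isolationTerm
  rw [integral_fintype_prod_eq_prod (μ := fun _ => τ),
    ← Finset.mul_prod_erase _ _ (Finset.mem_univ u), Finset.prod_congr rfl h]
  simp [isolationFactor, integral_indicator_one C.measurableSet_core]

lemma integral_isolationWeight (hσ : σ ∈ Set.Icc (0 : ℝ) 1) :
    ∫ v : Fin N → X, C.isolationWeight σ v ∂(Measure.pi fun _ => τ) =
      N * (τ.real C.core * (∫ x, C.discount σ x ∂τ) ^ (N - 1)) := by
  unfold isolationWeight
  rw [integral_finsetSum _ fun u _ => integrable_isolationTerm hσ u]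
  simp [integral_isolationTerm]

lemma integral_discount_le_one (hσ : σ ∈ Set.Icc (0 : ℝ) 1) : ∫ x, C.discount σ x ∂τ ≤ 1 :=
  (integral_mono (integrable_discount hσ) (integrable_const 1)
    fun x => (discount_mem_Icc hσ x).2).trans (by simp)

lemma integral_discount_mul_discount_le (hσ : σ ∈ Set.Icc (0 : ℝ) 1)
    (h : Disjoint C.outer C'.outer) :
    ∫ x, C.discount σ x * C'.discount σ x ∂τ ≤
      (∫ x, C.discount σ x ∂τ) * ∫ x, C'.discount σ x ∂τ := by
  simp_rw [discount_mul_discount h]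
  rw [integral_sub (f := fun x => C.discount σ x + C'.discount σ x)
      ((integrable_discount hσ).add (integrable_discount hσ)) (integrable_const 1),
    integral_add (integrable_discount hσ) (integrable_discount hσ)]
  simp only [integral_const, probReal_univ, smul_eq_mul, mul_one]
  nlinarith [integral_discount_le_one (C := C) (τ := τ) hσ,
    integral_discount_le_one (C := C') (τ := τ) hσ]

lemma integral_mul_le_mul_integral_mul {f g : X → ℝ} (hf : Integrable f τ) (hg : Integrable g τ)
    (hf01 : ∀ x, f x ∈ Set.Icc (0 : ℝ) 1) (hg01 : ∀ x, g x ∈ Set.Icc (0 : ℝ) 1) {q : ℝ}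
    (hq : 0 < q) (hqg : q ≤ ∫ x, g x ∂τ) :
    ∫ x, f x * g x ∂τ ≤ q⁻¹ * ((∫ x, f x ∂τ) * ∫ x, g x ∂τ) := by
  have hfg : Integrable (fun x => f x * g x) τ :=
    .of_mem_Icc 0 1 (hf.1.mul hg.1).aemeasurable
      (ae_of_all _ fun x => unitInterval.mul_mem (hf01 x) (hg01 x))
  calc ∫ x, f x * g x ∂τ ≤ ∫ x, f x ∂τ :=
        integral_mono hfg hf fun x => mul_le_of_le_one_right (hf01 x).1 (hg01 x).2
    _ ≤ (∫ x, f x ∂τ) * (q⁻¹ * ∫ x, g x ∂τ) :=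
        le_mul_of_one_le_right (integral_nonneg fun x => (hf01 x).1)
          (by rwa [← div_eq_inv_mul, one_le_div hq])
    _ = q⁻¹ * ((∫ x, f x ∂τ) * ∫ x, g x ∂τ) := by ring

variable {q : ℝ}

lemma integral_isolationFactor_mul_le (hσ : σ ∈ Set.Icc (0 : ℝ) 1)
    (h : Disjoint C.outer C'.outer) (hq : 0 < q) (hqC : q ≤ ∫ x, C.discount σ x ∂τ)
    (hqC' : q ≤ ∫ x, C'.discount σ x ∂τ) (hu : u ≠ u') (l : Fin N) :
    ∫ x, C.isolationFactor σ u l x * C'.isolationFactor σ u' l x ∂τ ≤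
      (if l = u then q⁻¹ else 1) * (if l = u' then q⁻¹ else 1) *
        ((∫ x, C.isolationFactor σ u l x ∂τ) * ∫ x, C'.isolationFactor σ u' l x ∂τ) := by
  by_cases hlu : l = u
  · have hlu' : l ≠ u' := fun h => hu (hlu.symm.trans h)
    rw [if_pos hlu, if_neg hlu', mul_one]
    exact integral_mul_le_mul_integral_mul (integrable_isolationFactor hσ u l)
      (integrable_isolationFactor hσ u' l) (isolationFactor_mem_Icc hσ u l)
      (isolationFactor_mem_Icc hσ u' l) hq (by simpa only [isolationFactor, if_neg hlu'])
  by_cases hlu' : l = u'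
  · rw [if_neg hlu, if_pos hlu', one_mul, mul_comm (∫ x, _ ∂τ)]
    simp_rw [mul_comm (C.isolationFactor σ u l _)]
    exact integral_mul_le_mul_integral_mul (integrable_isolationFactor hσ u' l)
      (integrable_isolationFactor hσ u l) (isolationFactor_mem_Icc hσ u' l)
      (isolationFactor_mem_Icc hσ u l) hq (by simpa only [isolationFactor, if_neg hlu])
  · simpa only [isolationFactor, if_neg hlu, if_neg hlu', one_mul] using
      integral_discount_mul_discount_le hσ h

lemma integral_isolationTerm_mul_le (hσ : σ ∈ Set.Icc (0 : ℝ) 1)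
    (h : Disjoint C.outer C'.outer) (hq : 0 < q) (hqC : q ≤ ∫ x, C.discount σ x ∂τ)
    (hqC' : q ≤ ∫ x, C'.discount σ x ∂τ) (u u' : Fin N) :
    ∫ v, C.isolationTerm σ u v * C'.isolationTerm σ u' v ∂(Measure.pi fun _ => τ) ≤
      q⁻¹ ^ 2 * ((∫ v, C.isolationTerm σ u v ∂(Measure.pi fun _ => τ)) *
        ∫ v, C'.isolationTerm σ u' v ∂(Measure.pi fun _ => τ)) := by
  rcases eq_or_ne u u' with rfl | hu
  · have hzero : ∀ v, C.isolationTerm σ u v * C'.isolationTerm σ u v = 0 := fun v => by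
      by_contra hne
      obtain ⟨h₁, h₂⟩ := mul_ne_zero_iff.1 hne
      exact Set.disjoint_left.1 h (C.core_subset_outer (mem_core_of_isolationTerm_ne_zero h₁))
        (C'.core_subset_outer (mem_core_of_isolationTerm_ne_zero h₂))
    simp_rw [hzero, integral_zero]
    exact mul_nonneg (sq_nonneg _) (mul_nonneg
      (integral_nonneg fun v => (isolationTerm_mem_Icc hσ u v).1)
      (integral_nonneg fun v => (isolationTerm_mem_Icc hσ u v).1))
  simp_rw [isolationTerm, ← Finset.prod_mul_distrib]
  rw [integral_fintype_prod_eq_prod (μ := fun _ => τ)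
      (f := fun l x => C.isolationFactor σ u l x * C'.isolationFactor σ u' l x),
    integral_fintype_prod_eq_prod (μ := fun _ => τ),
    integral_fintype_prod_eq_prod (μ := fun _ => τ)]
  refine (Finset.prod_le_prod (fun l _ => integral_nonneg fun x =>
    (unitInterval.mul_mem (isolationFactor_mem_Icc hσ u l x)
      (isolationFactor_mem_Icc hσ u' l x)).1) fun l _ =>
    integral_isolationFactor_mul_le hσ h hq hqC hqC' hu l).trans_eq ?_
  simp only [Finset.prod_mul_distrib, Finset.prod_ite_eq', Finset.mem_univ, if_true, sq]

lemma integral_isolationWeight_mul_le (hσ : σ ∈ Set.Icc (0 : ℝ) 1)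
    (h : Disjoint C.outer C'.outer) (hq : 0 < q) (hqC : q ≤ ∫ x, C.discount σ x ∂τ)
    (hqC' : q ≤ ∫ x, C'.discount σ x ∂τ) :
    ∫ v : Fin N → X, C.isolationWeight σ v * C'.isolationWeight σ v ∂(Measure.pi fun _ => τ) ≤
      q⁻¹ ^ 2 * ((∫ v : Fin N → X, C.isolationWeight σ v ∂(Measure.pi fun _ => τ)) *
        ∫ v : Fin N → X, C'.isolationWeight σ v ∂(Measure.pi fun _ => τ)) := by
  have hi (u u' : Fin N) : Integrable (fun v => C.isolationTerm σ u v * C'.isolationTerm σ u' v)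
      (Measure.pi fun _ => τ) :=
    .of_mem_Icc 0 1 (by fun_prop) (ae_of_all _ fun v =>
      unitInterval.mul_mem (isolationTerm_mem_Icc hσ u v) (isolationTerm_mem_Icc hσ u' v))
  simp_rw [isolationWeight, Finset.sum_mul_sum]
  rw [integral_finsetSum _ fun u _ => integrable_finsetSum _ fun u' _ => hi u u',
    integral_finsetSum _ fun u _ => integrable_isolationTerm hσ u,
    integral_finsetSum _ fun u _ => integrable_isolationTerm hσ u, Finset.sum_mul_sum,
    Finset.mul_sum]
  refine Finset.sum_le_sum fun u _ => ?_
  rw [integral_finsetSum _ fun u' _ => hi u u', Finset.mul_sum]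
  exact Finset.sum_le_sum fun u' _ => integral_isolationTerm_mul_le hσ h hq hqC hqC' u u'

variable {ι : Type*} [Fintype ι] {D : ι → Cell X}

lemma le_integral_sum_isolationWeight (hσ : σ ∈ Set.Icc (0 : ℝ) 1) (hq : q ∈ Set.Icc (0 : ℝ) 1)
    (hqD : ∀ c, q ≤ ∫ x, (D c).discount σ x ∂τ) {β : ℝ} (hβ : ∀ c, β ≤ τ.real (D c).core) :
    Fintype.card ι * (N * (β * q ^ N)) ≤
      ∫ v : Fin N → X, ∑ c, (D c).isolationWeight σ v ∂(Measure.pi fun _ => τ) := by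
  rw [integral_finsetSum _ fun c _ => integrable_isolationWeight hσ, ← Finset.card_univ,
    ← nsmul_eq_mul]
  refine Finset.card_nsmul_le_sum _ _ _ fun c _ => ?_
  rw [integral_isolationWeight hσ]
  refine mul_le_mul_of_nonneg_left (mul_le_mul (hβ c) ?_ (pow_nonneg hq.1 N) measureReal_nonneg)
    (Nat.cast_nonneg N)
  exact (pow_le_pow_of_le_one hq.1 hq.2 (Nat.sub_le N 1)).trans
    (pow_le_pow_left₀ hq.1 (hqD c) _)

lemma half_le_measureReal_sum_isolationWeight (hσ : σ ∈ Set.Icc (0 : ℝ) 1)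
    (hD : Pairwise fun c c' => Disjoint (D c).outer (D c').outer) (hq : 0 < q)
    (hq' : 4 * (q⁻¹ ^ 2 - 1) ≤ 1 / 4) (hqD : ∀ c, q ≤ ∫ x, (D c).discount σ x ∂τ) {T : ℝ}
    (hT : 2 * T ≤ ∫ v : Fin N → X, ∑ c, (D c).isolationWeight σ v ∂(Measure.pi fun _ => τ))
    (h16 : 16 ≤ ∫ v : Fin N → X, ∑ c, (D c).isolationWeight σ v ∂(Measure.pi fun _ => τ)) :
    1 / 2 ≤ (Measure.pi fun _ : Fin N => τ).real {v | T ≤ ∑ c, (D c).isolationWeight σ v} := by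
  have hlt := measureReal_sum_lt_half_integral_le (μ := Measure.pi fun _ : Fin N => τ)
    (W := fun c v => (D c).isolationWeight σ v) (fun c => measurable_isolationWeight)
    (fun c v => isolationWeight_mem_Icc hσ v) (sq_nonneg q⁻¹)
    (fun c c' hc => integral_isolationWeight_mul_le hσ (hD hc) hq (hqD c) (hqD c')) (by linarith)
  set m := ∫ v : Fin N → X, ∑ c, (D c).isolationWeight σ v ∂(Measure.pi fun _ => τ)
  have hm : 4 / m ≤ 1 / 4 := by
    rw [div_le_div_iff₀ (by linarith) (by norm_num)]
    linarith
  have hms : MeasurableSet {v : Fin N → X | ∑ c, (D c).isolationWeight σ v < m / 2} :=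
    measurableSet_lt (by fun_prop) measurable_const
  have hsub : {v : Fin N → X | ∑ c, (D c).isolationWeight σ v < m / 2}ᶜ ⊆
      {v | T ≤ ∑ c, (D c).isolationWeight σ v} := fun v hv =>
    (by linarith : T ≤ m / 2).trans (not_lt.1 hv)
  refine le_trans ?_ (measureReal_mono hsub)
  rw [probReal_compl_eq_one_sub hms]
  linarith

end Cell

lemma tendsto_log_div_natCast : Tendsto (fun n : ℕ => Real.log n / n) atTop (𝓝 0) :=
  Real.isLittleO_log_id_atTop.tendsto_div_nhds_zero.comp tendsto_natCast_atTop_atTop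

lemma tendsto_one_sub_mul_log_div (κ : ℝ) :
    Tendsto (fun n : ℕ => 1 - κ * (Real.log n / n)) atTop (𝓝 1) := by
  simpa using (tendsto_log_div_natCast.const_mul κ).const_sub 1

lemma rpow_neg_le_one_sub_pow {n x γ : ℝ} (hn : 0 < n) (hx : x < 1) {N : ℕ}
    (h : N * (x / (1 - x)) ≤ γ * Real.log n) : n ^ (-γ) ≤ (1 - x) ^ N := by
  have hx' : 0 < 1 - x := sub_pos.2 hx
  rw [Real.rpow_def_of_pos hn, ← Real.exp_log hx', ← Real.exp_nat_mul]
  refine Real.exp_le_exp.2 ?_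
  have hlog : -(x / (1 - x)) ≤ Real.log (1 - x) :=
    (by field_simp; ring : -(x / (1 - x)) = 1 - (1 - x)⁻¹).trans_le
      (Real.one_sub_inv_le_log_of_pos hx')
  nlinarith [mul_le_mul_of_nonneg_left hlog (Nat.cast_nonneg (α := ℝ) N)]

-- `n` times the probability that at most `μ * n` uniform points in a volume `n` all avoid a set
-- of volume `κ * log n` is about `n ^ (1 - μ * κ)`.
lemma eventually_le_mul_one_sub_pow {κ μ : ℝ} (hκ : 0 ≤ κ) (hμκ : μ * κ < 1) {c : ℝ} (hc : 0 < c)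
    (T : ℝ) :
    ∀ᶠ n : ℕ in atTop, ∀ N : ℕ, (N : ℝ) ≤ μ * n → T ≤ c * n * (1 - κ * (Real.log n / n)) ^ N := by
  obtain ⟨γ, hμγ, hγ⟩ := exists_between hμκ
  have hq := tendsto_one_sub_mul_log_div κ
  have hratio : Tendsto (fun n : ℕ => μ * κ / (1 - κ * (Real.log n / n))) atTop (𝓝 (μ * κ)) := by
    simpa only [div_one, Pi.div_def] using (tendsto_const_nhds (x := μ * κ)).div hq one_ne_zero
  have hpow : Tendsto (fun n : ℕ => c * (n : ℝ) ^ (1 - γ)) atTop atTop :=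
    ((tendsto_rpow_atTop (sub_pos.2 hγ)).comp tendsto_natCast_atTop_atTop).const_mul_atTop hc
  filter_upwards [hratio.eventually (gt_mem_nhds hμγ), hq.eventually (lt_mem_nhds one_pos),
    hpow.eventually_ge_atTop T, eventually_ge_atTop 1] with n hnγ hq0 hT hn1 N hN
  have hn : (0 : ℝ) < n := by exact_mod_cast hn1
  have : 0 ≤ Real.log n := Real.log_natCast_nonneg n
  set x := κ * (Real.log n / n) with hx
  have : 0 ≤ x := by positivity
  have hexp : N * (x / (1 - x)) ≤ γ * Real.log n :=
    calc N * (x / (1 - x)) ≤ μ * n * (x / (1 - x)) := by gcongr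
      _ = μ * κ / (1 - x) * Real.log n := by rw [hx]; field_simp
      _ ≤ γ * Real.log n := by gcongr
  calc T ≤ c * (n : ℝ) ^ (1 - γ) := hT
    _ = c * n * (n : ℝ) ^ (-γ) := by
        rw [sub_eq_add_neg, Real.rpow_add hn, Real.rpow_one, mul_assoc]
    _ ≤ c * n * (1 - x) ^ N := by
        gcongr
        exact rpow_neg_le_one_sub_pow hn (sub_pos.1 hq0) hexp

lemma Cell.eventually_half_le_measureReal_sum_isolationWeight {lam μ κ : ℝ} (hlam : 0 < lam)
    (hκ : 0 ≤ κ) (hμκ : μ * κ < 1) {c₁ c₂ : ℝ} (hc₁ : 0 < c₁) (hc₂ : 0 < c₂) (T : ℝ) :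
    ∀ᶠ n : ℕ in atTop, ∀ N : ℕ, lam * n ≤ N → (N : ℝ) ≤ μ * n →
      ∀ (X ι : Type) [MeasurableSpace X] [Fintype ι] (τ : Measure X) [IsProbabilityMeasure τ]
        (D : ι → Cell X) (σ : ℝ), σ ∈ Set.Icc (0 : ℝ) 1 →
        (Pairwise fun c c' => Disjoint (D c).outer (D c').outer) →
        c₁ * (n / Real.log n) ≤ Fintype.card ι →
        (∀ c, c₂ * (Real.log n / n) ≤ τ.real (D c).core) →
        (∀ c, 1 - κ * (Real.log n / n) ≤ ∫ x, (D c).discount σ x ∂τ) →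
        1 / 2 ≤ (Measure.pi fun _ : Fin N => τ).real
          {v | T ≤ ∑ c, (D c).isolationWeight σ v} := by
  have hq := tendsto_one_sub_mul_log_div κ
  have hq2 : Tendsto (fun n : ℕ => 4 * ((1 - κ * (Real.log n / n))⁻¹ ^ 2 - 1)) atTop (𝓝 0) := by
    simpa using (((hq.inv₀ one_ne_zero).pow 2).sub_const 1).const_mul 4
  filter_upwards [eventually_le_mul_one_sub_pow hκ hμκ
      (show 0 < c₁ * c₂ * lam by positivity) (max (2 * T) 16),
    hq2.eventually (ge_mem_nhds (show (0 : ℝ) < 1 / 4 by norm_num)),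
    hq.eventually (lt_mem_nhds one_pos), eventually_ge_atTop 2]
    with n hmean hq2 hq0 hn2 N hN₁ hN₂ X ι _ _ τ _ D σ hσ hD hcard hcore hdisc
  have : (0 : ℝ) < n := by positivity
  have : 0 < Real.log n := Real.log_pos (by exact_mod_cast hn2)
  set q := 1 - κ * (Real.log n / n)
  have hq1 : q ≤ 1 := sub_le_self 1 (by positivity)
  have hm : max (2 * T) 16 ≤
      ∫ v : Fin N → X, ∑ c, (D c).isolationWeight σ v ∂(Measure.pi fun _ => τ) :=
    calc max (2 * T) 16 ≤ c₁ * c₂ * lam * n * q ^ N := hmean N hN₂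
      _ = c₁ * (n / Real.log n) * (lam * n * (c₂ * (Real.log n / n) * q ^ N)) := by field_simp
      _ ≤ Fintype.card ι * (N * (c₂ * (Real.log n / n) * q ^ N)) := by gcongr
      _ ≤ _ := le_integral_sum_isolationWeight hσ ⟨hq0.le, hq1⟩ hdisc hcore
  exact half_le_measureReal_sum_isolationWeight hσ hD hq0 hq2 hdisc
    ((le_max_left _ _).trans hm) ((le_max_right _ _).trans hm)

/-! ### Concentration of the Poisson distribution -/

lemma hasSum_sub_sq_poissonMeasure (r : NNReal) :
    HasSum (fun n : ℕ => Real.exp (-r) * r ^ n / n.factorial * ((n : ℝ) - r) ^ 2) r := by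
  set f : ℕ → ℝ := fun n => Real.exp (-r) * r ^ n / n.factorial with hf
  have hsucc (n : ℕ) : ((n + 1 : ℕ) : ℝ) * f (n + 1) = r * f n := by
    simp only [hf, Nat.factorial_succ, pow_succ]
    push_cast
    field_simp
  have h0 : HasSum f 1 := hasSum_one_poissonMeasure r
  have h1 : HasSum (fun n => n * f n) r := by
    rw [← hasSum_nat_add_iff' 1]
    simp only [hsucc]
    simpa using h0.mul_left (r : ℝ)
  have h2 : HasSum (fun n => n * (n * f n)) (r * r + r : ℝ) := by
    rw [← hasSum_nat_add_iff' 1]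
    simp only [hsucc]
    convert! (h1.mul_left (r : ℝ)).add (h0.mul_left (r : ℝ)) using 1
    · ext n
      push_cast
      ring
    · simp
  convert! (h2.sub (h1.mul_left (2 * (r : ℝ)))).add (h0.mul_left ((r : ℝ) ^ 2)) using 1
  · ext n
    ring
  · ring

lemma integrable_sub_sq_poissonMeasure (r : NNReal) :
    Integrable (fun n : ℕ => ((n : ℝ) - r) ^ 2) (poissonMeasure r) :=
  integrable_poissonMeasure_iff.2 <| (hasSum_sub_sq_poissonMeasure r).summable.congr fun n => by
    rw [Real.norm_of_nonneg (sq_nonneg _)]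

lemma integral_sub_sq_poissonMeasure (r : NNReal) :
    ∫ n : ℕ, ((n : ℝ) - r) ^ 2 ∂poissonMeasure r = r := by
  rw [integral_poissonMeasure]
  exact (hasSum_sub_sq_poissonMeasure r).tsum_eq

lemma eventually_half_le_poissonMeasure {lam ε : ℝ} (hlam : 0 < lam) (hε : 0 < ε) :
    ∀ᶠ n : ℕ in atTop, 1 / 2 ≤ (poissonMeasure (Real.toNNReal (lam * n))).real
      {N : ℕ | (lam - ε) * n ≤ N ∧ (N : ℝ) ≤ (lam + ε) * n} := by
  filter_upwards [tendsto_natCast_atTop_atTop.eventually_ge_atTop (2 * lam / ε ^ 2),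
    eventually_ge_atTop 1] with n hn hn1
  have hn0 : (0 : ℝ) < n := by exact_mod_cast hn1
  set r := Real.toNNReal (lam * n)
  have hr : (r : ℝ) = lam * n := Real.coe_toNNReal _ (by positivity)
  set G : Set ℕ := {N : ℕ | (lam - ε) * n ≤ N ∧ (N : ℝ) ≤ (lam + ε) * n}
  have hsub : Gᶜ ⊆ {N : ℕ | (ε * n) ^ 2 ≤ ((N : ℝ) - r) ^ 2} := fun N hN => by
    rw [Set.mem_ofPred_eq, hr, sq_le_sq, abs_of_pos (by positivity : 0 < ε * (n : ℝ))]
    by_contra hlt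
    obtain ⟨h₁, h₂⟩ := abs_lt.1 (not_le.1 hlt)
    exact hN ⟨by linarith, by linarith⟩
  have hcompl : (poissonMeasure r).real Gᶜ ≤ 1 / 2 := by
    have hmarkov := mul_meas_ge_le_integral_of_nonneg
      (ae_of_all _ fun N : ℕ => sq_nonneg ((N : ℝ) - r)) (integrable_sub_sq_poissonMeasure r)
      ((ε * n) ^ 2)
    rw [integral_sub_sq_poissonMeasure, hr] at hmarkov
    have hvar : lam * n ≤ (ε * n) ^ 2 * (1 / 2) := by
      rw [div_le_iff₀ (by positivity)] at hn
      nlinarith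
    rw [← hr] at hmarkov
    exact (measureReal_mono hsub).trans
      (le_of_mul_le_mul_left (hmarkov.trans (hr ▸ hvar)) (by positivity))
  rw [probReal_compl_eq_one_sub (by measurability)] at hcompl
  linarith

/-! ### Deciding between competing hypotheses -/

section Competitors

lemma one_le_measure_compl_add_sum_setLIntegral {ι Y : Type*} [MeasurableSpace Y]
    (μ : Measure Y) [IsProbabilityMeasure μ] (A : Set Y) {ψ : ι → Y → ENNReal}
    (hψ : ∀ k, Measurable (ψ k)) (s : Finset ι) :
    1 ≤ μ Aᶜ + μ {y | ∑ k ∈ s, ψ k y < 1} + ∑ k ∈ s, ∫⁻ y in A, ψ k y ∂μ := by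
  have hm : Measurable fun y => ∑ k ∈ s, ψ k y := Finset.measurable_sum _ fun k _ => hψ k
  have hmarkov : μ (A ∩ {y | 1 ≤ ∑ k ∈ s, ψ k y}) ≤ ∑ k ∈ s, ∫⁻ y in A, ψ k y ∂μ := by
    rw [← lintegral_finsetSum _ fun k _ => hψ k]
    have := mul_meas_ge_le_lintegral (μ := μ.restrict A) hm 1
    rwa [one_mul, Measure.restrict_apply (measurableSet_le measurable_const hm),
      Set.inter_comm] at this
  have hcover : Set.univ ⊆ (Aᶜ ∪ {y | ∑ k ∈ s, ψ k y < 1}) ∪ (A ∩ {y | 1 ≤ ∑ k ∈ s, ψ k y}) :=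
    fun y _ => by
      rcases lt_or_ge (∑ k ∈ s, ψ k y) 1 with h | h
      · exact .inl (.inr h)
      · exact (em (y ∈ A)).elim (fun hy => .inr ⟨hy, h⟩) fun hy => .inl (.inl hy)
  calc 1 = μ Set.univ := measure_univ.symm
    _ ≤ μ (Aᶜ ∪ {y | ∑ k ∈ s, ψ k y < 1}) + μ (A ∩ {y | 1 ≤ ∑ k ∈ s, ψ k y}) :=
        (measure_mono hcover).trans (measure_union_le _ _)
    _ ≤ _ := add_le_add (measure_union_le _ _) hmarkov

/- Hypotheses `x` with prior weights `w x` and laws `R x` are to be told apart; `A x` is the set of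
observations on which `x` is accepted, and at most `q` hypotheses are accepted at a time. The
hypotheses `flip k x` compete with `x`. -/
variable {𝓛 ι Y : Type*} [Fintype 𝓛] [MeasurableSpace Y] {w : 𝓛 → ENNReal} {R : 𝓛 → Measure Y}
  {A : 𝓛 → Set Y} {G : Finset 𝓛} {active : 𝓛 → Finset ι} {flip : ι → 𝓛 → 𝓛}
  {ψ : ι → 𝓛 → Y → ENNReal} {C q : ENNReal}

lemma sum_measure_inter_compl_le (hA : ∀ x, MeasurableSet (A x))
    (hq : ∀ y, ∑ x, (A x).indicator 1 y ≤ q) (x' : 𝓛) :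
    ∑ x, R x' (A x ∩ (A x')ᶜ) ≤ q * R x' (A x')ᶜ :=
  calc ∑ x, R x' (A x ∩ (A x')ᶜ) = ∑ x, ∫⁻ y in (A x')ᶜ, (A x).indicator 1 y ∂(R x') :=
        Finset.sum_congr rfl fun x _ => by
          rw [lintegral_indicator_one (hA x), Measure.restrict_apply (hA x)]
    _ = ∫⁻ y in (A x')ᶜ, ∑ x, (A x).indicator 1 y ∂(R x') :=
        (lintegral_finsetSum _ fun x _ => measurable_one.indicator (hA x)).symm
    _ ≤ ∫⁻ _ in (A x')ᶜ, q ∂(R x') := lintegral_mono fun y => hq y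
    _ = q * R x' (A x')ᶜ := setLIntegral_const _ _

-- Accepting `x` is an error under every competitor of `x`; as each observation is accepted by at
-- most `q` hypotheses, it is charged at most `q` times.
lemma sum_setLIntegral_le_sum_measure_compl (hA : ∀ x, MeasurableSet (A x))
    (hq : ∀ y, ∑ x, (A x).indicator 1 y ≤ q)
    (hψ : ∀ x ∈ G, ∀ k ∈ active x,
      w x * ∫⁻ y in A x, ψ k x y ∂(R x) ≤ C * (w (flip k x) * R (flip k x) (A x)))
    (hinj : ∀ x ∈ G, Set.InjOn (fun k => flip k x) (active x))
    (hdisj : ∀ x ∈ G, ∀ k ∈ active x, Disjoint (A x) (A (flip k x))) :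
    ∑ x ∈ G, ∑ k ∈ active x, w x * ∫⁻ y in A x, ψ k x y ∂(R x) ≤
      C * q * ∑ x, w x * R x (A x)ᶜ := by
  classical
  have hflip : ∀ x ∈ G, ∑ k ∈ active x, w x * ∫⁻ y in A x, ψ k x y ∂(R x) ≤
      ∑ x', C * (w x' * R x' (A x ∩ (A x')ᶜ)) := fun x hx =>
    calc ∑ k ∈ active x, w x * ∫⁻ y in A x, ψ k x y ∂(R x)
        ≤ ∑ k ∈ active x, C * (w (flip k x) * R (flip k x) (A x ∩ (A (flip k x))ᶜ)) :=
          Finset.sum_le_sum fun k hk => by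
            rw [Set.inter_eq_left.2 (hdisj x hx k hk).subset_compl_right]
            exact hψ x hx k hk
      _ = ∑ x' ∈ (active x).image fun k => flip k x, C * (w x' * R x' (A x ∩ (A x')ᶜ)) :=
          (Finset.sum_image (f := fun x' => C * (w x' * R x' (A x ∩ (A x')ᶜ))) (hinj x hx)).symm
      _ ≤ _ := Finset.sum_le_sum_of_subset (Finset.subset_univ _)
  calc ∑ x ∈ G, ∑ k ∈ active x, w x * ∫⁻ y in A x, ψ k x y ∂(R x)
      ≤ ∑ x, ∑ x', C * (w x' * R x' (A x ∩ (A x')ᶜ)) :=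
        (Finset.sum_le_sum hflip).trans (Finset.sum_le_sum_of_subset (Finset.subset_univ _))
    _ = ∑ x', C * (w x' * ∑ x, R x' (A x ∩ (A x')ᶜ)) := by
        rw [Finset.sum_comm]
        simp_rw [Finset.mul_sum]
    _ ≤ ∑ x', C * (w x' * (q * R x' (A x')ᶜ)) :=
        Finset.sum_le_sum fun x' _ => by gcongr; exact sum_measure_inter_compl_le hA hq x'
    _ = C * q * ∑ x, w x * R x (A x)ᶜ := by
        rw [Finset.mul_sum]
        exact Finset.sum_congr rfl fun x _ => by ring

lemma half_le_mul_sum_measure_compl [DecidableEq 𝓛] [∀ x, IsProbabilityMeasure (R x)]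
    (hw : ∑ x, w x = 1) (hA : ∀ x, MeasurableSet (A x))
    (hq : ∀ y, ∑ x, (A x).indicator 1 y ≤ q) (hψm : ∀ x k, Measurable (ψ k x))
    (hψ : ∀ x ∈ G, ∀ k ∈ active x,
      w x * ∫⁻ y in A x, ψ k x y ∂(R x) ≤ C * (w (flip k x) * R (flip k x) (A x)))
    (hinj : ∀ x ∈ G, Set.InjOn (fun k => flip k x) (active x))
    (hdisj : ∀ x ∈ G, ∀ k ∈ active x, Disjoint (A x) (A (flip k x)))
    (hG : ∑ x ∈ Gᶜ, w x ≤ 4⁻¹)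
    (hΨ : ∑ x, w x * R x {y | ∑ k ∈ active x, ψ k x y < 1} ≤ 4⁻¹) :
    2⁻¹ ≤ (C * q + 1) * ∑ x, w x * R x (A x)ᶜ := by
  have hquarter : (4⁻¹ + 4⁻¹ : ENNReal) = 2⁻¹ := by
    rw [show (4 : ENNReal) = 2 * 2 by norm_num, ENNReal.mul_inv (by simp) (by simp), ← mul_add,
      ENNReal.inv_two_add_inv_two, mul_one]
  have hsplit : ∀ x, w x ≤ w x * R x (A x)ᶜ + w x * R x {y | ∑ k ∈ active x, ψ k x y < 1} +
      ∑ k ∈ active x, w x * ∫⁻ y in A x, ψ k x y ∂(R x) := fun x => by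
    rw [← Finset.mul_sum, ← mul_add, ← mul_add]
    exact le_mul_of_one_le_right' (one_le_measure_compl_add_sum_setLIntegral _ _ (hψm x) _)
  have htotal : (1 : ENNReal) ≤ 2⁻¹ + (C * q + 1) * ∑ x, w x * R x (A x)ᶜ :=
    calc (1 : ENNReal) = ∑ x ∈ G, w x + ∑ x ∈ Gᶜ, w x := by
          rw [← hw, Finset.sum_add_sum_compl]
      _ ≤ (∑ x, w x * R x (A x)ᶜ + 4⁻¹ + C * q * ∑ x, w x * R x (A x)ᶜ) + 4⁻¹ := by
          refine add_le_add ((Finset.sum_le_sum fun x _ => hsplit x).trans ?_) hG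
          rw [Finset.sum_add_distrib, Finset.sum_add_distrib]
          exact add_le_add (add_le_add (Finset.sum_le_sum_of_subset (Finset.subset_univ _))
            ((Finset.sum_le_sum_of_subset (Finset.subset_univ _)).trans hΨ))
            (sum_setLIntegral_le_sum_measure_compl hA hq hψ hinj hdisj)
      _ = (4⁻¹ + 4⁻¹) + (C * q + 1) * ∑ x, w x * R x (A x)ᶜ := by ring
      _ = _ := by rw [hquarter]
  refine (ENNReal.add_le_add_iff_left (a := 2⁻¹) (by simp)).1 ?_
  rwa [ENNReal.inv_two_add_inv_two]

end Competitors

lemma pi_sum_smul_map_mk {Z X T : Type*} [Fintype Z] [Fintype T] [DecidableEq T]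
    [MeasurableSpace Z] [MeasurableSpace X] (a : Z → ENNReal) (ha : ∀ r, a r ≠ ⊤)
    (κ : Z → Measure X) [∀ r, IsFiniteMeasure (κ r)] :
    Measure.pi (fun _ : T => ∑ r, a r • (κ r).map (Prod.mk r)) =
      ∑ x : T → Z, (∏ l, a (x l)) • (Measure.pi fun l => κ (x l)).map fun y l => (x l, y l) := by
  have (r : Z) : IsFiniteMeasure (a r • (κ r).map (Prod.mk r)) := Measure.smul_finite _ (ha r)
  refine Measure.pi_eq fun s hs => ?_
  simp only [Measure.finsetSum_apply, Measure.smul_apply, smul_eq_mul]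
  rw [Finset.prod_univ_sum, Fintype.piFinset_univ]
  refine Finset.sum_congr rfl fun x _ => ?_
  have hm : Measurable fun (y : T → X) l => (x l, y l) := by fun_prop
  have hpre : (fun (y : T → X) l => (x l, y l)) ⁻¹' Set.univ.pi s =
      Set.univ.pi fun l => Prod.mk (x l) ⁻¹' s l := by
    ext y; simp
  rw [Measure.map_apply hm (MeasurableSet.univ_pi hs), Finset.prod_mul_distrib, hpre,
    Measure.pi_pi]
  congr 1
  exact Finset.prod_congr rfl fun l _ => (Measure.map_apply (by fun_prop) (hs l)).symm

/-! ### Likelihood ratios of stars -/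

lemma pi_le_pi {E : Type*} [Fintype E] {X : E → Type*} [∀ e, MeasurableSpace (X e)]
    {μ ν : ∀ e, Measure (X e)} (h : ∀ e, μ e ≤ ν e) : Measure.pi μ ≤ Measure.pi ν := by
  refine Measure.le_iff.2 fun s hs => ?_
  rw [Measure.pi, Measure.pi, toMeasure_apply _ _ hs, toMeasure_apply _ _ hs]
  exact OuterMeasure.le_pi.2 (fun t _ => (OuterMeasure.pi_pi_le _ t).trans
    (Finset.prod_le_prod' fun e _ => h e (t e))) s

lemma pi_withDensity_prod_comp_le {E K X : Type*} [Fintype E] [Fintype K] [MeasurableSpace X]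
    {φ : K → E} (hφ : Function.Injective φ) {μ ν : E → Measure X}
    [∀ e, IsProbabilityMeasure (μ e)] {f : K → X → ℝ}
    (hf : ∀ k, Integrable (f k) (μ (φ k))) (hf0 : ∀ k x, 0 ≤ f k x)
    (hmem : ∀ k, (μ (φ k)).withDensity (fun x => ENNReal.ofReal (f k x)) ≤ ν (φ k))
    (hnotMem : ∀ e, (¬∃ k, φ k = e) → μ e ≤ ν e) :
    (Measure.pi μ).withDensity (fun y => ENNReal.ofReal (∏ k, f k (y (φ k)))) ≤
      Measure.pi ν := by
  set g : E → X → ℝ := Function.extend φ f (1 : E → X → ℝ)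
  have hgφ : ∀ k, g (φ k) = f k := hφ.extend_apply f _
  have hg1 : ∀ e, (¬∃ k, φ k = e) → g e = 1 := fun e he => Function.extend_apply' f _ e he
  have hprod : ∀ y : E → X, ∏ k, f k (y (φ k)) = ∏ e, g e (y e) := fun y =>
    Finset.prod_of_injOn φ hφ.injOn (fun _ _ => Finset.mem_coe.2 (Finset.mem_univ _))
      (fun e _ he => by rw [hg1 e fun ⟨k, hk⟩ => he ⟨k, by simp, hk⟩, Pi.one_apply])
      fun k _ => by rw [hgφ]
  have hgi : ∀ e, Integrable (g e) (μ e) := fun e => by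
    by_cases he : ∃ k, φ k = e
    · obtain ⟨k, rfl⟩ := he
      exact (hgφ k).symm ▸ hf k
    · exact (hg1 e he).symm ▸ integrable_const 1
  have hg0 : ∀ e x, 0 ≤ g e x := fun e x => by
    by_cases he : ∃ k, φ k = e
    · obtain ⟨k, rfl⟩ := he
      exact (hgφ k).symm ▸ hf0 k x
    · exact (hg1 e he).symm ▸ zero_le_one
  have (e : E) : IsFiniteMeasure ((μ e).withDensity fun x => ENNReal.ofReal (g e x)) :=
    isFiniteMeasure_withDensity_ofReal (hgi e).2
  simp_rw [hprod]
  rw [pi_withDensity_ofReal _ g hgi hg0]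
  refine pi_le_pi fun e => ?_
  by_cases he : ∃ k, φ k = e
  · obtain ⟨k, rfl⟩ := he
    simpa only [hgφ] using hmem k
  · simpa only [hg1 e he, Pi.one_apply, ENNReal.ofReal_one, withDensity_const, one_smul]
      using hnotMem e he

namespace GHCMParams

/-- The unordered pair of two distinct vertices, in the ordered representation of `VertexPair`. -/
def edge {N : ℕ} (u l : Fin N) (h : l ≠ u) : VertexPair N :=
  if h' : u < l then ⟨(u, l), h'⟩ else ⟨(l, u), lt_of_le_of_ne (not_lt.1 h') h⟩

lemma eq_and_eq_or_of_edge_eq_edge {N : ℕ} {u l u' l' : Fin N} {h : l ≠ u} {h' : l' ≠ u'}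
    (he : edge u l h = edge u' l' h') : (u = u' ∧ l = l') ∨ (u = l' ∧ l = u') := by
  unfold edge at he
  split_ifs at he <;> simp only [Subtype.mk.injEq, Prod.mk.injEq] at he <;> tauto

lemma exists_eq_edge {N : ℕ} (e : VertexPair N) (u : Fin N) (h : e.1.1 = u ∨ e.1.2 = u) :
    ∃ l, ∃ h : l ≠ u, e = edge u l h := by
  obtain ⟨⟨a, b⟩, hab⟩ := e
  rcases h with rfl | rfl
  · exact ⟨b, (ne_of_lt hab).symm, by unfold edge; rw [dif_pos hab]⟩
  · exact ⟨a, ne_of_lt hab, by unfold edge; rw [dif_neg (not_lt.2 (le_of_lt hab))]⟩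

variable {Z : Type*} [Fintype Z] (M : GHCMParams Z)

section Observations

lemma P_symm (i j : Z) : M.P i j = M.P j i := M.p_symm i j

lemma visible_comm {n : ℕ} {u v : Fin M.d → ℝ} : M.Visible n u v ↔ M.Visible n v u := by
  unfold Visible torusDist
  simp_rw [abs_sub_comm]

lemma obsLaw_comm (n : ℕ) (u v : Fin M.d → ℝ) (a b : Z) :
    M.obsLaw n u v a b = M.obsLaw n v u b a := by
  unfold obsLaw
  rw [M.P_symm a b]
  congr 1
  exact propext M.visible_comm

variable {n N : ℕ} (v : Locations M.d N)

/-- Law of the observation on the pair `e` given the locations `v` and the labels `x`. -/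
noncomputable def obsAt (n : ℕ) (v : Locations M.d N) (x : Labeling Z N) (e : VertexPair N) :
    Measure ℝ :=
  M.obsLaw n (v e.1.1) (v e.1.2) (x e.1.1) (x e.1.2)

instance (x : Labeling Z N) (e : VertexPair N) : IsProbabilityMeasure (M.obsAt n v x e) := by
  unfold obsAt; infer_instance

lemma obsAt_edge (x : Labeling Z N) {u l : Fin N} (h : l ≠ u) :
    M.obsAt n v x (edge u l h) = M.obsLaw n (v u) (v l) (x u) (x l) := by
  unfold obsAt edge
  split_ifs
  · rfl
  · exact M.obsLaw_comm _ _ _ _ _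

/-- The vertices visible from `u`. -/
abbrev Nbr (n : ℕ) (v : Locations M.d N) (u : Fin N) : Type :=
  {l : Fin N // l ≠ u ∧ M.Visible n (v u) (v l)}

noncomputable instance (u : Fin N) : Fintype (M.Nbr n v u) := Fintype.ofFinite _

/-- The edges from `u` to its neighbors. -/
def starEdge {n : ℕ} {v : Locations M.d N} (u : Fin N) (l : M.Nbr n v u) : VertexPair N :=
  edge u l.1 l.2.1

lemma starEdge_injective (u : Fin N) :
    Function.Injective (M.starEdge (n := n) (v := v) u) := fun l l' h => by
  rcases eq_and_eq_or_of_edge_eq_edge h with h' | h'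
  · exact Subtype.ext h'.2
  · exact absurd h'.2 l.2.1

lemma obsAt_starEdge (x : Labeling Z N) {u : Fin N} (l : M.Nbr n v u) :
    M.obsAt n v x (M.starEdge u l) = M.P (x u) (x l) := by
  rw [starEdge, obsAt_edge, obsLaw, if_pos l.2.2]

lemma obsAt_update_of_notMem_star (x : Labeling Z N) {u : Fin N} (j : Z) {e : VertexPair N}
    (he : ¬∃ l : M.Nbr n v u, M.starEdge u l = e) :
    M.obsAt n v (Function.update x u j) e = M.obsAt n v x e := by
  by_cases hu : e.1.1 = u ∨ e.1.2 = u
  · obtain ⟨l, hl, rfl⟩ := exists_eq_edge e u hu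
    have : ¬M.Visible n (v u) (v l) := fun hv => he ⟨⟨l, hl, hv⟩, rfl⟩
    rw [obsAt_edge, obsAt_edge, obsLaw, obsLaw, if_neg this, if_neg this]
  · push Not at hu
    rw [obsAt, obsAt, Function.update_of_ne hu.1, Function.update_of_ne hu.2]

end Observations

section Ratio

/-- Likelihood ratio between the labels `j` and `i` of a vertex, for the label of a neighbor and
the observation on the edge to it. -/
noncomputable def ratio (i j : Z) (z : Z × ℝ) : ℝ := M.p j z.1 z.2 / M.p i z.1 z.2

lemma ratio_nonneg (i j : Z) (z : Z × ℝ) : 0 ≤ M.ratio i j z :=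
  div_nonneg (M.p_nonneg _ _ _) (M.p_nonneg _ _ _)

lemma measurable_ratio_mk (i j r : Z) : Measurable fun t => M.ratio i j (r, t) :=
  (M.p_measurable j r).div (M.p_measurable i r)

lemma measurable_ratio [MeasurableSpace Z] [DiscreteMeasurableSpace Z] (i j : Z) :
    Measurable (M.ratio i j) :=
  measurable_from_prod_countable_right fun r => M.measurable_ratio_mk i j r

lemma withDensity_ratio (i j r : Z) :
    (M.P i r).withDensity (fun t => ENNReal.ofReal (M.ratio i j (r, t))) =
      (M.P j r).restrict {t | M.p i r t ≠ 0} := by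
  have hs : MeasurableSet {t | M.p i r t ≠ 0} :=
    (measurableSet_singleton (0 : ℝ)).compl.preimage (M.p_measurable i r)
  unfold P
  rw [← withDensity_mul _ (M.p_measurable i r).ennreal_ofReal
    (M.measurable_ratio_mk i j r).ennreal_ofReal, restrict_withDensity hs,
    ← withDensity_indicator hs]
  congr 1
  ext t
  simp only [Pi.mul_apply, ratio]
  rw [← ENNReal.ofReal_mul (M.p_nonneg _ _ _)]
  by_cases h : M.p i r t = 0
  · simp [h]
  · rw [Set.indicator_of_mem (show t ∈ {t | M.p i r t ≠ 0} from h), mul_div_cancel₀ _ h]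

lemma integrable_ratio_mk (i j r : Z) : Integrable (fun t => M.ratio i j (r, t)) (M.P i r) := by
  refine ⟨(M.measurable_ratio_mk i j r).aestronglyMeasurable, ?_⟩
  rw [hasFiniteIntegral_iff_ofReal (ae_of_all _ fun t => M.ratio_nonneg i j (r, t)),
    ← setLIntegral_univ, ← withDensity_apply _ MeasurableSet.univ, withDensity_ratio]
  exact measure_lt_top _ _

variable {n N : ℕ} (v : Locations M.d N)

/-- Likelihood ratio between the labels `j` and `i` of `u`, given the labels of its neighbors and
the observations on the edges to them. -/
noncomputable def starRatio (n : ℕ) (v : Locations M.d N) (i j : Z) (u : Fin N)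
    (x : Labeling Z N) (y : Observations N) : ℝ :=
  ∏ l : M.Nbr n v u, M.ratio i j (x l, y (M.starEdge u l))

lemma starRatio_nonneg (i j : Z) (u : Fin N) (x : Labeling Z N) (y : Observations N) :
    0 ≤ M.starRatio n v i j u x y :=
  Finset.prod_nonneg fun _ _ => M.ratio_nonneg _ _ _

lemma measurable_starRatio (i j : Z) (u : Fin N) (x : Labeling Z N) :
    Measurable (M.starRatio n v i j u x) :=
  Finset.measurable_prod _ fun l _ =>
    (M.measurable_ratio_mk i j (x l)).comp (measurable_pi_apply _)

lemma pi_obsAt_withDensity_starRatio_le {i : Z} (j : Z) {u : Fin N} {x : Labeling Z N}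
    (hx : x u = i) :
    (Measure.pi (M.obsAt n v x)).withDensity
        (fun y => ENNReal.ofReal (M.starRatio n v i j u x y)) ≤
      Measure.pi (M.obsAt n v (Function.update x u j)) := by
  refine pi_withDensity_prod_comp_le (M.starEdge_injective v u)
    (f := fun l t => M.ratio i j (x l, t)) (fun l => ?_)
    (fun _ _ => M.ratio_nonneg _ _ _) (fun l => ?_)
    fun e he => (M.obsAt_update_of_notMem_star v x j he).ge
  · rw [obsAt_starEdge, hx]
    exact M.integrable_ratio_mk i j (x l)
  · rw [obsAt_starEdge, obsAt_starEdge, hx, Function.update_self, Function.update_of_ne l.2.1,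
      withDensity_ratio]
    exact Measure.restrict_le_self

end Ratio

/-! ### Labels and marks -/

section Labels

/-- Prior probability of a labeling. -/
noncomputable def labelProb {T : Type*} [Fintype T] (x : T → Z) : ℝ := ∏ u, M.prior (x u)

lemma labelProb_nonneg {T : Type*} [Fintype T] (x : T → Z) : 0 ≤ M.labelProb x :=
  Finset.prod_nonneg fun _ _ => (M.prior_pos _).le

lemma labelProb_eq_mul_labelProb_update {T : Type*} [Fintype T] [DecidableEq T] {x : T → Z}
    {u : T} {i : Z} (hx : x u = i) (j : Z) :
    M.labelProb x = M.prior i / M.prior j * M.labelProb (Function.update x u j) := by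
  have hupdate : M.labelProb (Function.update x u j) =
      M.prior j * ∏ w ∈ Finset.univ \ {u}, M.prior (x w) := by
    simp_rw [labelProb, Function.apply_update fun _ => M.prior]
    exact Finset.prod_update_of_mem (Finset.mem_univ u) _ _
  rw [hupdate, labelProb, Finset.prod_eq_mul_prod_sdiff_singleton_of_mem (Finset.mem_univ u), hx,
    ← mul_assoc, div_mul_cancel₀ _ (M.prior_pos j).ne']

lemma sum_ofReal_prior : ∑ r, ENNReal.ofReal (M.prior r) = 1 := by
  rw [← ENNReal.ofReal_sum_of_nonneg fun r _ => (M.prior_pos r).le, M.prior_sum,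
    ENNReal.ofReal_one]

variable [MeasurableSpace Z]

/-- Joint law of the label of a neighbor and the observation on the edge to it, for a vertex with
label `i`. -/
noncomputable def markLaw (i : Z) : Measure (Z × ℝ) :=
  ∑ r, ENNReal.ofReal (M.prior r) • (M.P i r).map (Prod.mk r)

instance (i : Z) : IsProbabilityMeasure (M.markLaw i) := by
  have (r : Z) : IsProbabilityMeasure ((M.P i r).map (Prod.mk r)) :=
    Measure.isProbabilityMeasure_map (by fun_prop)
  constructor
  simp only [markLaw, Measure.finsetSum_apply, Measure.smul_apply, smul_eq_mul, measure_univ,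
    mul_one, sum_ofReal_prior]

variable [DiscreteMeasurableSpace Z]

lemma labelLaw_singleton (r : Z) : M.labelLaw {r} = ENNReal.ofReal (M.prior r) := by
  classical
  simp only [labelLaw, Measure.finsetSum_apply, Measure.smul_apply, Measure.dirac_apply,
    smul_eq_mul, Set.indicator_apply, Set.mem_singleton_iff, Pi.one_apply, mul_ite, mul_one,
    mul_zero, Finset.sum_ite_eq', Finset.mem_univ, if_true]

lemma labelLaw_real_singleton (r : Z) : M.labelLaw.real {r} = M.prior r := by
  rw [Measure.real, labelLaw_singleton, ENNReal.toReal_ofReal (M.prior_pos r).le]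

lemma pi_labelLaw_singleton {T : Type*} [Fintype T] (x : T → Z) :
    Measure.pi (fun _ : T => M.labelLaw) {x} = ENNReal.ofReal (M.labelProb x) := by
  simp_rw [Measure.pi_singleton, labelLaw_singleton]
  exact (ENNReal.ofReal_prod_of_nonneg fun _ _ => (M.prior_pos _).le).symm

lemma integral_pi_labelLaw {T : Type*} [Fintype T] [DecidableEq T] (g : (T → Z) → ℝ) :
    ∫ x, g x ∂(Measure.pi fun _ : T => M.labelLaw) = ∑ x, M.labelProb x * g x := by
  simp_rw [integral_fintype Integrable.of_finite, Measure.real, pi_labelLaw_singleton,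
    ENNReal.toReal_ofReal (M.labelProb_nonneg _), smul_eq_mul]

lemma integral_pi_markLaw {T : Type*} [Fintype T] (i : Z)
    {g : (T → Z × ℝ) → ℝ} (hg : Measurable g) (hg1 : ∀ z, g z ∈ Set.Icc (0 : ℝ) 1) :
    ∫ z, g z ∂(Measure.pi fun _ : T => M.markLaw i) =
      ∫ x, ∫ y, g (fun l => (x l, y l)) ∂(Measure.pi fun l => M.P i (x l))
        ∂(Measure.pi fun _ : T => M.labelLaw) := by
  classical
  have hm (x : T → Z) : Measurable fun (y : T → ℝ) l => (x l, y l) := by fun_prop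
  have (x : T → Z) : IsProbabilityMeasure
      ((Measure.pi fun l => M.P i (x l)).map fun y l => (x l, y l)) :=
    Measure.isProbabilityMeasure_map (hm x).aemeasurable
  rw [integral_pi_labelLaw]
  unfold markLaw
  rw [pi_sum_smul_map_mk _ (fun r => ENNReal.ofReal_ne_top),
    integral_finsetSum_measure fun x _ => Integrable.smul_measure
      (.of_mem_Icc 0 1 hg.aemeasurable (ae_of_all _ hg1))
      (ENNReal.prod_ne_top fun _ _ => ENNReal.ofReal_ne_top)]
  refine Finset.sum_congr rfl fun x _ => ?_
  rw [integral_smul_measure, integral_map (hm x).aemeasurable hg.aestronglyMeasurable,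
    smul_eq_mul, ← ENNReal.ofReal_prod_of_nonneg fun _ _ => (M.prior_pos _).le,
    ENNReal.toReal_ofReal (Finset.prod_nonneg fun _ _ => (M.prior_pos _).le), labelProb]

end Labels

section JointLaw

variable [MeasurableSpace Z] [DiscreteMeasurableSpace Z] {n N : ℕ}
  {v : Locations M.d N}

/-- Joint law of the labels and the observations given the locations. -/
noncomputable def jointLaw (n : ℕ) (v : Locations M.d N) :
    Measure (Labeling Z N × Observations N) :=
  (Measure.pi fun _ => M.labelLaw) ⊗ₘ (M.obsKernel n N).sectR v

instance : IsProbabilityMeasure (M.jointLaw n v) := by unfold jointLaw; infer_instance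

lemma jointLaw_apply {S : Set (Labeling Z N × Observations N)} (hS : MeasurableSet S) :
    M.jointLaw n v S = ∑ x : Labeling Z N, ENNReal.ofReal (M.labelProb x) *
      Measure.pi (M.obsAt n v x) {y | (x, y) ∈ S} := by
  simp_rw [jointLaw, Measure.compProd_apply hS, lintegral_fintype, pi_labelLaw_singleton,
    mul_comm]
  rfl

lemma integral_jointLaw {f : Labeling Z N × Observations N → ℝ}
    (hf : Integrable f (M.jointLaw n v)) :
    ∫ z, f z ∂M.jointLaw n v =
      ∫ x, ∫ y, f (x, y) ∂Measure.pi (M.obsAt n v x) ∂Measure.pi fun _ => M.labelLaw :=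
  Measure.integral_compProd hf

end JointLaw

/-! ### The second moment of the star weights -/

section StarWeight

variable {n N : ℕ} {v : Locations M.d N} {i j : Z} {u u' : Fin N}

open Classical in
/-- The likelihood ratio of the star of `u` capped at `1` if `u` has label `i`, and `0` otherwise:
it is at most the posterior mass gained, relative to that of `x`, by changing the label of `u` to
`j`, up to the ratio of the priors. -/
noncomputable def starWeight (n : ℕ) (v : Locations M.d N) (i j : Z) (u : Fin N)
    (z : Labeling Z N × Observations N) : ℝ :=
  if z.1 u = i then min 1 (M.starRatio n v i j u z.1 z.2) else 0

lemma starWeight_mem_Icc (z : Labeling Z N × Observations N) :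
    M.starWeight n v i j u z ∈ Set.Icc (0 : ℝ) 1 := by
  unfold starWeight
  split_ifs
  · exact ⟨le_min zero_le_one (M.starRatio_nonneg _ _ _ _ _ _), min_le_left _ _⟩
  · exact ⟨le_rfl, zero_le_one⟩

lemma ofReal_labelProb_mul_setLIntegral_starWeight_le {S : Type*} [MeasurableSpace S]
    (ν : Measure S) [SFinite ν] {x : Labeling Z N} (hx : x u = i) {A : Set (Observations N × S)}
    (hA : MeasurableSet A) :
    ENNReal.ofReal (M.labelProb x) *
        ∫⁻ y in A, ENNReal.ofReal (M.starWeight n v i j u (x, y.1))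
          ∂((Measure.pi (M.obsAt n v x)).prod ν) ≤
      ENNReal.ofReal (M.prior i / M.prior j) *
        (ENNReal.ofReal (M.labelProb (Function.update x u j)) *
          (Measure.pi (M.obsAt n v (Function.update x u j))).prod ν A) := by
  have hm : Measurable fun y => ENNReal.ofReal (M.starRatio n v i j u x y) :=
    (M.measurable_starRatio v i j u x).ennreal_ofReal
  have hle : ∫⁻ y in A, ENNReal.ofReal (M.starWeight n v i j u (x, y.1))
      ∂((Measure.pi (M.obsAt n v x)).prod ν) ≤
        (Measure.pi (M.obsAt n v (Function.update x u j))).prod ν A :=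
    calc ∫⁻ y in A, ENNReal.ofReal (M.starWeight n v i j u (x, y.1))
          ∂((Measure.pi (M.obsAt n v x)).prod ν)
        ≤ ∫⁻ y in A, ENNReal.ofReal (M.starRatio n v i j u x y.1)
          ∂((Measure.pi (M.obsAt n v x)).prod ν) :=
          lintegral_mono fun y => ENNReal.ofReal_le_ofReal
            ((if_pos hx).trans_le (min_le_right _ _))
      _ = (((Measure.pi (M.obsAt n v x)).withDensity
            fun y => ENNReal.ofReal (M.starRatio n v i j u x y)).prod ν) A := by
          rw [prod_withDensity_left hm, withDensity_apply _ hA]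
      _ ≤ _ := Measure.prod_mono (M.pi_obsAt_withDensity_starRatio_le v j hx) le_rfl A
  rw [← mul_assoc, ← ENNReal.ofReal_mul (div_pos (M.prior_pos i) (M.prior_pos j)).le,
    ← M.labelProb_eq_mul_labelProb_update hx j]
  gcongr

/-- No vertex of `{u} ∪ Nbr u` belongs to `{u'} ∪ Nbr u'`. -/
def SeparatedStars (n : ℕ) (v : Locations M.d N) (u u' : Fin N) : Prop :=
  ∀ l l', (l = u ∨ M.Visible n (v u) (v l)) → (l' = u' ∨ M.Visible n (v u') (v l')) → l ≠ l'

variable [MeasurableSpace Z] [DiscreteMeasurableSpace Z]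

open Classical in
/-- The conditional mean of `starWeight` given the labels. -/
noncomputable def starMean (n : ℕ) (v : Locations M.d N) (i j : Z) (u : Fin N)
    (x : Labeling Z N) : ℝ :=
  if x u = i then ∫ y : M.Nbr n v u → ℝ, min 1 (∏ l : M.Nbr n v u, M.ratio i j (x l, y l))
    ∂(Measure.pi fun l : M.Nbr n v u => M.P i (x l)) else 0

lemma measurable_starWeight : Measurable (M.starWeight n v i j u) :=
  measurable_from_prod_countable_right fun x => by
    by_cases hx : x u = i
    · simp only [starWeight, hx, if_true]
      exact measurable_const.min (M.measurable_starRatio v i j u x)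
    · simp only [starWeight, hx, if_false]
      exact measurable_const

lemma integral_starWeight_pi_obsAt (x : Labeling Z N) :
    ∫ y, M.starWeight n v i j u (x, y) ∂(Measure.pi (M.obsAt n v x)) =
      M.starMean n v i j u x := by
  unfold starWeight starMean
  split_ifs with hx
  · have hmap := map_comp_pi_of_injective (M.obsAt n v x) (M.starEdge_injective (n := n) v u)
    simp_rw [obsAt_starEdge, hx] at hmap
    have hm : Measurable fun y : M.Nbr n v u → ℝ =>
        min 1 (∏ l : M.Nbr n v u, M.ratio i j (x l, y l)) :=
      (measurable_min_one_prod (M.measurable_ratio i j)).comp (by fun_prop)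
    rw [← hmap, integral_map (measurable_pi_lambda _ fun _ => measurable_pi_apply _).aemeasurable
      hm.aestronglyMeasurable]
    rfl
  · exact integral_zero _ _

lemma integral_starWeight_mul_pi_obsAt (h : M.SeparatedStars n v u u') (x : Labeling Z N) :
    ∫ y, M.starWeight n v i j u (x, y) * M.starWeight n v i j u' (x, y)
        ∂(Measure.pi (M.obsAt n v x)) =
      M.starMean n v i j u x * M.starMean n v i j u' x := by
  classical
  have hindep := indepFun_comp_pi_of_forall_ne (M.obsAt n v x)
    (φ := M.starEdge (n := n) (v := v) u) (ψ := M.starEdge u') fun l l' hl => by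
      rcases eq_and_eq_or_of_edge_eq_edge hl with h' | h'
      · exact h u u' (.inl rfl) (.inl rfl) h'.1
      · exact h u l' (.inl rfl) (.inr l'.2.2) h'.1
  have hm (u : Fin N) : Measurable fun w : M.Nbr n v u → ℝ =>
      if x u = i then min 1 (∏ l : M.Nbr n v u, M.ratio i j (x l, w l)) else 0 := by
    split_ifs
    · exact (measurable_min_one_prod (M.measurable_ratio i j)).comp (by fun_prop)
    · exact measurable_const
  have hms (u : Fin N) : Measurable fun y => M.starWeight n v i j u (x, y) :=
    M.measurable_starWeight.comp (by fun_prop)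
  rw [← integral_starWeight_pi_obsAt, ← integral_starWeight_pi_obsAt]
  exact (hindep.comp (hm u) (hm u')).integral_mul_eq_mul_integral
    (hms u).aestronglyMeasurable (hms u').aestronglyMeasurable

lemma integral_starMean :
    ∫ x, M.starMean n v i j u x ∂(Measure.pi fun _ : Fin N => M.labelLaw) =
      M.prior i * testingAffinity (M.markLaw i) (M.ratio i j) (M.Nbr n v u) := by
  classical
  let f (w : Unit → Z) : ℝ := if w () = i then 1 else 0
  let g (w : M.Nbr n v u → Z) : ℝ :=
    ∫ y : M.Nbr n v u → ℝ, min 1 (∏ l, M.ratio i j (w l, y l)) ∂(Measure.pi fun l => M.P i (w l))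
  have hfg : M.starMean n v i j u = fun x : Labeling Z N => f (fun _ => x u) * g fun l => x l := by
    ext x
    simp only [starMean, f, g, ite_mul, one_mul, zero_mul]
  have hindep := (indepFun_comp_pi_of_forall_ne (fun _ : Fin N => M.labelLaw)
    (φ := fun _ : Unit => u) (ψ := (Subtype.val : M.Nbr n v u → Fin N))
    fun _ l => l.2.1.symm).comp (φ := f) (ψ := g) .of_discrete .of_discrete
  have hf : ∫ x : Labeling Z N, f (fun _ => x u) ∂(Measure.pi fun _ => M.labelLaw) =
      M.prior i := by
    rw [integral_comp_eval (μ := fun _ : Fin N => M.labelLaw) (i := u)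
      (f := fun r => if r = i then (1 : ℝ) else 0) Measurable.of_discrete.aestronglyMeasurable,
      integral_fintype .of_finite]
    simp [labelLaw_real_singleton]
  have hg : ∫ x : Labeling Z N, g (fun l => x l) ∂(Measure.pi fun _ => M.labelLaw) =
      testingAffinity (M.markLaw i) (M.ratio i j) (M.Nbr n v u) := by
    rw [testingAffinity, integral_pi_markLaw M i (measurable_min_one_prod (M.measurable_ratio i j))
      (min_one_prod_mem_Icc (M.ratio_nonneg i j)),
      ← map_comp_pi_of_injective (fun _ : Fin N => M.labelLaw)
        (Subtype.val_injective (p := fun l => l ≠ u ∧ M.Visible n (v u) (v l))),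
      integral_map (Measurable.of_discrete.aemeasurable)
        Measurable.of_discrete.aestronglyMeasurable]
  rw [hfg, ← hf, ← hg]
  exact hindep.integral_mul_eq_mul_integral Measurable.of_discrete.aestronglyMeasurable
    Measurable.of_discrete.aestronglyMeasurable

lemma integral_starMean_mul (h : M.SeparatedStars n v u u') :
    ∫ x, M.starMean n v i j u x * M.starMean n v i j u' x
        ∂(Measure.pi fun _ : Fin N => M.labelLaw) =
      (∫ x, M.starMean n v i j u x ∂(Measure.pi fun _ : Fin N => M.labelLaw)) *
        ∫ x, M.starMean n v i j u' x ∂(Measure.pi fun _ : Fin N => M.labelLaw) := by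
  have hne : ∀ (o : Option (M.Nbr n v u)) (o' : Option (M.Nbr n v u')),
      o.elim u Subtype.val ≠ o'.elim u' Subtype.val := fun o o' =>
    h _ _ (by cases o with | none => exact .inl rfl | some l => exact .inr l.2.2)
      (by cases o' with | none => exact .inl rfl | some l => exact .inr l.2.2)
  classical
  let g (u : Fin N) (w : Option (M.Nbr n v u) → Z) : ℝ :=
    if w none = i then ∫ y : M.Nbr n v u → ℝ, min 1 (∏ l, M.ratio i j (w (some l), y l))
      ∂(Measure.pi fun l => M.P i (w (some l))) else 0
  exact ((indepFun_comp_pi_of_forall_ne (fun _ : Fin N => M.labelLaw) hne).comp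
    (φ := g u) (ψ := g u') .of_discrete .of_discrete).integral_mul_eq_mul_integral
    Measurable.of_discrete.aestronglyMeasurable Measurable.of_discrete.aestronglyMeasurable

lemma integral_starWeight : ∫ z, M.starWeight n v i j u z ∂M.jointLaw n v =
    M.prior i * testingAffinity (M.markLaw i) (M.ratio i j) (M.Nbr n v u) := by
  rw [integral_jointLaw M (.of_mem_Icc 0 1 M.measurable_starWeight.aemeasurable
    (ae_of_all _ M.starWeight_mem_Icc)), ← integral_starMean]
  simp_rw [integral_starWeight_pi_obsAt]

lemma integral_starWeight_mul (h : M.SeparatedStars n v u u') :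
    ∫ z, M.starWeight n v i j u z * M.starWeight n v i j u' z ∂M.jointLaw n v =
      (∫ z, M.starWeight n v i j u z ∂M.jointLaw n v) *
        ∫ z, M.starWeight n v i j u' z ∂M.jointLaw n v := by
  rw [integral_jointLaw M (f := fun z => M.starWeight n v i j u z * M.starWeight n v i j u' z)
    (.of_mem_Icc 0 1 (M.measurable_starWeight.mul M.measurable_starWeight).aemeasurable
      (ae_of_all _ fun z =>
        unitInterval.mul_mem (M.starWeight_mem_Icc z) (M.starWeight_mem_Icc z)))]
  simp_rw [integral_starWeight_mul_pi_obsAt M h, integral_starMean_mul M h, integral_starWeight,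
    integral_starMean]

lemma jointLaw_sum_starWeight_lt_one_le {I : Finset (Fin N)} {c σ : ℝ}
    (hsep : (I : Set (Fin N)).Pairwise (M.SeparatedStars n v))
    (hcσ : ∀ (T : Type) [Fintype T],
      c * σ ^ Fintype.card T ≤ testingAffinity (M.markLaw i) (M.ratio i j) T)
    (hI : 16 ≤ M.prior i * c * ∑ u ∈ I, σ ^ Fintype.card (M.Nbr n v u)) :
    M.jointLaw n v {z | ∑ u ∈ I, M.starWeight n v i j u z < 1} ≤ 4⁻¹ := by
  set W : I → Labeling Z N × Observations N → ℝ := fun u => M.starWeight n v i j u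
  set m := ∫ z, ∑ u, W u z ∂M.jointLaw n v with hm
  have hWm : ∀ u, Measurable (W u) := fun u => M.measurable_starWeight
  have hm16 : 16 ≤ m := by
    rw [hm, integral_finsetSum _ fun u _ => .of_mem_Icc 0 1 (hWm u).aemeasurable
      (ae_of_all _ M.starWeight_mem_Icc)]
    refine hI.trans ?_
    rw [← Finset.sum_coe_sort, Finset.mul_sum]
    refine Finset.sum_le_sum fun u _ => ?_
    rw [integral_starWeight, mul_assoc]
    exact mul_le_mul_of_nonneg_left (hcσ _) (M.prior_pos i).le
  have hreal : (M.jointLaw n v).real {z | ∑ u, W u z < m / 2} ≤ 4 / m + 4 * (1 - 1) :=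
    measureReal_sum_lt_half_integral_le hWm (fun _ => M.starWeight_mem_Icc) zero_le_one
      (fun u u' huu => ((M.integral_starWeight_mul (hsep u.2 u'.2
        (Subtype.coe_ne_coe.2 huu))).trans (one_mul _).symm).le) (by linarith)
  have hquarter : (4 : ENNReal)⁻¹ = ENNReal.ofReal 4⁻¹ := by
    rw [ENNReal.ofReal_inv_of_pos (by norm_num), ENNReal.ofReal_ofNat]
  rw [hquarter, ← ofReal_measureReal]
  refine ENNReal.ofReal_le_ofReal ((measureReal_mono fun z hz => ?_).trans (hreal.trans ?_))
  · rw [Set.mem_ofPred_eq, Finset.sum_coe_sort I fun u => M.starWeight n v i j u z]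
    exact lt_of_lt_of_le hz (by linarith)
  · rw [sub_self, mul_zero, add_zero, div_le_iff₀ (by linarith)]
    linarith

end StarWeight

end GHCMParams

/-! ### Failure given the locations -/

namespace GHCMParams

variable {Z : Type*} [Fintype Z] (M : GHCMParams Z)

section AllLabels

/-- Every label occurs both inside and outside of `A`: the estimate on either side of `A` then
determines a permissible relabeling. -/
def AllLabels {T : Type*} (A : Finset T) (x : T → Z) : Prop :=
  ∀ r, (∃ u ∈ A, x u = r) ∧ ∃ u ∉ A, x u = r

variable [MeasurableSpace Z] [DiscreteMeasurableSpace Z]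

lemma pi_labelLaw_coe_finset {T : Type*} [Fintype T] (S : Finset (T → Z)) :
    Measure.pi (fun _ : T => M.labelLaw) S = ∑ x ∈ S, ENNReal.ofReal (M.labelProb x) := by
  classical
  simp_rw [← pi_labelLaw_singleton, sum_measure_singleton]

lemma sum_ofReal_labelProb {T : Type*} [Fintype T] [DecidableEq T] :
    ∑ x : T → Z, ENNReal.ofReal (M.labelProb x) = 1 := by
  rw [← pi_labelLaw_coe_finset, Finset.coe_univ, measure_univ]

lemma pi_labelLaw_forall_ne {T : Type*} [Fintype T] (r : Z) (A : Finset T) :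
    Measure.pi (fun _ : T => M.labelLaw) {x | ∀ u ∈ A, x u ≠ r} =
      ENNReal.ofReal (1 - M.prior r) ^ A.card := by
  have hpi : {x : T → Z | ∀ u ∈ A, x u ≠ r} = Set.pi A fun _ => {r}ᶜ := by
    ext x
    simp [Set.mem_pi]
  rw [hpi, Measure.pi_pi_finset, Finset.prod_const, prob_compl_eq_one_sub .of_discrete,
    labelLaw_singleton, ENNReal.ofReal_sub _ (M.prior_pos r).le, ENNReal.ofReal_one]

lemma pi_labelLaw_not_allLabels_le {T : Type*} [Fintype T] [DecidableEq T] {A : Finset T} {m : ℕ}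
    (hA : m ≤ A.card) (hA' : m ≤ Aᶜ.card) :
    Measure.pi (fun _ : T => M.labelLaw) {x | ¬AllLabels A x} ≤
      ∑ r, (ENNReal.ofReal (1 - M.prior r) ^ m + ENNReal.ofReal (1 - M.prior r) ^ m) := by
  have hsub : {x : T → Z | ¬AllLabels A x} ⊆ ⋃ r ∈ (Finset.univ : Finset Z),
      ({x | ∀ u ∈ A, x u ≠ r} ∪ {x | ∀ u ∈ Aᶜ, x u ≠ r}) := fun x hx => by
    simp only [AllLabels, Set.mem_ofPred_eq, not_forall, not_and_or, not_exists] at hx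
    simpa [imp_iff_not_or] using hx
  have hle (r : Z) {B : Finset T} (hB : m ≤ B.card) :
      Measure.pi (fun _ : T => M.labelLaw) {x | ∀ u ∈ B, x u ≠ r} ≤
        ENNReal.ofReal (1 - M.prior r) ^ m := by
    rw [pi_labelLaw_forall_ne]
    exact pow_le_pow_right_of_le_one' (ENNReal.ofReal_le_one.2 (by linarith [M.prior_pos r])) hB
  exact (measure_mono hsub).trans <| (measure_biUnion_finset_le _ _).trans <|
    Finset.sum_le_sum fun r _ => (measure_union_le _ _).trans (add_le_add (hle r hA) (hle r hA'))

lemma exists_pi_labelLaw_not_allLabels_le {ε : ENNReal} (hε : ε ≠ 0) :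
    ∃ m : ℕ, ∀ (N : ℕ) (A : Finset (Fin N)), m ≤ A.card → m ≤ Aᶜ.card →
      Measure.pi (fun _ : Fin N => M.labelLaw) {x | ¬AllLabels A x} ≤ ε := by
  have hlim : Tendsto (fun m : ℕ => ∑ r, (ENNReal.ofReal (1 - M.prior r) ^ m +
      ENNReal.ofReal (1 - M.prior r) ^ m)) atTop (𝓝 (∑ _r : Z, (0 + 0))) :=
    tendsto_finsetSum _ fun r _ =>
      have hr := ENNReal.tendsto_pow_atTop_nhds_zero_of_lt_one
        (ENNReal.ofReal_lt_one.2 (by linarith [M.prior_pos r] : 1 - M.prior r < 1))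
      hr.add hr
  simp only [add_zero, Finset.sum_const_zero] at hlim
  obtain ⟨m, hm⟩ := (hlim.eventually (ge_mem_nhds hε.bot_lt)).exists
  exact ⟨m, fun N A hA hA' => (M.pi_labelLaw_not_allLabels_le hA hA').trans hm⟩

end AllLabels

section Relabelings

/-- The labelings obtained from `x` by a permissible relabeling. -/
def relabelings {T : Type*} (x : T → Z) : Set (T → Z) :=
  {x' | ∃ ω ∈ M.permissible, ∀ u, x' u = ω (x u)}

lemma mem_relabelings_of_agreement_eq_one {N : ℕ} {x' x : Labeling Z N}
    (h : M.agreement x' x = 1) : x' ∈ M.relabelings x := by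
  classical
  have : Nonempty M.permissible := ⟨1, fun _ => rfl, fun _ _ => rfl⟩
  obtain ⟨ω, hω⟩ := exists_eq_ciSup_of_finite
    (f := fun ω : M.permissible => ∑ u, if x' u = (ω : Equiv.Perm Z) (x u) then (1 : ℝ) else 0)
  have hmean : (1 / (N : ℝ)) *
      (∑ u, if x' u = (ω : Equiv.Perm Z) (x u) then (1 : ℝ) else 0) = 1 := by
    rw [hω, ← h, agreement]
    congr!
  have hN : (N : ℝ) ≠ 0 := fun h0 => by simp [h0] at hmean
  rw [one_div_mul_eq_div, div_eq_one_iff_eq hN, Finset.sum_boole, Nat.cast_inj] at hmean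
  exact ⟨ω, ω.2, fun u => Finset.filter_eq_self.1
    (Finset.eq_univ_of_card _ (hmean.trans (Fintype.card_fin N).symm)) u (Finset.mem_univ u)⟩

lemma card_mem_relabelings_le {T : Type*} [Fintype T] [DecidableEq T]
    (x' : T → Z) [DecidablePred fun x => x' ∈ M.relabelings x] :
    (Finset.univ.filter fun x => x' ∈ M.relabelings x).card ≤ Nat.card (Equiv.Perm Z) := by
  classical
  rw [Nat.card_eq_fintype_card]
  refine (Finset.card_le_card (t := Finset.univ.image fun (ω : Equiv.Perm Z) u => ω.symm (x' u))
    fun x hx => ?_).trans Finset.card_image_le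
  obtain ⟨ω, -, hω⟩ := (Finset.mem_filter.1 hx).2
  exact Finset.mem_image.2 ⟨ω, Finset.mem_univ _, funext fun u => by simp [hω u]⟩

variable {T : Type*} {A : Finset T} {x : T → Z}

lemma disjoint_relabelings_update [DecidableEq T] {i j : Z} (hij : i ≠ j) {u : T} (hx : x u = i)
    (hall : AllLabels A x) :
    Disjoint (M.relabelings x) (M.relabelings (Function.update x u j)) := by
  rw [Set.disjoint_left]
  rintro x' ⟨ω, -, hω⟩ ⟨ω', -, hω'⟩
  have hne : ∀ w ≠ u, ω (x w) = ω' (x w) := fun w hw => by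
    rw [← hω, hω', Function.update_of_ne hw]
  have heq : ω j = ω' j := by
    obtain ⟨⟨a, ha, rfl⟩, b, hb, hba⟩ := hall j
    by_cases hau : a = u
    · rw [← hba]
      exact hne b fun hbu => hb (hbu.trans hau.symm ▸ ha)
    · exact hne a hau
  have hu := (hω u).symm.trans (hω' u)
  rw [Function.update_self, hx, ← heq] at hu
  exact hij (ω.injective hu)

lemma disjoint_relabelings_piecewise [DecidableEq T] {τ : Equiv.Perm Z} (hτ : τ ≠ 1)
    (hall : AllLabels A x) :
    Disjoint (M.relabelings x) (M.relabelings (A.piecewise (τ ∘ x) x)) := by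
  rw [Set.disjoint_left]
  rintro x' ⟨ω, -, hω⟩ ⟨ω', -, hω'⟩
  have heq : ∀ r, ω r = ω' r := fun r => by
    obtain ⟨-, b, hb, rfl⟩ := hall r
    rw [← hω, hω', Finset.piecewise_eq_of_notMem _ _ _ hb]
  refine hτ (Equiv.ext fun r => ?_)
  obtain ⟨⟨a, ha, rfl⟩, -⟩ := hall r
  have hωa := (hω a).symm.trans (hω' a)
  rw [Finset.piecewise_eq_of_mem _ _ _ ha, ← heq] at hωa
  exact (ω.injective hωa).symm

lemma labelProb_piecewise [Fintype T] [DecidableEq T] {τ : Equiv.Perm Z} (hτ : τ ∈ M.permissible) :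
    M.labelProb (A.piecewise (τ ∘ x) x) = M.labelProb x := by
  refine Finset.prod_congr rfl fun u _ => ?_
  by_cases hu : u ∈ A
  · rw [Finset.piecewise_eq_of_mem _ _ _ hu, Function.comp_apply, ← hτ.1]
  · rw [Finset.piecewise_eq_of_notMem _ _ _ hu]

lemma obsAt_piecewise {n N : ℕ} {v : Locations M.d N} {τ : Equiv.Perm Z} (hτ : τ ∈ M.permissible)
    {A : Finset (Fin N)} (hA : ∀ u ∈ A, ∀ w ∉ A, ¬M.Visible n (v u) (v w)) (x : Labeling Z N) :
    M.obsAt n v (A.piecewise (τ ∘ x) x) = M.obsAt n v x := by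
  ext1 e
  unfold obsAt obsLaw
  split_ifs with hvis
  · have hiff : e.1.1 ∈ A ↔ e.1.2 ∈ A :=
      ⟨fun h1 => by_contra fun h2 => hA _ h1 _ h2 hvis,
        fun h2 => by_contra fun h1 => hA _ h2 _ h1 (M.visible_comm.1 hvis)⟩
    by_cases h1 : e.1.1 ∈ A
    · rw [Finset.piecewise_eq_of_mem _ _ _ h1, Finset.piecewise_eq_of_mem _ _ _ (hiff.1 h1)]
      exact (hτ.2 _ _).symm
    · rw [Finset.piecewise_eq_of_notMem _ _ _ h1,
        Finset.piecewise_eq_of_notMem _ _ _ (mt hiff.2 h1)]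
  · rfl

end Relabelings

section FailGiven

variable [MeasurableSpace Z] (est : M.Estimator) {n N : ℕ} (v : Locations M.d N)

/-- The observations and seeds for which the estimate agrees with `x` up to a permissible
relabeling. -/
def accept (n : ℕ) (v : Locations M.d N) (x : Labeling Z N) :
    Set (Observations N × unitInterval) :=
  (fun y => est.toFun n N ((v, y.1), y.2)) ⁻¹' M.relabelings x

/-- Probability that the estimate is wrong, given the locations. -/
noncomputable def failGiven (n : ℕ) (v : Locations M.d N) : ENNReal :=
  ∑ x : Labeling Z N, ENNReal.ofReal (M.labelProb x) *
    ((Measure.pi (M.obsAt n v x)).prod (volume : Measure unitInterval)) (M.accept est n v x)ᶜ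

lemma sum_indicator_accept_le (y : Observations N × unitInterval) :
    ∑ x, (M.accept est n v x).indicator 1 y ≤ (Nat.card (Equiv.Perm Z) : ENNReal) := by
  classical
  simp only [Set.indicator_apply, Pi.one_apply, Finset.sum_boole]
  exact_mod_cast M.card_mem_relabelings_le (est.toFun n N ((v, y.1), y.2))

variable [DiscreteMeasurableSpace Z]

lemma measurableSet_accept (x : Labeling Z N) : MeasurableSet (M.accept est n v x) :=
  (est.measurable n N).comp (by fun_prop : Measurable fun y : Observations N × unitInterval =>
    ((v, y.1), y.2)) .of_discrete

variable {v} {A : Finset (Fin N)}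

open Classical in
lemma sum_compl_filter_allLabels_le {ε : ENNReal}
    (hA : Measure.pi (fun _ : Fin N => M.labelLaw) {x | ¬AllLabels A x} ≤ ε) :
    ∑ x ∈ (Finset.univ.filter fun x : Labeling Z N => AllLabels A x)ᶜ,
      ENNReal.ofReal (M.labelProb x) ≤ ε := by
  rw [← pi_labelLaw_coe_finset, Finset.compl_filter, Finset.coe_filter_univ]
  exact hA

open Classical in
lemma sum_labelProb_mul_measure_sum_starWeight_lt_one {i j : Z} (I : Finset (Fin N)) :
    ∑ x, ENNReal.ofReal (M.labelProb x) *
      ((Measure.pi (M.obsAt n v x)).prod (volume : Measure unitInterval))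
        {y | ∑ u ∈ I with x u = i, ENNReal.ofReal (M.starWeight n v i j u (x, y.1)) < 1} =
      M.jointLaw n v {z | ∑ u ∈ I, M.starWeight n v i j u z < 1} := by
  rw [jointLaw_apply _ (measurableSet_lt
    (Finset.measurable_sum _ fun _ _ => M.measurable_starWeight) measurable_const)]
  refine Finset.sum_congr rfl fun x _ => ?_
  have hprod : {y : Observations N × unitInterval | ∑ u ∈ I with x u = i,
      ENNReal.ofReal (M.starWeight n v i j u (x, y.1)) < 1} =
      (Prod.mk x ⁻¹' {z | ∑ u ∈ I, M.starWeight n v i j u z < 1}) ×ˢ Set.univ := by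
    ext y
    have hsum : ∑ u ∈ I with x u = i, M.starWeight n v i j u (x, y.1) =
        ∑ u ∈ I, M.starWeight n v i j u (x, y.1) :=
      Finset.sum_filter_of_ne fun u _ hne => by_contra fun hu => hne (if_neg hu)
    rw [Set.mem_ofPred_eq, ← ENNReal.ofReal_sum_of_nonneg fun u _ => (M.starWeight_mem_Icc _).1,
      ENNReal.ofReal_lt_one, hsum]
    simp
  rw [hprod, Measure.prod_prod, measure_univ, mul_one]
  rfl

lemma half_le_failGiven_of_jointLaw_sum_starWeight_le {i j : Z} (hij : i ≠ j)
    {I : Finset (Fin N)}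
    (hI : M.jointLaw n v {z | ∑ u ∈ I, M.starWeight n v i j u z < 1} ≤ 4⁻¹)
    (hA : Measure.pi (fun _ : Fin N => M.labelLaw) {x | ¬AllLabels A x} ≤ 4⁻¹) :
    2⁻¹ ≤ (ENNReal.ofReal (M.prior i / M.prior j) * Nat.card (Equiv.Perm Z) + 1) *
      M.failGiven est n v := by
  classical
  have hm (x : Labeling Z N) (u : Fin N) : Measurable fun y : Observations N × unitInterval =>
      ENNReal.ofReal (M.starWeight n v i j u (x, y.1)) :=
    (M.measurable_starWeight.comp measurable_prodMk_left).ennreal_ofReal.comp measurable_fst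
  refine half_le_mul_sum_measure_compl (w := fun x => ENNReal.ofReal (M.labelProb x))
    (R := fun x => (Measure.pi (M.obsAt n v x)).prod volume) (A := M.accept est n v)
    (G := Finset.univ.filter fun x => AllLabels A x)
    (active := fun x => I.filter fun u => x u = i) (flip := fun u x => Function.update x u j)
    (ψ := fun u x y => ENNReal.ofReal (M.starWeight n v i j u (x, y.1)))
    M.sum_ofReal_labelProb (M.measurableSet_accept est v) (M.sum_indicator_accept_le est v) hm
    (fun x _ u hu => M.ofReal_labelProb_mul_setLIntegral_starWeight_le volume
      (Finset.mem_filter.1 hu).2 (M.measurableSet_accept est v x))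
    (fun x _ u hu u' _ huu => ?_)
    (fun x hx u hu => (M.disjoint_relabelings_update hij (Finset.mem_filter.1 hu).2
      (Finset.mem_filter.1 hx).2).preimage _)
    (M.sum_compl_filter_allLabels_le hA) ?_
  · by_contra hne
    have := congrFun huu u
    simp only [Function.update_self, Function.update_of_ne hne] at this
    exact hij ((Finset.mem_filter.1 hu).2.symm.trans this.symm)
  · exact (M.sum_labelProb_mul_measure_sum_starWeight_lt_one I).trans_le hI

lemma half_le_failGiven_of_disconnected {τ : Equiv.Perm Z} (hτ : τ ∈ M.permissible) (hτ1 : τ ≠ 1)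
    (hvis : ∀ u ∈ A, ∀ w ∉ A, ¬M.Visible n (v u) (v w))
    (hA : Measure.pi (fun _ : Fin N => M.labelLaw) {x | ¬AllLabels A x} ≤ 4⁻¹) :
    2⁻¹ ≤ ((Nat.card (Equiv.Perm Z) : ENNReal) + 1) * M.failGiven est n v := by
  classical
  rw [← one_mul (Nat.card (Equiv.Perm Z) : ENNReal)]
  refine half_le_mul_sum_measure_compl (G := Finset.univ.filter fun x => AllLabels A x)
    (active := fun _ => ({()} : Finset Unit)) (flip := fun _ x => A.piecewise (τ ∘ x) x)
    (ψ := fun _ _ _ => 1) M.sum_ofReal_labelProb (M.measurableSet_accept est v)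
    (M.sum_indicator_accept_le est v) (fun _ _ => measurable_const) (fun x _ _ _ => ?_)
    (fun _ _ _ _ _ _ _ => rfl)
    (fun x hx _ _ => (M.disjoint_relabelings_piecewise hτ1 (Finset.mem_filter.1 hx).2).preimage _)
    (M.sum_compl_filter_allLabels_le hA) ?_
  · rw [labelProb_piecewise M hτ, obsAt_piecewise M hτ hvis, setLIntegral_one, one_mul]
  · simp

end FailGiven

end GHCMParams

/-! ### Reduction of exact recovery to the conditional failure probability -/

section SigmaMk

variable {α : Type*} {β : α → Type*} [∀ a, MeasurableSpace (β a)]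

lemma measurableEmbedding_sigmaMk (a : α) : MeasurableEmbedding (Sigma.mk a : β a → Sigma β) where
  injective := sigma_mk_injective
  measurable _ hs := MeasurableSpace.measurableSet_iInf.1 hs a
  measurableSet_image' s hs := MeasurableSpace.measurableSet_iInf.2 fun b => by
    change MeasurableSet (Sigma.mk b ⁻¹' (Sigma.mk a '' s))
    by_cases h : a = b
    · subst h
      rwa [Set.preimage_image_eq _ sigma_mk_injective]
    · convert MeasurableSet.empty
      ext y
      simp only [Set.mem_preimage, Set.mem_image, Set.mem_empty_iff_false, iff_false, not_exists,
        not_and]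
      exact fun z _ hz => h (congrArg Sigma.fst hz)

lemma map_sigmaMk_prod_apply {γ : Type*} [MeasurableSpace γ] {a : α} (μ : Measure (β a)) [SFinite μ]
    (ν : Measure γ) [SFinite ν] (S : Set (Sigma β × γ)) :
    ((μ.map (Sigma.mk a)).prod ν) S = (μ.prod ν) {p | (⟨a, p.1⟩, p.2) ∈ S} := by
  have ha := measurableEmbedding_sigmaMk (β := β) a
  have hprod := Measure.map_prod_map μ ν ha.measurable measurable_id
  rw [Measure.map_id] at hprod
  rw [hprod, (ha.prodMap .id).map_apply]
  rfl

end SigmaMk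

namespace GHCMParams

variable {Z : Type*} [Fintype Z] (M : GHCMParams Z) {n N : ℕ}

lemma side_pos (hn : 1 ≤ n) : 0 < M.side n :=
  Real.rpow_pos_of_pos (by exact_mod_cast hn) _

lemma side_pow (n : ℕ) : M.side n ^ M.d = n := by
  unfold side
  rw [← Real.rpow_natCast, ← Real.rpow_mul (Nat.cast_nonneg n),
    one_div_mul_cancel (by exact_mod_cast Nat.one_le_iff_ne_zero.1 M.d_pos), Real.rpow_one]

lemma volume_cube (n : ℕ) : volume (M.cube n) = n := by
  have hside : M.side n / 2 - -(M.side n) / 2 = M.side n := by ring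
  rw [cube, Real.volume_Icc_pi]
  simp only [hside, Finset.prod_const, Finset.card_univ, Fintype.card_fin]
  rw [← ENNReal.ofReal_pow (by unfold side; positivity), side_pow, ENNReal.ofReal_natCast]

/-- Law of the location of one vertex. -/
noncomputable def locLaw (n : ℕ) : Measure (Fin M.d → ℝ) := cond volume (M.cube n)

lemma isProbabilityMeasure_locLaw (hn : 1 ≤ n) : IsProbabilityMeasure (M.locLaw n) :=
  cond_isProbabilityMeasure_of_finite
    (by rw [volume_cube]; exact_mod_cast Nat.one_le_iff_ne_zero.1 hn)
    (by rw [volume_cube]; exact ENNReal.natCast_ne_top n)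

lemma ae_forall_mem_cube (hn : 1 ≤ n) :
    ∀ᵐ v ∂(Measure.pi fun _ : Fin N => M.locLaw n), ∀ l, v l ∈ M.cube n := by
  have := M.isProbabilityMeasure_locLaw hn
  have hmem : ∀ᵐ x ∂(M.locLaw n), x ∈ M.cube n := ae_cond_mem measurableSet_Icc
  exact ae_all_iff.2 fun l =>
    (measurePreserving_eval (fun _ : Fin N => M.locLaw n) l).quasiMeasurePreserving.ae hmem

variable [MeasurableSpace Z]

/-- The event that the estimate is correct up to a permissible relabeling, on graphs with `N`
vertices. -/
def successSet (est : M.Estimator) (n N : ℕ) : Set (LabeledGraph Z M.d N × unitInterval) :=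
  {s | est.toFun n N ((s.1.1.1, s.1.2), s.2) ∈ M.relabelings s.1.1.2}

variable [DiscreteMeasurableSpace Z]

lemma measurableSet_successSet (est : M.Estimator) : MeasurableSet (M.successSet est n N) :=
  have hm : Measurable fun s : LabeledGraph Z M.d N × unitInterval =>
      (est.toFun n N ((s.1.1.1, s.1.2), s.2), s.1.1.2) :=
    .prodMk ((est.measurable n N).comp (by fun_prop)) (by fun_prop)
  hm (.of_discrete (s := {q : Labeling Z N × Labeling Z N | q.1 ∈ M.relabelings q.2}))

lemma isProbabilityMeasure_lawGiven (hn : 1 ≤ n) : IsProbabilityMeasure (M.lawGiven n N) := by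
  have := M.isProbabilityMeasure_locLaw hn
  exact inferInstanceAs (IsProbabilityMeasure (((Measure.pi fun _ : Fin N => M.locLaw n).prod
    (Measure.pi fun _ : Fin N => M.labelLaw)) ⊗ₘ M.obsKernel n N))

variable (est : M.Estimator)

lemma lawGiven_compl_successSet (hn : 1 ≤ n) :
    ((M.lawGiven n N).prod (volume : Measure unitInterval)) (M.successSet est n N)ᶜ =
      ∫⁻ v, M.failGiven est n v ∂(Measure.pi fun _ : Fin N => M.locLaw n) := by
  have := M.isProbabilityMeasure_locLaw hn
  have hS := (M.measurableSet_successSet (n := n) (N := N) est).compl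
  have hlaw : M.lawGiven n N = ((Measure.pi fun _ : Fin N => M.locLaw n).prod
    (Measure.pi fun _ : Fin N => M.labelLaw)) ⊗ₘ M.obsKernel n N := rfl
  have hm : Measurable fun a : LabeledGraph Z M.d N =>
      (volume : Measure unitInterval) (Prod.mk a ⁻¹' (M.successSet est n N)ᶜ) :=
    measurable_measure_prodMk_left hS
  rw [Measure.prod_apply hS, hlaw, Measure.lintegral_compProd hm,
    lintegral_prod _ hm.lintegral_kernel_prod_right'.aemeasurable]
  refine lintegral_congr fun v => ?_
  rw [lintegral_fintype, failGiven]
  refine Finset.sum_congr rfl fun x _ => ?_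
  rw [pi_labelLaw_singleton, mul_comm, Measure.prod_apply (M.measurableSet_accept est v x).compl]
  rfl

lemma successProb_le (hn : 1 ≤ n) :
    M.successProb est n ≤ ∑' N, poissonMeasure (Real.toNNReal (M.lam * n)) {N} *
      ((M.lawGiven n N).prod (volume : Measure unitInterval)) (M.successSet est n N) := by
  unfold successProb law
  rw [Measure.prod_sum_left, Measure.sum_apply_of_countable]
  refine ENNReal.tsum_le_tsum fun N => ?_
  have := M.isProbabilityMeasure_lawGiven (N := N) hn
  rw [Measure.prod_smul_left, Measure.smul_apply, smul_eq_mul, map_sigmaMk_prod_apply]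
  gcongr
  exact fun s hs => M.mem_relabelings_of_agreement_eq_one hs

lemma tsum_poissonMeasure_mul_lintegral_failGiven_le (hn : 1 ≤ n) :
    ∑' N, poissonMeasure (Real.toNNReal (M.lam * n)) {N} *
      ∫⁻ v, M.failGiven est n v ∂(Measure.pi fun _ : Fin N => M.locLaw n) ≤
        1 - M.successProb est n := by
  set po := poissonMeasure (Real.toNNReal (M.lam * n))
  have hadd (N : ℕ) : po {N} * ((M.lawGiven n N).prod (volume : Measure unitInterval))
      (M.successSet est n N) + po {N} * ∫⁻ v, M.failGiven est n v
        ∂(Measure.pi fun _ : Fin N => M.locLaw n) = po {N} := by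
    have := M.isProbabilityMeasure_lawGiven (N := N) hn
    rw [← lawGiven_compl_successSet M est hn, ← mul_add,
      prob_add_prob_compl (M.measurableSet_successSet est), mul_one]
  have htotal : ∑' N, po {N} = 1 := by
    simpa using Measure.tsum_indicator_apply_singleton po Set.univ .univ
  have hle : M.successProb est n + ∑' N, po {N} *
      ∫⁻ v, M.failGiven est n v ∂(Measure.pi fun _ : Fin N => M.locLaw n) ≤ 1 := by
    refine (add_le_add_left (M.successProb_le est hn) _).trans ?_
    rw [← ENNReal.tsum_add, tsum_congr hadd, htotal]
  exact ENNReal.le_sub_of_add_le_left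
    (ne_top_of_le_ne_top ENNReal.one_ne_top (le_self_add.trans hle)) hle

end GHCMParams

lemma inv_two_mul_le_lintegral {Ω : Type*} [MeasurableSpace Ω] {μ : Measure Ω} [IsFiniteMeasure μ]
    {S : Set Ω} (hS : MeasurableSet S) (hμ : 1 / 2 ≤ μ.real S) {a : ENNReal} {f : Ω → ENNReal}
    (hf : ∀ᵐ x ∂μ, x ∈ S → a ≤ f x) : 2⁻¹ * a ≤ ∫⁻ x, f x ∂μ := by
  have hhalf : (2 : ENNReal)⁻¹ ≤ μ S := by
    rw [← ofReal_measureReal, ← ENNReal.ofReal_ofNat 2, ← ENNReal.ofReal_inv_of_pos two_pos]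
    exact ENNReal.ofReal_le_ofReal (by rwa [← one_div])
  calc 2⁻¹ * a ≤ a * μ S := by rw [mul_comm]; gcongr
    _ = ∫⁻ _ in S, a ∂μ := by rw [setLIntegral_const]
    _ ≤ ∫⁻ x in S, f x ∂μ := setLIntegral_mono_ae' hS hf
    _ ≤ ∫⁻ x, f x ∂μ := setLIntegral_le_lintegral _ _

namespace GHCMParams

variable {Z : Type*} [Fintype Z] [MeasurableSpace Z] [DiscreteMeasurableSpace Z]
  (M : GHCMParams Z) (est : M.Estimator)

lemma not_exactRecovery_of_half_le_failGiven {K : ENNReal} (hK : K ≠ ⊤) {ε : ℝ} (hε : 0 < ε)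
    (h : ∀ᶠ n : ℕ in atTop, ∀ N : ℕ, (M.lam - ε) * n ≤ N → (N : ℝ) ≤ (M.lam + ε) * n →
      ∃ G : Set (Locations M.d N), MeasurableSet G ∧
        1 / 2 ≤ (Measure.pi fun _ : Fin N => M.locLaw n).real G ∧
        ∀ v ∈ G, (∀ l, v l ∈ M.cube n) → 2⁻¹ ≤ K * M.failGiven est n v) :
    ¬M.ExactRecovery est := by
  intro hrec
  have hlim : Tendsto (fun n => K * (1 - M.successProb est n)) atTop (𝓝 0) := by
    simpa using ENNReal.Tendsto.const_mul (ENNReal.Tendsto.sub (tendsto_const_nhds (x := 1)) hrec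
      (.inl ENNReal.one_ne_top)) (.inr hK)
  obtain ⟨n, hn, hlt, hpois, hn1⟩ := (h.and ((hlim.eventually (gt_mem_nhds
    (by simp : (0 : ENNReal) < 2⁻¹ * (2⁻¹ * 2⁻¹)))).and
    ((eventually_half_le_poissonMeasure M.lam_pos hε).and (eventually_ge_atTop 1)))).exists
  have := M.isProbabilityMeasure_locLaw hn1
  refine hlt.not_ge ?_
  calc 2⁻¹ * (2⁻¹ * 2⁻¹)
      ≤ ∫⁻ N, K * (∫⁻ v, M.failGiven est n v ∂(Measure.pi fun _ : Fin N => M.locLaw n))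
          ∂(poissonMeasure (Real.toNNReal (M.lam * n))) :=
        inv_two_mul_le_lintegral .of_discrete hpois <| ae_of_all _ fun N hN => by
          obtain ⟨G, hG, hG2, hfail⟩ := hn N hN.1 hN.2
          rw [← lintegral_const_mul' _ _ hK]
          refine inv_two_mul_le_lintegral hG hG2 ?_
          filter_upwards [M.ae_forall_mem_cube hn1] with v hv hvG using hfail v hvG hv
    _ = K * ∑' N, poissonMeasure (Real.toNNReal (M.lam * n)) {N} *
          ∫⁻ v, M.failGiven est n v ∂(Measure.pi fun _ : Fin N => M.locLaw n) := by
        rw [lintegral_const_mul' _ _ hK, lintegral_countable']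
        simp_rw [mul_comm]
    _ ≤ K * (1 - M.successProb est n) := by
        gcongr
        exact M.tsum_poissonMeasure_mul_lintegral_failGiven_le est hn1

end GHCMParams

/-! ### Cells on a sparse grid -/

lemma half_le_natFloor {x : ℝ} (hx : 1 ≤ x) : x / 2 ≤ ⌊x⌋₊ := by
  have hlt := Nat.lt_floor_add_one x
  have hone : (1 : ℝ) ≤ ⌊x⌋₊ := by exact_mod_cast (Nat.one_le_floor_iff x).2 hx
  linarith

lemma exists_pos_mul_lt_one {lam ν σ : ℝ} {d : ℕ} (hlam : 0 < lam) (hd : d ≠ 0)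
    (h : lam * (ν * (1 - σ)) < 1) :
    ∃ ε > 0, ε < 1 ∧ ε < lam ∧
      (lam + ε) * (σ * (ν * ε ^ d) + (1 - σ) * (ν * (ε + 1) ^ d)) < 1 := by
  have hlim : Tendsto (fun ε : ℝ => (lam + ε) * (σ * (ν * ε ^ d) + (1 - σ) * (ν * (ε + 1) ^ d)))
      (𝓝[>] 0) (𝓝 ((lam + 0) * (σ * (ν * 0 ^ d) + (1 - σ) * (ν * (0 + 1) ^ d)))) :=
    (Continuous.tendsto (by fun_prop) 0).mono_left nhdsWithin_le_nhds
  have hlt : (lam + 0) * (σ * (ν * 0 ^ d) + (1 - σ) * (ν * (0 + 1) ^ d)) < 1 := by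
    rw [zero_pow hd]
    exact lt_of_eq_of_lt (by ring) h
  obtain ⟨ε, hε, hεlt, hε0⟩ := ((hlim.eventually (gt_mem_nhds hlt)).and
    ((eventually_nhdsWithin_of_eventually_nhds (eventually_lt_nhds (lt_min one_pos hlam))).and
      self_mem_nhdsWithin)).exists
  exact ⟨ε, hε0, (lt_min_iff.1 hεlt).1, (lt_min_iff.1 hεlt).2, hε⟩

namespace GHCMParams

variable {Z : Type*} [Fintype Z] (M : GHCMParams Z) {n : ℕ}

/-- The visibility radius. -/
noncomputable def radius (n : ℕ) : ℝ := Real.log n ^ (1 / (M.d : ℝ))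

lemma radius_pow (n : ℕ) : M.radius n ^ M.d = Real.log n := by
  unfold radius
  rw [← Real.rpow_natCast, ← Real.rpow_mul (Real.log_natCast_nonneg n),
    one_div_mul_cancel (by exact_mod_cast Nat.one_le_iff_ne_zero.1 M.d_pos), Real.rpow_one]

lemma radius_nonneg (n : ℕ) : 0 ≤ M.radius n :=
  Real.rpow_nonneg (Real.log_natCast_nonneg n) _

lemma radius_pos (hn : 2 ≤ n) : 0 < M.radius n :=
  Real.rpow_pos_of_pos (Real.log_pos (by exact_mod_cast hn)) _

lemma eventually_mul_radius_le_side (K : ℝ) : ∀ᶠ n : ℕ in atTop, K * M.radius n ≤ M.side n := by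
  have hlim := (tendsto_log_div_natCast.const_mul (K ^ M.d)).eventually
    (ge_mem_nhds (by simp : K ^ M.d * 0 < 1))
  filter_upwards [hlim, eventually_ge_atTop 1] with n hn hn1
  refine le_of_pow_le_pow_left₀ (Nat.one_le_iff_ne_zero.1 M.d_pos) (M.side_pos hn1).le ?_
  rwa [mul_pow, radius_pow, side_pow, ← div_le_one (by exact_mod_cast hn1), mul_div_assoc]

lemma locLaw_real_of_subset {S : Set (Fin M.d → ℝ)} (h : S ⊆ M.cube n) :
    (M.locLaw n).real S = volume.real S / n := by
  rw [measureReal_def, locLaw, cond_apply (show MeasurableSet (M.cube n) from measurableSet_Icc),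
    Set.inter_eq_self_of_subset_right h, volume_cube, ENNReal.toReal_mul, ENNReal.toReal_inv,
    ENNReal.toReal_natCast, measureReal_def, div_eq_inv_mul]

/-- Indices of the points of a grid of mesh `4 * radius n` which fills the subcube
`[0, n^{1/d}/4]^d`: far from the boundary, the toroidal distance is Euclidean. -/
abbrev GridIndex (n : ℕ) : Type := Fin M.d → Fin ⌊M.side n / (16 * M.radius n)⌋₊

/-- The grid point with a given index. -/
noncomputable def gridPoint (c : M.GridIndex n) : Fin M.d → ℝ :=
  fun a => 4 * M.radius n * (c a : ℕ)

lemma gridPoint_mem_Icc (hn : 2 ≤ n) (c : M.GridIndex n) (a : Fin M.d) :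
    M.gridPoint c a ∈ Set.Icc 0 (M.side n / 4) := by
  have hr := M.radius_pos hn
  have hc : ((c a : ℕ) : ℝ) ≤ M.side n / (16 * M.radius n) :=
    (Nat.le_floor_iff (by have := M.side_pos (by lia : 1 ≤ n); positivity)).1 (c a).2.le
  rw [le_div_iff₀ (by positivity)] at hc
  unfold gridPoint
  exact ⟨by positivity, by linarith⟩

lemma le_abs_gridPoint_sub {c c' : M.GridIndex n} {a : Fin M.d} (h : c a ≠ c' a) :
    4 * M.radius n ≤ |M.gridPoint c a - M.gridPoint c' a| := by
  have hr := M.radius_nonneg n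
  have hone : (1 : ℝ) ≤ |((c a : ℕ) : ℝ) - (c' a : ℕ)| := by
    have hne : ((c a : ℕ) : ℤ) - (c' a : ℕ) ≠ 0 := fun h0 => h (Fin.ext (by lia))
    exact_mod_cast Int.one_le_abs hne
  unfold gridPoint
  rw [← mul_sub, abs_mul, abs_of_nonneg (by positivity)]
  exact le_mul_of_one_le_right (by positivity) hone

lemma le_card_gridIndex (hn : 2 ≤ n) (h : 16 * M.radius n ≤ M.side n) :
    (1 / 32) ^ M.d * (n / Real.log n) ≤ Fintype.card (M.GridIndex n) := by
  have hr := M.radius_pos hn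
  have hL := M.side_pos (by lia : 1 ≤ n)
  rw [Fintype.card_fun, Fintype.card_fin, Fintype.card_fin, Nat.cast_pow, ← M.radius_pow,
    ← M.side_pow, ← div_pow, ← mul_pow]
  refine pow_le_pow_left₀ (by positivity) (le_trans (le_of_eq ?_)
    (half_le_natFloor ((one_le_div (by positivity)).2 h))) _
  field_simp
  norm_num

lemma mem_Ioo_of_abs_sub_gridPoint_lt (hn : 2 ≤ n) {c : M.GridIndex n} {w : Fin M.d → ℝ}
    {a : Fin M.d} (hw : |w a - M.gridPoint c a| < 2 * M.radius n) :
    w a ∈ Set.Ioo (-(2 * M.radius n)) (M.side n / 4 + 2 * M.radius n) := by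
  obtain ⟨hc, hc'⟩ := M.gridPoint_mem_Icc hn c a
  obtain ⟨hw, hw'⟩ := abs_lt.1 hw
  exact ⟨by linarith, by linarith⟩

lemma mem_cube_of_abs_sub_gridPoint_lt (hn : 2 ≤ n) (h : 16 * M.radius n ≤ M.side n)
    {c : M.GridIndex n} {w : Fin M.d → ℝ}
    (hw : ∀ a, |w a - M.gridPoint c a| < 2 * M.radius n) : w ∈ M.cube n := by
  have := M.radius_nonneg n
  refine ⟨fun a => ?_, fun a => ?_⟩ <;>
  · obtain ⟨hwa, hwa'⟩ := M.mem_Ioo_of_abs_sub_gridPoint_lt hn (hw a)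
    beta_reduce
    linarith

lemma abs_sub_lt_of_mem_cube (h : 32 * M.radius n ≤ M.side n) {x y : Fin M.d → ℝ} {a : Fin M.d}
    (hx : x a ∈ Set.Ioo (-(2 * M.radius n)) (M.side n / 4 + 2 * M.radius n))
    (hy : y ∈ M.cube n) : |x a - y a| < M.side n - M.radius n := by
  have := M.radius_nonneg n
  obtain ⟨hx, hx'⟩ := hx
  have hy' := hy.2 a
  have hy := hy.1 a
  beta_reduce at hy hy'
  exact abs_lt.2 ⟨by linarith, by linarith⟩

lemma pairwise_disjoint_of_near_gridPoint {S : M.GridIndex n → Set (Fin M.d → ℝ)}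
    (hS : ∀ c, ∀ w ∈ S c, ∀ a, |w a - M.gridPoint c a| < 2 * M.radius n) :
    Pairwise fun c c' => Disjoint (S c) (S c') := by
  intro c c' hcc
  obtain ⟨a, ha⟩ := Function.ne_iff.1 hcc
  refine Set.disjoint_left.2 fun w hw hw' => (M.le_abs_gridPoint_sub ha).not_gt ?_
  linarith [abs_sub_le (M.gridPoint c a) (w a) (M.gridPoint c' a), hS c w hw a, hS c' w hw' a,
    abs_sub_comm (w a) (M.gridPoint c a)]

variable [MeasurableSpace Z] [DiscreteMeasurableSpace Z] (est : M.Estimator)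

lemma not_exactRecovery_of_gridCells {K : ENNReal} (hK : K ≠ ⊤) {ν σ T : ℝ} (hν : 0 < ν)
    (hσ : σ ∈ Set.Icc (0 : ℝ) 1) (hlam : M.lam * (ν * (1 - σ)) < 1)
    {D : ℝ → ∀ {n}, M.GridIndex n → Cell (Fin M.d → ℝ)}
    (hcore : ∀ ε > 0, ∀ n (c : M.GridIndex n),
      volume.real (D ε c).core = ν * ε ^ M.d * Real.log n)
    (houter : ∀ ε > 0, ∀ n (c : M.GridIndex n),
      volume.real (D ε c).outer = ν * (ε + 1) ^ M.d * Real.log n)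
    (hnear : ∀ ε < 1, ∀ n ≥ 2, ∀ (c : M.GridIndex n), ∀ w ∈ (D ε c).outer, ∀ a,
      |w a - M.gridPoint c a| < 2 * M.radius n)
    (hfail : ∀ ε > 0, ε < 1 → ∀ᶠ n : ℕ in atTop, ∀ (N : ℕ) (v : Locations M.d N),
      (∀ l, v l ∈ M.cube n) → T ≤ ∑ c : M.GridIndex n, (D ε c).isolationWeight σ v →
        2⁻¹ ≤ K * M.failGiven est n v) :
    ¬M.ExactRecovery est := by
  obtain ⟨ε, hε, hε1, hεl, hκ⟩ :=
    exists_pos_mul_lt_one M.lam_pos (Nat.one_le_iff_ne_zero.1 M.d_pos) hlam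
  refine M.not_exactRecovery_of_half_le_failGiven est hK hε ?_
  have h1σ := sub_nonneg.2 hσ.2
  have hσ0 := hσ.1
  filter_upwards [hfail ε hε hε1, M.eventually_mul_radius_le_side 16, eventually_ge_atTop 2,
    Cell.eventually_half_le_measureReal_sum_isolationWeight (sub_pos.2 hεl) (by positivity) hκ
      (by positivity : (0 : ℝ) < (1 / 32) ^ M.d) (by positivity : 0 < ν * ε ^ M.d) T]
    with n hfail hside hn hhalf N hN hN'
  have := M.isProbabilityMeasure_locLaw (by lia : 1 ≤ n)
  have hcube (c : M.GridIndex n) : (D ε c).outer ⊆ M.cube n := fun w hw =>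
    M.mem_cube_of_abs_sub_gridPoint_lt hn hside (hnear ε hε1 n hn c w hw)
  refine ⟨{v | T ≤ ∑ c : M.GridIndex n, (D ε c).isolationWeight σ v},
    measurableSet_le measurable_const (by fun_prop), ?_, fun v hv hvc => hfail N v hvc hv⟩
  refine hhalf N hN hN' _ _ (M.locLaw n) (D ε) σ
    hσ (M.pairwise_disjoint_of_near_gridPoint (hnear ε hε1 n hn))
    (M.le_card_gridIndex hn hside) (fun c => ?_) (fun c => ?_)
  · rw [M.locLaw_real_of_subset ((D ε c).core_subset_outer.trans (hcube c)), hcore ε hε,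
      mul_div_assoc]
  · rw [Cell.integral_discount, M.locLaw_real_of_subset (hcube c),
      M.locLaw_real_of_subset ((D ε c).core_subset_outer.trans (hcube c)), hcore ε hε,
      houter ε hε]
    exact le_of_eq (by ring)

end GHCMParams

/-! ### Confusion of two labels -/

/-- Closed Euclidean ball among the coordinate vectors, whose own distance is the supremum one. -/
def euclideanBall {d : ℕ} (z : Fin d → ℝ) (R : ℝ) : Set (Fin d → ℝ) :=
  WithLp.toLp 2 ⁻¹' Metric.closedBall (WithLp.toLp 2 z : EuclideanSpace ℝ (Fin d)) R

section euclideanBall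

variable {d : ℕ} {z w : Fin d → ℝ} {L r R : ℝ}

lemma measurableSet_euclideanBall : MeasurableSet (euclideanBall z R) :=
  measurableSet_closedBall.preimage (PiLp.continuous_toLp 2 _).measurable

lemma unitBallVolume_pos : 0 < unitBallVolume d :=
  ENNReal.toReal_pos (Metric.measure_ball_pos _ _ one_pos).ne' measure_ball_lt_top.ne

lemma volume_real_euclideanBall (hR : 0 ≤ R) :
    volume.real (euclideanBall z R) = unitBallVolume d * R ^ d := by
  have hvol : volume (euclideanBall z R) =
      volume (Metric.closedBall (WithLp.toLp 2 z : EuclideanSpace ℝ (Fin d)) R) :=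
    (EuclideanSpace.volume_preserving_symm_measurableEquiv_toLp (Fin d)).symm.measure_preimage
      measurableSet_closedBall.nullMeasurableSet
  rw [measureReal_def, hvol, Measure.addHaar_closedBall _ _ hR, ENNReal.toReal_mul,
    ENNReal.toReal_ofReal (by positivity), finrank_euclideanSpace_fin, unitBallVolume, mul_comm]

lemma abs_sub_le_of_mem_euclideanBall (h : w ∈ euclideanBall z R) (a : Fin d) :
    |w a - z a| ≤ R :=
  (PiLp.norm_apply_le (p := 2)
    (WithLp.toLp 2 w - WithLp.toLp 2 z : EuclideanSpace ℝ (Fin d)) a).trans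
      ((dist_eq_norm _ _).ge.trans h)

lemma abs_min_le_torusDist (L : ℝ) (z w : Fin d → ℝ) (a : Fin d) :
    |min |z a - w a| (L - |z a - w a|)| ≤ torusDist L z w := by
  unfold torusDist
  rw [← Real.sqrt_sq_eq_abs]
  exact Real.sqrt_le_sqrt (Finset.single_le_sum
    (f := fun a => (min |z a - w a| (L - |z a - w a|)) ^ 2) (fun _ _ => sq_nonneg _)
    (Finset.mem_univ a))

lemma abs_sub_le_of_torusDist_le (h : torusDist L z w ≤ r) {a : Fin d}
    (ha : |z a - w a| < L - r) : |z a - w a| ≤ r := by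
  have hmin := (le_abs_self _).trans ((abs_min_le_torusDist L z w a).trans h)
  rcases min_le_iff.1 hmin with hle | hle
  · exact hle
  · linarith

lemma dist_toLp_le_of_torusDist_le (h : torusDist L z w ≤ r) (ha : ∀ a, |z a - w a| < L - r) :
    dist (WithLp.toLp 2 w : EuclideanSpace ℝ (Fin d)) (WithLp.toLp 2 z) ≤ r := by
  refine le_trans (le_of_eq ?_) h
  rw [dist_comm, EuclideanSpace.dist_eq, torusDist]
  congr 1
  refine Finset.sum_congr rfl fun a _ => ?_
  have hle := abs_sub_le_of_torusDist_le h (ha a)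
  rw [min_eq_left (by linarith [ha a]), Real.dist_eq]

end euclideanBall

namespace GHCMParams

variable {Z : Type*} [Fintype Z] (M : GHCMParams Z) {n N : ℕ} {ε : ℝ}

/-- Concentric balls around a grid point: the points visible from the small core lie in the outer
ball. -/
def ballCell (ε : ℝ) (c : M.GridIndex n) : Cell (Fin M.d → ℝ) where
  core := euclideanBall (M.gridPoint c) (ε * M.radius n)
  outer := euclideanBall (M.gridPoint c) ((ε + 1) * M.radius n)
  measurableSet_core := measurableSet_euclideanBall
  measurableSet_outer := measurableSet_euclideanBall
  core_subset_outer := Set.preimage_mono (Metric.closedBall_subset_closedBall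
    (mul_le_mul_of_nonneg_right (le_add_of_nonneg_right zero_le_one) (M.radius_nonneg n)))

lemma abs_sub_gridPoint_lt_of_mem_ballCell_outer (hn : 2 ≤ n) (hε : ε < 1) {c : M.GridIndex n}
    {w : Fin M.d → ℝ} (hw : w ∈ (M.ballCell ε c).outer) (a : Fin M.d) :
    |w a - M.gridPoint c a| < 2 * M.radius n := by
  rw [ballCell] at hw
  refine (abs_sub_le_of_mem_euclideanBall hw a).trans_lt ?_
  have hr := M.radius_pos hn
  gcongr
  linarith

lemma volume_real_ballCell_core (hε : 0 ≤ ε) (c : M.GridIndex n) :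
    volume.real (M.ballCell ε c).core = unitBallVolume M.d * ε ^ M.d * Real.log n := by
  have := M.radius_nonneg n
  rw [ballCell, volume_real_euclideanBall (by positivity), mul_pow, radius_pow, mul_assoc]

lemma volume_real_ballCell_outer (hε : 0 ≤ ε) (c : M.GridIndex n) :
    volume.real (M.ballCell ε c).outer = unitBallVolume M.d * (ε + 1) ^ M.d * Real.log n := by
  have := M.radius_nonneg n
  rw [ballCell, volume_real_euclideanBall (by positivity), mul_pow, radius_pow, mul_assoc]

lemma mem_ballCell_outer_of_visible (hn : 2 ≤ n) (h : 32 * M.radius n ≤ M.side n) (hε : ε < 1)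
    {c : M.GridIndex n} {x y : Fin M.d → ℝ} (hx : x ∈ (M.ballCell ε c).core) (hy : y ∈ M.cube n)
    (hxy : M.Visible n x y) : y ∈ (M.ballCell ε c).outer := by
  have hxo := (M.ballCell ε c).core_subset_outer hx
  have hdist := dist_toLp_le_of_torusDist_le hxy fun a =>
    M.abs_sub_lt_of_mem_cube h (M.mem_Ioo_of_abs_sub_gridPoint_lt hn
      (M.abs_sub_gridPoint_lt_of_mem_ballCell_outer hn hε hxo a)) hy
  exact (dist_triangle _ (WithLp.toLp 2 x) _).trans
    ((add_le_add hdist hx).trans (le_of_eq (by rw [radius]; ring)))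

lemma exists_pairwise_separatedStars {ι : Type*} [Fintype ι] {C : ι → Cell (Fin M.d → ℝ)}
    (hC : Pairwise fun c c' => Disjoint (C c).outer (C c').outer) {σ : ℝ}
    (hσ : σ ∈ Set.Icc (0 : ℝ) 1) {v : Locations M.d N}
    (hvis : ∀ c u l, v u ∈ (C c).core → M.Visible n (v u) (v l) → v l ∈ (C c).outer) :
    ∃ I : Finset (Fin N), (I : Set (Fin N)).Pairwise (M.SeparatedStars n v) ∧
      ∑ c, (C c).isolationWeight σ v ≤ ∑ u ∈ I, σ ^ Fintype.card (M.Nbr n v u) := by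
  classical
  have hcore {c u} (h : (C c).isolationTerm σ u v ≠ 0) : v u ∈ (C c).core :=
    Cell.mem_core_of_isolationTerm_ne_zero h
  have hstar {c u} (h : (C c).isolationTerm σ u v ≠ 0) {l} :
      (l = u ∨ M.Visible n (v u) (v l)) → v l ∈ (C c).outer
    | .inl hl => hl ▸ (C c).core_subset_outer (hcore h)
    | .inr hl => hvis c u l (hcore h) hl
  have huniq {c c' : ι} {u} (h : (C c).isolationTerm σ u v ≠ 0)
      (h' : (C c').isolationTerm σ u v ≠ 0) : c = c' := by
    by_contra hne
    exact Set.disjoint_left.1 (hC hne) (hstar h (.inl rfl)) (hstar h' (.inl rfl))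
  refine ⟨Finset.univ.filter fun u => ∃ c, (C c).isolationTerm σ u v ≠ 0, ?_, ?_⟩
  · intro u hu u' hu' huu l l' hl hl' hll
    obtain ⟨c, hc⟩ := (Finset.mem_filter.1 hu).2
    obtain ⟨c', hc'⟩ := (Finset.mem_filter.1 hu').2
    have hne : c ≠ c' := by
      rintro rfl
      exact hc' (Cell.isolationTerm_eq_zero_of_ne huu hc)
    exact Set.disjoint_left.1 (hC hne) (hstar hc hl) (hll ▸ hstar hc' hl')
  · unfold Cell.isolationWeight
    rw [Finset.sum_comm, Finset.sum_filter]
    refine Finset.sum_le_sum fun u _ => ?_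
    split_ifs with hu
    · obtain ⟨c, hc⟩ := hu
      rw [Finset.sum_eq_single_of_mem c (Finset.mem_univ c) fun c' _ hne =>
        by_contra fun hc' => hne (huniq hc' hc)]
      exact Cell.isolationTerm_le_pow hσ hc fun l hl => ⟨hl.1, hstar hc (.inr hl.2)⟩
    · push Not at hu
      simp [hu]

variable [MeasurableSpace Z] [DiscreteMeasurableSpace Z] (est : M.Estimator)

lemma exists_half_le_failGiven_of_sum_isolationWeight {i j : Z} (hij : i ≠ j) {c σ : ℝ}
    (hc : 0 < c) (hσ : σ ∈ Set.Icc (0 : ℝ) 1)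
    (hcσ : ∀ (T : Type) [Fintype T],
      c * σ ^ Fintype.card T ≤ testingAffinity (M.markLaw i) (M.ratio i j) T) :
    ∃ T : ℝ, ∀ {n N : ℕ} {v : Locations M.d N} {ι : Type} [Fintype ι]
      {C : ι → Cell (Fin M.d → ℝ)}, (Pairwise fun c c' => Disjoint (C c).outer (C c').outer) →
      (∀ c u l, v u ∈ (C c).core → M.Visible n (v u) (v l) → v l ∈ (C c).outer) →
      T ≤ ∑ c, (C c).isolationWeight σ v →
        2⁻¹ ≤ (ENNReal.ofReal (M.prior i / M.prior j) * Nat.card (Equiv.Perm Z) + 1) *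
          M.failGiven est n v := by
  obtain ⟨m, hm⟩ := M.exists_pi_labelLaw_not_allLabels_le (ε := 4⁻¹) (by simp)
  refine ⟨max (16 / (M.prior i * c)) (2 * m), fun {n N v ι _ C} hC hvis hT => ?_⟩
  obtain ⟨I, hsep, hI⟩ := M.exists_pairwise_separatedStars hC hσ hvis
  obtain ⟨hT, hTm⟩ := max_le_iff.1 (hT.trans hI)
  have hN : 2 * m ≤ N := by
    have hle : ∑ u ∈ I, σ ^ Fintype.card (M.Nbr n v u) ≤ N :=
      (Finset.sum_le_card_nsmul I _ 1 fun u _ => pow_le_one₀ hσ.1 hσ.2).trans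
        (by simpa using I.card_le_univ)
    exact_mod_cast hTm.trans hle
  obtain ⟨A, -, hA⟩ := Finset.exists_subset_card_eq
    (show m ≤ (Finset.univ : Finset (Fin N)).card by rw [Finset.card_fin]; lia)
  have hA' : m ≤ Aᶜ.card := by
    rw [Finset.card_compl, Fintype.card_fin]
    lia
  refine M.half_le_failGiven_of_jointLaw_sum_starWeight_le est hij (I := I)
    (M.jointLaw_sum_starWeight_lt_one_le hsep hcσ ?_) (hm N A hA.ge hA')
  rwa [div_le_iff₀' (mul_pos (M.prior_pos i) hc)] at hT

lemma not_exactRecovery_of_testingAffinity {i j : Z} (hij : i ≠ j) {c σ : ℝ} (hc : 0 < c)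
    (hσ : σ ∈ Set.Icc (0 : ℝ) 1)
    (hcσ : ∀ (T : Type) [Fintype T],
      c * σ ^ Fintype.card T ≤ testingAffinity (M.markLaw i) (M.ratio i j) T)
    (h : M.lam * (unitBallVolume M.d * (1 - σ)) < 1) : ¬M.ExactRecovery est := by
  obtain ⟨T, hT⟩ := M.exists_half_le_failGiven_of_sum_isolationWeight est hij hc hσ hcσ
  refine M.not_exactRecovery_of_gridCells est (T := T)
    (K := ENNReal.ofReal (M.prior i / M.prior j) * Nat.card (Equiv.Perm Z) + 1) (by finiteness)
    unitBallVolume_pos hσ h (D := fun ε _ => M.ballCell ε)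
    (fun ε hε n => M.volume_real_ballCell_core hε.le)
    (fun ε hε n => M.volume_real_ballCell_outer hε.le)
    (fun ε hε n hn c w => M.abs_sub_gridPoint_lt_of_mem_ballCell_outer hn hε) fun ε _ hε1 => ?_
  filter_upwards [M.eventually_mul_radius_le_side 32, eventually_ge_atTop 2] with n h32 hn N v hv
  exact hT (M.pairwise_disjoint_of_near_gridPoint fun c w =>
      M.abs_sub_gridPoint_lt_of_mem_ballCell_outer hn hε1)
    fun c u l hu hul => M.mem_ballCell_outer_of_visible hn h32 hε1 hu (hv l) hul

end GHCMParams

/-! ### The Chernoff–Hellinger threshold -/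

lemma mul_div_rpow {p q t : ℝ} (hp : 0 ≤ p) (hq : 0 ≤ q) (ht : t < 1) :
    p * (q / p) ^ t = p ^ (1 - t) * q ^ t := by
  rcases hp.eq_or_lt with rfl | hp
  · rw [zero_mul, Real.zero_rpow (by linarith), zero_mul]
  · rw [Real.div_rpow hq hp.le, Real.rpow_sub hp, Real.rpow_one]
    field_simp

lemma exists_lt_and_mul_one_sub_lt {a s : ℝ} (h : a * (1 - s) < 1) (hs : 0 < s) :
    ∃ σ ∈ Set.Ioo 0 s, a * (1 - σ) < 1 := by
  have hlim : Tendsto (fun σ : ℝ => a * (1 - σ)) (𝓝[<] s) (𝓝 (a * (1 - s))) :=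
    (Continuous.tendsto (by fun_prop) s).mono_left nhdsWithin_le_nhds
  obtain ⟨σ, hσ, hσs⟩ := ((hlim.eventually (gt_mem_nhds h)).and (Ioo_mem_nhdsLT hs)).exists
  exact ⟨σ, hσs, hσ⟩

namespace GHCMParams

variable {Z : Type*} [Fintype Z] (M : GHCMParams Z)

/-- The sum of the Hellinger integrals of order `t` in the Chernoff–Hellinger divergence. -/
noncomputable def hellinger (i j : Z) (t : ℝ) : ℝ :=
  ∑ r, M.prior r * ∫ y, M.p i r y ^ t * M.p j r y ^ (1 - t) ∂M.ref

lemma hellinger_nonneg (i j : Z) (t : ℝ) : 0 ≤ M.hellinger i j t :=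
  Finset.sum_nonneg fun r _ => mul_nonneg (M.prior_pos r).le (integral_nonneg fun _ =>
    mul_nonneg (Real.rpow_nonneg (M.p_nonneg _ _ _) _) (Real.rpow_nonneg (M.p_nonneg _ _ _) _))

lemma hellinger_zero (i j : Z) : M.hellinger i j 0 = 1 := by
  have hint (r : Z) : ∫ y, M.p j r y ∂M.ref = 1 := by
    rw [integral_eq_lintegral_of_nonneg_ae (ae_of_all _ (M.p_nonneg j r))
      (M.p_measurable j r).aestronglyMeasurable, M.p_lintegral, ENNReal.toReal_one]
  simp [hellinger, hint, M.prior_sum]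

lemma one_sub_chDiv (i j : Z) :
    1 - M.chDiv i j = ⨅ t : Set.Icc (0 : ℝ) 1, M.hellinger i j t :=
  sub_sub_cancel _ _

lemma one_sub_chDiv_le (i j : Z) {t : ℝ} (ht : t ∈ Set.Icc (0 : ℝ) 1) :
    1 - M.chDiv i j ≤ M.hellinger i j t := by
  rw [one_sub_chDiv]
  exact ciInf_le (f := fun t : Set.Icc (0 : ℝ) 1 => M.hellinger i j t)
    ⟨0, Set.forall_mem_range.2 fun t => M.hellinger_nonneg i j t⟩ ⟨t, ht⟩

lemma one_sub_chDiv_mem_Icc (i j : Z) : 1 - M.chDiv i j ∈ Set.Icc (0 : ℝ) 1 := by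
  refine ⟨?_, (M.one_sub_chDiv_le i j ⟨le_rfl, zero_le_one⟩).trans (M.hellinger_zero i j).le⟩
  rw [one_sub_chDiv]
  exact Real.iInf_nonneg fun t => M.hellinger_nonneg i j t

lemma integral_ratio_mk_rpow (i j r : Z) {t : ℝ} (ht : t < 1) :
    ∫ y, M.ratio i j (r, y) ^ t ∂M.P i r =
      ∫ y, M.p i r y ^ (1 - t) * M.p j r y ^ t ∂M.ref := by
  rw [P, integral_withDensity_eq_integral_toReal_smul (M.p_measurable i r).ennreal_ofReal
    (ae_of_all _ fun _ => ENNReal.ofReal_lt_top)]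
  refine integral_congr_ae (ae_of_all _ fun y => ?_)
  simp only [ratio, ENNReal.toReal_ofReal (M.p_nonneg i r y), smul_eq_mul]
  exact mul_div_rpow (M.p_nonneg i r y) (M.p_nonneg j r y) ht

variable [MeasurableSpace Z]

lemma integral_markLaw (i : Z) {f : Z × ℝ → ℝ} (hf : Measurable f)
    (hfi : Integrable f (M.markLaw i)) :
    ∫ z, f z ∂(M.markLaw i) = ∑ r, M.prior r * ∫ y, f (r, y) ∂(M.P i r) := by
  rw [markLaw, integral_finsetSum_measure (integrable_finsetSum_measure.1 hfi)]
  refine Finset.sum_congr rfl fun r _ => ?_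
  rw [integral_smul_measure, ENNReal.toReal_ofReal (M.prior_pos r).le, smul_eq_mul,
    integral_map (by fun_prop) hf.aestronglyMeasurable]

variable [DiscreteMeasurableSpace Z]

lemma integrable_ratio (i j : Z) : Integrable (M.ratio i j) (M.markLaw i) :=
  integrable_finsetSum_measure.2 fun r _ => Integrable.smul_measure
    ((integrable_map_measure (M.measurable_ratio i j).aestronglyMeasurable (by fun_prop)).2
      (M.integrable_ratio_mk i j r)) ENNReal.ofReal_ne_top

lemma integral_ratio_rpow (i j : Z) {t : ℝ} (ht : t ∈ Set.Ioo (0 : ℝ) 1) :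
    ∫ z, M.ratio i j z ^ t ∂(M.markLaw i) = M.hellinger i j (1 - t) := by
  rw [M.integral_markLaw i ((M.measurable_ratio i j).pow_const t) (integrable_rpow_of_mem_Icc
    (M.integrable_ratio i j) (M.ratio_nonneg i j) (Set.Ioo_subset_Icc_self ht))]
  simp only [hellinger, M.integral_ratio_mk_rpow i j _ ht.2, sub_sub_cancel]

lemma not_exactRecovery_of_chDiv_lt (est : M.Estimator) {i j : Z} (hij : i ≠ j)
    (h : M.lam * unitBallVolume M.d * M.chDiv i j < 1) : ¬M.ExactRecovery est := by
  obtain ⟨h0, h1⟩ := M.one_sub_chDiv_mem_Icc i j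
  rw [← sub_sub_cancel 1 (M.chDiv i j)] at h
  rcases h0.eq_or_lt with h0 | h0
  · refine M.not_exactRecovery_of_testingAffinity est hij one_pos ⟨le_rfl, zero_le_one⟩
      (fun T _ => ?_) (by rwa [← mul_assoc, h0])
    rw [one_mul]
    exact zero_pow_card_le_testingAffinity (M.markLaw i) (M.ratio_nonneg i j)
  · obtain ⟨σ, ⟨hσ0, hσ⟩, hlt⟩ := exists_lt_and_mul_one_sub_lt h h0
    have hellinger_ge (t : ℝ) (ht : t ∈ Set.Ioo (0 : ℝ) 1) :
        1 - M.chDiv i j ≤ ∫ z, M.ratio i j z ^ t ∂(M.markLaw i) := by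
      rw [M.integral_ratio_rpow i j ht]
      exact M.one_sub_chDiv_le i j ⟨by linarith [ht.2], by linarith [ht.1]⟩
    obtain ⟨c, hc, hcσ⟩ := exists_mul_pow_le_testingAffinity (M.measurable_ratio i j)
      (M.ratio_nonneg i j) (M.integrable_ratio i j) hσ0.le hσ hellinger_ge
    exact M.not_exactRecovery_of_testingAffinity est hij hc ⟨hσ0.le, hσ.le.trans h1⟩ hcσ
      (by rwa [← mul_assoc])

end GHCMParams

/-! ### Disconnection in dimension one -/

lemma exists_strictMono_comp_of_card_eq {α β : Type*} [LinearOrder β] {s : Finset α} {f : α → β}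
    (hf : Set.InjOn f s) {k : ℕ} (hs : s.card = k) :
    ∃ c : Fin k → α, (∀ i, c i ∈ s) ∧ StrictMono (f ∘ c) := by
  classical
  let e := (s.image f).orderEmbOfFin ((Finset.card_image_of_injOn hf).trans hs)
  choose c hcs hc using fun i => Finset.mem_image.1 (Finset.orderEmbOfFin_mem _ _ i : e i ∈ _)
  exact ⟨c, hcs, (funext hc : f ∘ c = e) ▸ e.strictMono⟩

lemma exists_separated_part {N m : ℕ} {x : Fin N → ℝ} {r : ℝ} {z : Fin (2 * m + 1) → ℝ}
    (hgap : ∀ k l, x l ∉ Set.Ioc (z k) (z k + r)) {f : Fin (2 * m + 1) → Fin N}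
    (hle : ∀ k, x (f k) ≤ z k) (hlt : ∀ k k', k < k' → z k < x (f k')) :
    ∃ A : Finset (Fin N), m ≤ A.card ∧ m ≤ Aᶜ.card ∧
      ∃ k, (∀ u ∈ A, x u ∈ Set.Ioc (z 0) (z k)) ∧ ∀ u ∈ A, ∀ w ∉ A, r < |x u - x w| := by
  classical
  have hf : StrictMono (x ∘ f) := fun k k' hk => (hle k).trans_lt (hlt k k' hk)
  have hz : StrictMono z := fun k k' hk => (hlt k k' hk).trans_le (hle k')
  have hgap (k l) (hl : z k < x l) : z k + r < x l := not_le.1 fun h => hgap k l ⟨hl, h⟩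
  let mid : Fin (2 * m + 1) := ⟨m, by lia⟩
  refine ⟨Finset.univ.filter fun l => x l ∈ Set.Ioc (z 0) (z mid), ?_, ?_, mid, by simp, ?_⟩
  · calc m = (Finset.Ioc 0 mid).card := by simp [mid]
      _ = ((Finset.Ioc 0 mid).image f).card :=
        (Finset.card_image_of_injective _ hf.injective.of_comp).symm
      _ ≤ _ := Finset.card_le_card fun l hl => by
        obtain ⟨k, hk, rfl⟩ := Finset.mem_image.1 hl
        obtain ⟨h0, hk⟩ := Finset.mem_Ioc.1 hk
        simp [hlt 0 k h0, (hle k).trans (hz.monotone hk)]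
  · calc m = (Finset.Ioi mid).card := by simp [mid]; lia
      _ = ((Finset.Ioi mid).image f).card :=
        (Finset.card_image_of_injective _ hf.injective.of_comp).symm
      _ ≤ _ := Finset.card_le_card fun l hl => by
        obtain ⟨k, hk, rfl⟩ := Finset.mem_image.1 hl
        simp [hlt mid k (Finset.mem_Ioi.1 hk)]
  · intro u hu w hw
    obtain ⟨hu0, hu⟩ := (Finset.mem_filter.1 hu).2
    by_cases hw0 : z 0 < x w
    · have := hgap mid w (not_le.1 fun h => hw (by simp [hw0, h]))
      exact lt_abs.2 (.inr (by linarith))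
    · exact lt_abs.2 (.inl (by linarith [hgap 0 u hu0]))

namespace GHCMParams

variable {Z : Type*} [Fintype Z] (M : GHCMParams Z) {n N : ℕ} {ε : ℝ}

/-- Boxes with a corner at a grid point. In dimension one, a point alone in the core with no other
point in the outer box leaves a gap of length `radius n` on its right. -/
noncomputable def boxCell (ε : ℝ) (c : M.GridIndex n) : Cell (Fin M.d → ℝ) where
  core := Set.Icc (M.gridPoint c) fun a => M.gridPoint c a + ε * M.radius n
  outer := Set.Icc (M.gridPoint c) fun a => M.gridPoint c a + (ε + 1) * M.radius n
  measurableSet_core := measurableSet_Icc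
  measurableSet_outer := measurableSet_Icc
  core_subset_outer := Set.Icc_subset_Icc_right fun _ => add_le_add_right
    (mul_le_mul_of_nonneg_right (le_add_of_nonneg_right zero_le_one) (M.radius_nonneg n)) _

lemma volume_real_boxCell_core (hε : 0 ≤ ε) (c : M.GridIndex n) :
    volume.real (M.boxCell ε c).core = ε ^ M.d * Real.log n := by
  have hr := M.radius_nonneg n
  rw [measureReal_def, boxCell,
    Real.volume_Icc_pi_toReal fun a => le_add_of_nonneg_right (by positivity)]
  simp [mul_pow, radius_pow]

lemma volume_real_boxCell_outer (hε : 0 ≤ ε) (c : M.GridIndex n) :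
    volume.real (M.boxCell ε c).outer = (ε + 1) ^ M.d * Real.log n := by
  have hr := M.radius_nonneg n
  rw [measureReal_def, boxCell,
    Real.volume_Icc_pi_toReal fun a => le_add_of_nonneg_right (by positivity)]
  simp [mul_pow, radius_pow]

lemma abs_sub_gridPoint_lt_of_mem_boxCell_outer (hn : 2 ≤ n) (hε : ε < 1) {c : M.GridIndex n}
    {w : Fin M.d → ℝ} (hw : w ∈ (M.boxCell ε c).outer) (a : Fin M.d) :
    |w a - M.gridPoint c a| < 2 * M.radius n := by
  rw [abs_of_nonneg (sub_nonneg.2 (hw.1 a))]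
  refine (sub_le_iff_le_add'.2 (hw.2 a)).trans_lt ?_
  have hr := M.radius_pos hn
  gcongr
  linarith

lemma four_mul_radius_le_gridPoint_sub {c c' : M.GridIndex n} {a : Fin M.d}
    (h : M.gridPoint c a < M.gridPoint c' a) :
    4 * M.radius n ≤ M.gridPoint c' a - M.gridPoint c a := by
  have hne : c' a ≠ c a := fun h0 => h.ne' (by simp only [gridPoint, h0])
  simpa only [abs_of_pos (sub_pos.2 h)] using M.le_abs_gridPoint_sub hne

lemma exists_invisible_cut (hd : M.d = 1) (hn : 2 ≤ n) (h : 32 * M.radius n ≤ M.side n)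
    (hε : 0 ≤ ε) (hε1 : ε < 1) {v : Locations M.d N} (hv : ∀ l, v l ∈ M.cube n)
    {C : Finset (M.GridIndex n)} {m : ℕ} (hC : C.card = 2 * m + 1)
    (hsole : ∀ c ∈ C, ∃ u, v u ∈ (M.boxCell ε c).core ∧ ∀ l ≠ u, v l ∉ (M.boxCell ε c).outer) :
    ∃ A : Finset (Fin N), m ≤ A.card ∧ m ≤ Aᶜ.card ∧
      ∀ u ∈ A, ∀ w ∉ A, ¬M.Visible n (v u) (v w) := by
  have hr := M.radius_pos hn
  have hεr : 0 ≤ ε * M.radius n := by positivity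
  have hεr1 : ε * M.radius n < M.radius n := mul_lt_of_lt_one_left hr hε1
  have : Subsingleton (Fin M.d) := hd ▸ inferInstance
  let a : Fin M.d := ⟨0, M.d_pos⟩
  have hinj : Set.InjOn (fun c => M.gridPoint c a) C := fun c _ c' _ hcc => by
    by_contra hne
    obtain ⟨b, hb⟩ := Function.ne_iff.1 hne
    have hb := M.le_abs_gridPoint_sub hb
    rw [Subsingleton.elim b a, sub_eq_zero.2 hcc, abs_zero] at hb
    linarith
  obtain ⟨c, hcC, hc⟩ := exists_strictMono_comp_of_card_eq hinj hC
  choose f hf hfo using fun k => hsole (c k) (hcC k)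
  have hgap (k l) : v l a ∉ Set.Ioc (M.gridPoint (c k) a + ε * M.radius n)
      (M.gridPoint (c k) a + ε * M.radius n + M.radius n) := fun ⟨hl, hl'⟩ => by
    have hlf : l ≠ f k := fun h0 => hl.not_ge (h0 ▸ (hf k).2 a)
    refine hfo k l hlf ⟨fun b => ?_, fun b => ?_⟩ <;> rw [Subsingleton.elim b a]
    · linarith
    · linarith
  have hsep (k k') (hk : k < k') : M.gridPoint (c k) a + ε * M.radius n < v (f k') a :=
    (by linarith [M.four_mul_radius_le_gridPoint_sub (hc hk)] : _ < M.gridPoint (c k') a).trans_le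
      ((hf k').1 a)
  obtain ⟨A, hA, hAc, k, hAk, hcut⟩ := exists_separated_part hgap (fun k => (hf k).2 a) hsep
  refine ⟨A, hA, hAc, fun u hu w hw huw => (hcut u hu w hw).not_ge ?_⟩
  refine abs_sub_le_of_torusDist_le huw (M.abs_sub_lt_of_mem_cube h ?_ (hv w))
  have hc0 := (M.gridPoint_mem_Icc hn (c 0) a).1
  have hck := (M.gridPoint_mem_Icc hn (c k) a).2
  obtain ⟨hu0, huk⟩ := hAk u hu
  exact ⟨by linarith, by linarith⟩

variable [MeasurableSpace Z] [DiscreteMeasurableSpace Z] (est : M.Estimator)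

lemma not_exactRecovery_of_disconnected (hd : M.d = 1) (hlam : M.lam < 1) {τ : Equiv.Perm Z}
    (hτ : τ ∈ M.permissible) (hτ1 : τ ≠ 1) : ¬M.ExactRecovery est := by
  classical
  obtain ⟨m, hm⟩ := M.exists_pi_labelLaw_not_allLabels_le (ε := 4⁻¹) (by simp)
  refine M.not_exactRecovery_of_gridCells est (K := Nat.card (Equiv.Perm Z) + 1) (σ := 0)
    (T := (2 * m + 1 : ℕ)) (by finiteness) one_pos unitInterval.zero_mem (by simpa using hlam)
    (D := fun ε _ => M.boxCell ε)
    (fun ε hε n c => (M.volume_real_boxCell_core hε.le c).trans (by rw [one_mul]))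
    (fun ε hε n c => (M.volume_real_boxCell_outer hε.le c).trans (by rw [one_mul]))
    (fun ε hε n hn c w => M.abs_sub_gridPoint_lt_of_mem_boxCell_outer hn hε) fun ε hε hε1 => ?_
  filter_upwards [M.eventually_mul_radius_le_side 32, eventually_ge_atTop 2]
    with n h32 hn N v hv hT
  let C : Finset (M.GridIndex n) := {c | (M.boxCell ε c).isolationWeight 0 v ≠ 0}
  have hC : 2 * m + 1 ≤ C.card := by
    have hle : ∑ c : M.GridIndex n, (M.boxCell ε c).isolationWeight 0 v ≤ C.card := by
      rw [← Finset.sum_filter_ne_zero]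
      exact (Finset.sum_le_card_nsmul _ _ 1 fun c _ =>
        (Cell.isolationWeight_mem_Icc unitInterval.zero_mem v).2).trans (by simp [C])
    exact_mod_cast hT.trans hle
  obtain ⟨C', hC', hcard⟩ := Finset.exists_subset_card_eq hC
  have hsole (c) (hc : c ∈ C') : ∃ u, v u ∈ (M.boxCell ε c).core ∧
      ∀ l ≠ u, v l ∉ (M.boxCell ε c).outer := by
    obtain ⟨u, -, hu⟩ :=
      Cell.exists_isolationWeight_eq_isolationTerm (Finset.mem_filter.1 (hC' hc)).2
    exact ⟨u, Cell.mem_core_of_isolationTerm_ne_zero hu, fun l hl =>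
      Cell.notMem_outer_of_discount_ne_zero
        (Cell.discount_ne_zero_of_isolationTerm_ne_zero hu hl)⟩
  obtain ⟨A, hA, hAc, hcut⟩ := M.exists_invisible_cut hd hn h32 hε.le hε1 hv hcard hsole
  exact M.half_le_failGiven_of_disconnected est hτ hτ1 hcut (hm N A hA hAc)

end GHCMParams

theorem theorem1 {Z : Type*} [Fintype Z] [MeasurableSpace Z] [DiscreteMeasurableSpace Z]
    (M : GHCMParams Z)
    (h : (∃ i j : Z, i ≠ j ∧ M.lam * unitBallVolume M.d * M.chDiv i j < 1) ∨
      (M.d = 1 ∧ M.lam < 1 ∧ 2 ≤ M.permissible.ncard))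
    (est : M.Estimator) :
    ¬ M.ExactRecovery est := by
  rcases h with ⟨i, j, hij, h⟩ | ⟨hd, hlam, h⟩
  · exact M.not_exactRecovery_of_chDiv_lt est hij h
  · obtain ⟨τ, hτ, hτ1⟩ := Set.exists_ne_of_one_lt_ncard (s := M.permissible) h 1
    exact M.not_exactRecovery_of_disconnected est hd hlam hτ hτ1
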